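/- Let $M$ be a smooth ($C^\infty$), Hausdorff, paracompact manifold of dimension $d$. A local vector field on $M$ is a smooth vector field $X$ on an open subset of $M$; $\mathrm{Fl}^X_t$ denotes its maximal local flow. Let $D$ be a set of local vector fields that is everywhere defined, i.e. the domains of its elements cover $M$. For $n\ge 1$, $\xi=(X_1,\dots,X_n)\in D^n$ and $T=(t_1,\dots,t_n)\in\mathbb R^n$ put $\xi_T:=\mathrm{Fl}^{X_1}_{t_1}\circ\dots\circ\mathrm{Fl}^{X_n}_{t_n}$, on its maximal domain. The $D$-orbit of $m\in M$ is the set of all $\xi_T(m)$; it is trivial if it equals $\{m\}$. Its natural topology is the finest topology for which all the maps $T\mapsto \xi_T(m)$, on their domains in $\mathbb R^n$, are continuous. A distribution $\Delta$ assigns to each $m\in M$ a linear subspace $\Delta(m)\subseteq T_mM$. Let $\Delta_D(m)$ be the span of all $X(m)$ with $X\in D$ defined at $m$. A distribution is smooth if it is of the form $\Delta_{D'}$ for some everywhere defined $D'$, and $D$-invariant if $T_m\xi_T(\Delta(m))\subseteq\Delta(\xi_T(m))$ for all $\xi\in D^n$, $n\ge1$, $T\in\mathbb R^n$ and all $m$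 in the domain of $\xi_T$. Let $P_D$ be the smallest $D$-invariant distribution containing $\Delta_D$. The set of all local vector fields $X$ with $X(m)\in\Delta(m)$ for all $m$ in the domain of $X$ is denoted by $D_\Delta$, and $\Delta$ is called involutive if $D_\Delta$ is closed under the Lie bracket (taken on the intersection of the domains). An immersive submanifold of $M$ is a subset $S$ with a topology and a $C^\infty$-structure making it a Hausdorff, paracompact manifold of dimension at least $1$ such that the inclusion $S\hookrightarrow M$ is an immersion. It is an integral manifold of $\Delta$ if $T_sS=\Delta(s)$ for all $s\in S$. A maximal integral manifold of $\Delta$ is a connected, non-empty integral manifold $S$ such that every connected integral manifold of $\Delta$ that intersects $S$ is an open submanifold of $S$. A smooth distribution $\Delta$ has the maximal integral manifold property if through each $m\in M$ with $P_{D_\Delta}(m)\neq 0$ there passes a maximal integral manifold of $\Delta$. Then: (i) Every non-trivial $D$-orbit $S$, equipped with its natural topology, admits a unique $C^\infty$-structure for which it is an immersive submanifold of $M$. Its dimension is $\dim P_D(x)$, for every $x\in S$. (ii) With this topology and $C^\infty$-structure, each non-trivial $D$-orbit is a maximal integral manifold of $P_D$; conversely, every maximal integral manifold of $P_D$ is a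 non-trivial $D$-orbit, with this topology and $C^\infty$-structure. (iii) $P_D$ is smooth and has the maximal integral manifold property. (iv) $P_D$ is involutive. -/

import Mathlib

open Set TopologicalSpace
open scoped Manifold ContDiff Topology

noncomputable section

namespace Sussmann

universe u

/-! Throughout, `M` is a `C^∞` manifold of dimension `d`, without boundary. -/

/-- A local vector field on `M`: a smooth vector field on an open (possibly empty) subset `domain`.
The values of `toFun` outside `domain` are never used. -/
structure LocalVectorField (d : ℕ) (M : Type u) [TopologicalSpace M]
    [ChartedSpace (EuclideanSpace ℝ (Fin d)) M] [IsManifold (𝓡 d) ∞ M] where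
  domain : Opens M
  toFun : (x : M) → TangentSpace (𝓡 d) x
  smooth : ContMDiffOn (𝓡 d) (𝓡 d).tangent ∞
    (fun x ↦ (⟨x, toFun x⟩ : TangentBundle (𝓡 d) M)) domain

/-- A distribution (of possibly non-constant rank) assigns to each point a linear subspace of the
tangent space. Containment of distributions is the pointwise order. -/
abbrev Distribution (d : ℕ) (M : Type u) [TopologicalSpace M]
    [ChartedSpace (EuclideanSpace ℝ (Fin d)) M] : Type u :=
  (x : M) → Submodule ℝ (TangentSpace (𝓡 d) x)

section Basic

variable {d : ℕ} {M : Type u} [TopologicalSpace M] [ChartedSpace (EuclideanSpace ℝ (Fin d)) M]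
  [IsManifold (𝓡 d) ∞ M]

/-- The Lie bracket of two local vector fields, on the intersection of their domains. -/
def LocalVectorField.bracket (X Y : LocalVectorField d M) : LocalVectorField d M where
  domain := X.domain ⊓ Y.domain
  toFun := VectorField.mlieBracket (𝓡 d) X.toFun Y.toFun
  smooth := by
    intro x hx
    have hX : ContMDiffAt (𝓡 d) (𝓡 d).tangent ((⊤ : ℕ∞) : WithTop ℕ∞)
        (fun x ↦ (⟨x, X.toFun x⟩ : TangentBundle (𝓡 d) M)) x :=
      (X.smooth x hx.1).contMDiffAt (X.domain.isOpen.mem_nhds hx.1)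
    have hY : ContMDiffAt (𝓡 d) (𝓡 d).tangent ((⊤ : ℕ∞) : WithTop ℕ∞)
        (fun x ↦ (⟨x, Y.toFun x⟩ : TangentBundle (𝓡 d) M)) x :=
      (Y.smooth x hx.2).contMDiffAt (Y.domain.isOpen.mem_nhds hx.2)
    have : IsManifold (𝓡 d) (((⊤ : ℕ∞) : WithTop ℕ∞) + 1) M := by
      have h : (((⊤ : ℕ∞) : WithTop ℕ∞) + 1) = ∞ := rfl
      rw [h]; infer_instance
    have : IsManifold (𝓡 d) (minSmoothness ℝ 2) M := by
      rw [minSmoothness_of_isRCLikeNormedField]; infer_instance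
    exact (hX.mlieBracket_vectorField (m := ⊤) hY (by simp)).contMDiffWithinAt

/-- `γ` restricts to an integral curve of `X`, inside the domain of `X`, on an open interval that
contains `0` and `t`, and it starts at `m` at time `0`. -/
def IsFlowCurve (X : LocalVectorField d M) (t : ℝ) (m : M) (γ : ℝ → M) : Prop :=
  γ 0 = m ∧ ∃ a b : ℝ, 0 ∈ Ioo a b ∧ t ∈ Ioo a b ∧
    IsMIntegralCurveOn (I := 𝓡 d) γ X.toFun (Ioo a b) ∧ ∀ s ∈ Ioo a b, γ s ∈ X.domain

/-- The maximal domain of the flow of `X`, a subset of `ℝ × M`. -/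
def flowDomain (X : LocalVectorField d M) : Set (ℝ × M) :=
  {p | ∃ γ : ℝ → M, IsFlowCurve X p.1 p.2 γ}

open Classical in
/-- The flow `Fl^X_t (m)` of `X`; only its values for `(t, m) ∈ flowDomain X` are meaningful. -/
def flow (X : LocalVectorField d M) (t : ℝ) (m : M) : M :=
  if h : ∃ γ : ℝ → M, IsFlowCurve X t m γ then h.choose t else m

/-- `ξ_T (m) = Fl^{X_1}_{t_1} (Fl^{X_2}_{t_2} (⋯ Fl^{X_n}_{t_n} (m) ⋯))` for `ξ = (X_1, …, X_n)` and
`T = (t_1, …, t_n)`; only its values for `(T, m) ∈ multiflowDomain ξ` are meaningful. -/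
def multiflow : {n : ℕ} → (Fin n → LocalVectorField d M) → (Fin n → ℝ) → M → M
  | 0, _, _, m => m
  | _ + 1, ξ, T, m => flow (ξ 0) (T 0) (multiflow (Fin.tail ξ) (Fin.tail T) m)

/-- The maximal domain of `(T, m) ↦ ξ_T (m)`, a subset of `ℝⁿ × M`. -/
def multiflowDomain : {n : ℕ} → (Fin n → LocalVectorField d M) → Set ((Fin n → ℝ) × M)
  | 0, _ => univ
  | _ + 1, ξ => {p | (Fin.tail p.1, p.2) ∈ multiflowDomain (Fin.tail ξ) ∧
      (p.1 0, multiflow (Fin.tail ξ) (Fin.tail p.1) p.2) ∈ flowDomain (ξ 0)}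

/-- The domain of `T ↦ ξ_T (m)`. -/
def timeDomain {n : ℕ} (ξ : Fin n → LocalVectorField d M) (m : M) : Set (Fin n → ℝ) :=
  {T | (T, m) ∈ multiflowDomain ξ}

/-- The domains of the members of `D` cover `M`. -/
def EverywhereDefined (D : Set (LocalVectorField d M)) : Prop :=
  ∀ m : M, ∃ X ∈ D, m ∈ X.domain

/-- The non-empty finite tuples of members of `D`. -/
def Word (D : Set (LocalVectorField d M)) : Type u :=
  (n : {n : ℕ // 1 ≤ n}) × (Fin n → D)

/-- The length of a tuple. -/
def Word.length {D : Set (LocalVectorField d M)} (w : Word D) : ℕ := w.1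

/-- The vector fields in a tuple. -/
def Word.fields {D : Set (LocalVectorField d M)} (w : Word D) :
    Fin w.length → LocalVectorField d M := fun i ↦ (w.2 i : LocalVectorField d M)

/-- The `D`-orbit of `m`: all points `ξ_T (m)`. -/
def orbit (D : Set (LocalVectorField d M)) (m : M) : Set M :=
  {x | ∃ (w : Word D) (T : Fin w.length → ℝ), T ∈ timeDomain w.fields m ∧
    multiflow w.fields T m = x}

/-- The set `S`, without any topology (in particular without the trace topology of `M`). -/
def Pts (S : Set M) : Type u := {x : M // x ∈ S}

/-- The map `T ↦ ξ_T (m)`, on its domain and with values in the orbit of `m`. -/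
def orbitMap (D : Set (LocalVectorField d M)) (m : M) (w : Word D)
    (T : timeDomain w.fields m) : Pts (orbit D m) :=
  ⟨multiflow w.fields T m, w, T, T.2, rfl⟩

/-- The natural topology on a set `S` which is the orbit of `m`: the finest topology for which all
the maps `T ↦ ξ_T (m)` are continuous. -/
@[reducible]
def orbitTopology (D : Set (LocalVectorField d M)) (m : M) (S : Set M) (h : S = orbit D m) :
    TopologicalSpace (Pts S) :=
  ⨆ w : Word D, TopologicalSpace.coinduced
    (fun T : timeDomain w.fields m ↦ (⟨(orbitMap D m w T).1, h ▸ (orbitMap D m w T).2⟩ : Pts S))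
    inferInstance

/-- The distribution `Δ_D` spanned by `D`. -/
def spanned (D : Set (LocalVectorField d M)) : Distribution d M := fun m ↦
  Submodule.span ℝ {v | ∃ X ∈ D, m ∈ X.domain ∧ X.toFun m = v}

/-- A distribution is smooth if it is spanned by an everywhere defined set of local vector
fields. -/
def Distribution.IsSmooth (Δ : Distribution d M) : Prop :=
  ∃ D : Set (LocalVectorField d M), EverywhereDefined D ∧ Δ = spanned D

/-- The set `D_Δ` of all local vector fields that belong to `Δ`. -/
def Distribution.fields (Δ : Distribution d M) : Set (LocalVectorField d M) :=
  {X | ∀ m ∈ X.domain, X.toFun m ∈ Δ m}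

/-- A distribution is `D`-invariant if it is mapped into itself by the tangent maps of all the
local diffeomorphisms `ξ_T` generated by `D`. -/
def Distribution.IsInvariant (D : Set (LocalVectorField d M)) (Δ : Distribution d M) : Prop :=
  ∀ (w : Word D) (T : Fin w.length → ℝ) (m : M), T ∈ timeDomain w.fields m →
    ∀ v ∈ Δ m, mfderiv (𝓡 d) (𝓡 d) (multiflow w.fields T) m v ∈ Δ (multiflow w.fields T m)

/-- The distribution `P_D`: the smallest `D`-invariant distribution that contains `Δ_D`, that is,
the intersection of all of these. -/
def orbitDistribution (D : Set (LocalVectorField d M)) : Distribution d M :=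
  sInf {Δ | Δ.IsInvariant D ∧ spanned D ≤ Δ}

theorem orbitDistribution_isLeast (D : Set (LocalVectorField d M)) :
    IsLeast {Δ : Distribution d M | Δ.IsInvariant D ∧ spanned D ≤ Δ} (orbitDistribution D) := by
  refine ⟨⟨fun w T m hT v hv ↦ ?_, le_sInf fun Δ hΔ ↦ hΔ.2⟩, fun Δ hΔ ↦ sInf_le hΔ⟩
  simp only [orbitDistribution, sInf_apply, Submodule.mem_iInf] at hv ⊢
  exact fun Δ ↦ Δ.2.1 w T m hT v (hv Δ)

/-- A set of local vector fields is involutive if it is closed under the Lie bracket. -/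
def IsInvolutiveSet (D : Set (LocalVectorField d M)) : Prop :=
  ∀ X ∈ D, ∀ Y ∈ D, X.bracket Y ∈ D

/-- A distribution is involutive if the set of local vector fields belonging to it is. -/
def Distribution.IsInvolutive (Δ : Distribution d M) : Prop :=
  IsInvolutiveSet Δ.fields

/-- The data making the subset `S` of `M` an immersive submanifold of `M`: a topology and a
`C^∞`-structure of some dimension `dim ≥ 1`, Hausdorff and paracompact, for which the inclusion
into `M` is an immersion. -/
structure ImmersiveStructure (d : ℕ) {M : Type u} [TopologicalSpace M]
    [ChartedSpace (EuclideanSpace ℝ (Fin d)) M] [IsManifold (𝓡 d) ∞ M] (S : Set M) where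
  dim : ℕ
  one_le_dim : 1 ≤ dim
  [topology : TopologicalSpace (Pts S)]
  [charts : ChartedSpace (EuclideanSpace ℝ (Fin dim)) (Pts S)]
  [isManifold : IsManifold (𝓡 dim) ∞ (Pts S)]
  [t2 : T2Space (Pts S)]
  [paracompact : ParacompactSpace (Pts S)]
  contMDiff_incl : ContMDiff (𝓡 dim) (𝓡 d) ∞ (fun x : Pts S ↦ x.1)
  injective_mfderiv : ∀ x : Pts S,
    Function.Injective (mfderiv (𝓡 dim) (𝓡 d) (fun x : Pts S ↦ x.1) x)

namespace ImmersiveStructure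

variable {R S : Set M}

/-- The set `S` with the topology and the smooth structure given by `N`. -/
def Carrier (_N : ImmersiveStructure d S) : Type u := Pts S

instance (N : ImmersiveStructure d S) : TopologicalSpace N.Carrier := N.topology

instance (N : ImmersiveStructure d S) :
    ChartedSpace (EuclideanSpace ℝ (Fin N.dim)) N.Carrier := N.charts

instance (N : ImmersiveStructure d S) : IsManifold (𝓡 N.dim) ∞ N.Carrier := N.isManifold

/-- The inclusion map of the submanifold into `M`. -/
def incl (N : ImmersiveStructure d S) : N.Carrier → M := Subtype.val

/-- The inclusion map between two submanifolds of `M`, one of which contains the other as a set. -/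
def inclusion (N : ImmersiveStructure d R) (N' : ImmersiveStructure d S) (h : R ⊆ S) :
    N.Carrier → N'.Carrier := Set.inclusion h

/-- Two submanifold structures on the same set coincide, that is, the identity is a diffeomorphism
between them. -/
def Same (N N' : ImmersiveStructure d S) : Prop :=
  ContMDiff (𝓡 N.dim) (𝓡 N'.dim) ∞ (N.inclusion N' Subset.rfl) ∧
    ContMDiff (𝓡 N'.dim) (𝓡 N.dim) ∞ (N'.inclusion N Subset.rfl)

/-- `N` is an open submanifold of `N'`: the inclusion is defined, and it is a (necessarily
injective) local diffeomorphism, that is, a diffeomorphism onto an open subset. -/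
def IsOpenSubmanifold (N : ImmersiveStructure d R) (N' : ImmersiveStructure d S) : Prop :=
  ∃ h : R ⊆ S, IsLocalDiffeomorph (𝓡 N.dim) (𝓡 N'.dim) ∞ (N.inclusion N' h)

/-- `N` is an integral manifold of `Δ`: its tangent spaces, viewed as subspaces of the tangent
spaces of `M`, are the spaces of `Δ`. -/
def IsIntegral (N : ImmersiveStructure d S) (Δ : Distribution d M) : Prop :=
  ∀ x : N.Carrier, (mfderiv (𝓡 N.dim) (𝓡 d) N.incl x).range = Δ (N.incl x)

/-- `N` is a maximal integral manifold of `Δ`: it is a connected integral manifold, and each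
connected integral manifold that intersects it is an open submanifold of it. -/
def IsMaximalIntegral (N : ImmersiveStructure d S) (Δ : Distribution d M) : Prop :=
  ConnectedSpace N.Carrier ∧ N.IsIntegral Δ ∧
    ∀ (R : Set M) (N' : ImmersiveStructure d R), ConnectedSpace N'.Carrier → N'.IsIntegral Δ →
      (R ∩ S).Nonempty → N'.IsOpenSubmanifold N

end ImmersiveStructure

/-- Through each point `m` at which the smallest `D_Δ`-invariant distribution containing `Δ_{D_Δ}`
does not vanish there passes a maximal integral manifold of `Δ`. -/
def Distribution.HasMaximalIntegralManifolds (Δ : Distribution d M) : Prop :=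
  ∀ m : M, orbitDistribution Δ.fields m ≠ ⊥ →
    ∃ (S : Set M) (N : ImmersiveStructure d S), m ∈ S ∧ N.IsMaximalIntegral Δ

end Basic

end Sussmann

end

/-!
Local flows are smooth because a reparametrized integral curve is a zero of a smooth operator on
continuous curves over `[0, 1]`, to which the inverse function theorem applies. The distribution
`P_D` is spanned by the images of members of `D` under compositions of flows, so that it is
smooth and its rank `k` is constant along orbits. Given a point of an orbit, choose `k` of these
generators that are independent there: following their flows one after the other gives an injective
immersion of an open subset of `ℝᵏ`, a plaque, which lies in the orbit and is tangent to `P_D`.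

The key point is that a smooth map `g` which meets a plaque, is tangent to `P_D`, and stays where
`P_D` has rank `k`, factors locally and smoothly through the plaque: a smooth local frame of `P_D`
is tangent to the plaque, so the transverse component of `g` satisfies a linear differential
inequality and vanishes. Hence the plaques are the charts of a smooth structure on the orbit which
induces the natural topology, this structure is unique, and integral manifolds of `P_D` that meet
the orbit are open in it if they are connected. The orbit is paracompact by the Poincaré–Volterra
theorem. Finally, `P_D` is involutive because brackets of fields tangent to an immersed manifold
are tangent to it.
-/

open Set TopologicalSpace
open scoped Manifold ContDiff Topology

noncomputable section

namespace Sussmann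

universe u

section SuperpositionOperator

variable {K : Type*} [TopologicalSpace K] [CompactSpace K]
  {E F : Type u} [NormedAddCommGroup E] [NormedSpace ℝ E] [NormedAddCommGroup F] [NormedSpace ℝ F]

/-- Pointwise evaluation of a continuous family of linear maps at a continuous family of vectors,
as a bounded bilinear map; the derivative of `γ ↦ f ∘ γ` is expressed through it. -/
def pointwiseApply (K : Type*) [TopologicalSpace K] [CompactSpace K] (E F : Type*)
    [NormedAddCommGroup E] [NormedSpace ℝ E] [NormedAddCommGroup F] [NormedSpace ℝ F] :
    C(K, E →L[ℝ] F) →L[ℝ] C(K, E) →L[ℝ] C(K, F) :=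
  LinearMap.mkContinuous₂
    (LinearMap.mk₂ ℝ (fun (A : C(K, E →L[ℝ] F)) (h : C(K, E)) ↦
        (⟨fun t ↦ A t (h t), A.continuous.clm_apply h.continuous⟩ : C(K, F)))
      (fun _ _ _ ↦ by ext; simp) (fun _ _ _ ↦ by ext; simp)
      (fun _ _ _ ↦ by ext; simp) (fun _ _ _ ↦ by ext; simp)) 1 fun A h ↦ by
    rw [one_mul, ContinuousMap.norm_le _ (by positivity)]
    exact fun t ↦ (A t).le_of_opNorm_le_of_le (A.norm_coe_le_norm t) (h.norm_coe_le_norm t)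

lemma hasFDerivAt_postcomp (f : C(E, F)) (f' : C(E, E →L[ℝ] F))
    (hf : ∀ x, HasFDerivAt f (f' x) x) (γ : C(K, E)) :
    HasFDerivAt (fun γ : C(K, E) ↦ f.comp γ) (pointwiseApply K E F (f'.comp γ)) γ := by
  rw [hasFDerivAt_iff_isLittleO, Asymptotics.isLittleO_iff]
  intro c hc
  have hcont : ContinuousAt (fun γ : C(K, E) ↦ f'.comp γ) γ :=
    (ContinuousMap.continuous_postcomp f').continuousAt
  obtain ⟨δ, hδ, hf'δ⟩ :=
    (Metric.continuousAt_iff (f := fun γ : C(K, E) ↦ f'.comp γ) (a := γ)).1 hcont c hc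
  filter_upwards [Metric.ball_mem_nhds γ hδ] with γ' hγ'
  rw [ContinuousMap.norm_le _ (by positivity)]
  intro t
  have hderiv : ∀ x ∈ segment ℝ (γ t) (γ' t), ‖f' x - f' (γ t)‖ ≤ c := by
    rw [segment_eq_image']
    rintro _ ⟨s, hs, rfl⟩
    have hmem : dist (γ + s • (γ' - γ)) γ < δ := by
      rw [dist_eq_norm, add_sub_cancel_left, norm_smul, Real.norm_of_nonneg hs.1]
      calc s * ‖γ' - γ‖ ≤ 1 * ‖γ' - γ‖ := by gcongr; exact hs.2
        _ < δ := by rw [one_mul, ← dist_eq_norm]; exact hγ'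
    have hdist := (ContinuousMap.dist_apply_le_dist (f := f'.comp (γ + s • (γ' - γ)))
      (g := f'.comp γ) t).trans (hf'δ hmem).le
    rwa [dist_eq_norm] at hdist
  calc ‖f (γ' t) - f (γ t) - f' (γ t) (γ' t - γ t)‖ ≤ c * ‖γ' t - γ t‖ :=
        (convex_segment _ _).norm_image_sub_le_of_norm_hasFDerivWithin_le'
          (fun x _ ↦ (hf x).hasFDerivWithinAt) hderiv (left_mem_segment _ _ _)
          (right_mem_segment _ _ _)
    _ ≤ c * ‖γ' - γ‖ := by gcongr; exact (γ' - γ).norm_coe_le_norm t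

lemma contDiff_postcomp (n : ℕ) (f : C(E, F)) (hf : ContDiff ℝ n f) :
    ContDiff ℝ n (fun γ : C(K, E) ↦ f.comp γ) := by
  induction n generalizing F with
  | zero =>
    rw [Nat.cast_zero, contDiff_zero]
    exact ContinuousMap.continuous_postcomp f
  | succ n ih =>
    rw [Nat.cast_succ] at hf ⊢
    obtain ⟨hd, -, hf'⟩ := contDiff_succ_iff_fderiv.1 hf
    let f' : C(E, E →L[ℝ] F) := ⟨fderiv ℝ f, hf'.continuous⟩
    exact contDiff_succ_iff_hasFDerivAt.2
      ⟨_, (pointwiseApply K E F).contDiff.comp (ih f' hf'),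
        hasFDerivAt_postcomp f f' fun x ↦ (hd x).hasFDerivAt⟩

end SuperpositionOperator

section InverseFunction

variable {E F : Type*} [NormedAddCommGroup E] [NormedSpace ℝ E] [NormedAddCommGroup F]
  [NormedSpace ℝ F] [CompleteSpace E]

/- Mathlib's inverse function theorem gives smoothness of the inverse at one point only. -/
lemma exists_openPartialHomeomorph_contDiffOn_symm {f : E → F} {U : Set E} (hU : IsOpen U)
    (hf : ContDiffOn ℝ ∞ f U) {a : E} (ha : a ∈ U) (f' : E ≃L[ℝ] F)
    (hf' : HasFDerivAt f (f' : E →L[ℝ] F) a) :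
    ∃ e : OpenPartialHomeomorph E F, a ∈ e.source ∧ e.source ⊆ U ∧ (e : E → F) = f ∧
      ContDiffOn ℝ ∞ e.symm e.target := by
  have hfU : ∀ x ∈ U, ContDiffAt ℝ ∞ f x := fun x hx ↦ hf.contDiffAt (hU.mem_nhds hx)
  have h0 : (∞ : WithTop ℕ∞) ≠ 0 := by simp
  let V := U ∩ fderiv ℝ f ⁻¹' range ((↑) : (E ≃L[ℝ] F) → E →L[ℝ] F)
  have hV : IsOpen V := (hf.continuousOn_fderiv_of_isOpen hU (by simp)).isOpen_inter_preimage hU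
    ContinuousLinearEquiv.isOpen
  let e := ((hfU a ha).toOpenPartialHomeomorph f hf' h0).restrOpen V hV
  refine ⟨e, ⟨(hfU a ha).mem_toOpenPartialHomeomorph_source hf' h0, ha, f', hf'.fderiv.symm⟩,
    fun x hx ↦ hx.2.1, (hfU a ha).toOpenPartialHomeomorph_coe hf' h0, fun y hy ↦ ?_⟩
  obtain ⟨-, hyU, A, hA⟩ := e.map_target hy
  refine (e.contDiffAt_symm (f₀' := A) hy ?_ (hfU _ hyU)).contDiffWithinAt
  rw [hA]
  exact ((hfU _ hyU).differentiableAt h0).hasFDerivAt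

/- Applied to `(p, b) ↦ (p, b - G (p, b))`, the inverse function theorem shows that the fixed
points of `G (p, ·)` near `b₀` depend smoothly on `p`. -/
lemma exists_contDiffOn_fixedPoint {P B : Type*} [NormedAddCommGroup P] [NormedSpace ℝ P]
    [CompleteSpace P] [NormedAddCommGroup B] [NormedSpace ℝ B] [CompleteSpace B]
    {G : P × B → B} (hG : ContDiff ℝ ∞ G) {p₀ : P} {b₀ : B} (L : P →L[ℝ] B)
    (hL : HasFDerivAt G (L.comp (ContinuousLinearMap.fst ℝ P B)) (p₀, b₀)) :
    ∃ N ∈ 𝓝 (p₀, b₀), ∃ (V : Set P) (ψ : P → B), ContDiffOn ℝ ∞ ψ V ∧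
      ∀ q ∈ N, G q = q.2 → q.1 ∈ V ∧ ψ q.1 = q.2 := by
  let H : P × B → P × B := fun q ↦ (q.1, q.2 - G q)
  let T : (P × B) ≃L[ℝ] (P × B) :=
    (ContinuousLinearEquiv.refl ℝ P).skewProd (ContinuousLinearEquiv.refl ℝ B) (-L)
  have hH : HasFDerivAt H (T : (P × B) →L[ℝ] (P × B)) (p₀, b₀) := by
    refine (hasFDerivAt_fst.prodMk (hasFDerivAt_snd.sub hL)).congr_fderiv ?_
    exact ContinuousLinearMap.ext fun q ↦ Prod.ext rfl (by simp [T, sub_eq_add_neg])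
  obtain ⟨e, he₀, -, heH, he⟩ := exists_openPartialHomeomorph_contDiffOn_symm isOpen_univ
    (contDiff_fst.prodMk (contDiff_snd.sub hG)).contDiffOn (mem_univ _) T hH
  refine ⟨e.source, e.open_source.mem_nhds he₀, {p | (p, 0) ∈ e.target},
    fun p ↦ (e.symm (p, 0)).2, contDiff_snd.comp_contDiffOn
      (he.comp (contDiff_id.prodMk contDiff_const).contDiffOn fun p hp ↦ hp), fun q hq hGq ↦ ?_⟩
  have heq : e q = (q.1, 0) := by rw [heH]; exact Prod.ext rfl (by simp [hGq])
  refine ⟨?_, ?_⟩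
  · change (q.1, 0) ∈ e.target
    exact heq ▸ e.map_source hq
  · change (e.symm (q.1, 0)).2 = q.2
    rw [← heq, e.left_inv hq]

end InverseFunction

section SmoothFlow

open scoped unitInterval

variable {E : Type u} [NormedAddCommGroup E] [NormedSpace ℝ E]

/-- The operator sending a continuous curve on `[0, 1]` to its primitive vanishing at `0`. -/
def primitive (E : Type*) [NormedAddCommGroup E] [NormedSpace ℝ E] : C(I, E) →L[ℝ] C(I, E) :=
  LinearMap.mkContinuous
    { toFun := fun γ ↦ ⟨fun t ↦ ∫ s in (0 : ℝ)..t, γ (projIcc 0 1 zero_le_one s),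
        (intervalIntegral.continuous_primitive (fun _ _ ↦
          (γ.continuous.comp continuous_projIcc).intervalIntegrable _ _) 0).comp
          continuous_subtype_val⟩
      map_add' := fun γ γ' ↦ by
        ext t
        exact intervalIntegral.integral_add
          ((γ.continuous.comp continuous_projIcc).intervalIntegrable _ _)
          ((γ'.continuous.comp continuous_projIcc).intervalIntegrable _ _)
      map_smul' := fun c γ ↦ by
        ext t
        exact intervalIntegral.integral_smul _ _ } 1 fun γ ↦ by
    rw [one_mul, ContinuousMap.norm_le _ (norm_nonneg _)]
    intro t
    refine (intervalIntegral.norm_integral_le_of_norm_le_const (C := ‖γ‖)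
      (fun s _ ↦ γ.norm_coe_le_norm _)).trans ?_
    rw [sub_zero, abs_of_nonneg t.2.1]
    exact mul_le_of_le_one_right (norm_nonneg _) t.2.2

/-- The Picard operator `γ ↦ x + l ∫₀ᵗ f (γ s) ds` on curves over `[0, 1]`, with parameters
`(x, l)`. A solution of `y' = f y`, `y 0 = x` gives the fixed point `t ↦ y (l t)`: by this
rescaling, time becomes a parameter in the same way as the initial value. -/
def picardMap (f : C(E, E)) (p : (E × ℝ) × C(I, E)) : C(I, E) :=
  ContinuousLinearMap.const ℝ I p.1.1 + p.1.2 • primitive E (f.comp p.2)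

lemma contDiff_primitive_postcomp (f : C(E, E)) (hf : ContDiff ℝ ∞ f) :
    ContDiff ℝ ∞ (fun γ : C(I, E) ↦ primitive E (f.comp γ)) :=
  (primitive E).contDiff.comp <|
    contDiff_infty.2 fun n ↦ contDiff_postcomp n f (contDiff_infty.1 hf n)

lemma contDiff_picardMap (f : C(E, E)) (hf : ContDiff ℝ ∞ f) : ContDiff ℝ ∞ (picardMap f) :=
  ((ContinuousLinearMap.const ℝ I).contDiff.comp (contDiff_fst.comp contDiff_fst)).add <|
    (contDiff_snd.comp contDiff_fst).smul ((contDiff_primitive_postcomp f hf).comp contDiff_snd)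

lemma hasFDerivAt_picardMap (f : C(E, E)) (hf : ContDiff ℝ ∞ f) (x₀ : E) (γ₀ : C(I, E)) :
    HasFDerivAt (picardMap f)
      (((ContinuousLinearMap.const ℝ I).comp (ContinuousLinearMap.fst ℝ E ℝ) +
        (ContinuousLinearMap.snd ℝ E ℝ).smulRight (primitive E (f.comp γ₀))).comp
          (ContinuousLinearMap.fst ℝ (E × ℝ) C(I, E)))
      ((x₀, 0), γ₀) := by
  have hprim : DifferentiableAt ℝ (fun p : (E × ℝ) × C(I, E) ↦ primitive E (f.comp p.2))
      ((x₀, 0), γ₀) :=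
    ((contDiff_primitive_postcomp f hf).comp contDiff_snd).differentiable (by simp) _
  have hconst := ((ContinuousLinearMap.const ℝ I).comp ((ContinuousLinearMap.fst ℝ E ℝ).comp
    (ContinuousLinearMap.fst ℝ (E × ℝ) C(I, E)))).hasFDerivAt (x := ((x₀, (0 : ℝ)), γ₀))
  have hscale := ((ContinuousLinearMap.snd ℝ E ℝ).comp
    (ContinuousLinearMap.fst ℝ (E × ℝ) C(I, E))).hasFDerivAt (x := ((x₀, (0 : ℝ)), γ₀))
  refine (hconst.add (hscale.smul hprim.hasFDerivAt)).congr_fderiv ?_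
  ext p <;> simp

lemma exists_contDiff_eqOn_ball {F : Type*} [NormedAddCommGroup F] [NormedSpace ℝ F]
    [HasContDiffBump E] {f : E → F} {U : Set E} (hU : IsOpen U) (hf : ContDiffOn ℝ ∞ f U)
    {x₀ : E} (hx₀ : x₀ ∈ U) :
    ∃ r > 0, Metric.ball x₀ r ⊆ U ∧ ∃ g : E → F, ContDiff ℝ ∞ g ∧ EqOn g f (Metric.ball x₀ r) := by
  obtain ⟨r, hr, hrU⟩ := Metric.isOpen_iff.1 hU x₀ hx₀
  let χ : ContDiffBump x₀ := ⟨r / 3, r / 2, by positivity, by linarith⟩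
  refine ⟨r / 3, by positivity, (Metric.ball_subset_ball (by linarith)).trans hrU,
    fun x ↦ χ x • f x, ?_, fun x hx ↦ ?_⟩
  · rw [← contMDiff_iff_contDiff]
    refine contMDiff_of_tsupport fun x hx ↦ ContDiffAt.contMDiffAt ?_
    have hxχ : x ∈ Metric.closedBall x₀ (r / 2) :=
      χ.tsupport_eq ▸ tsupport_smul_subset_left _ _ hx
    have hxU : x ∈ U := hrU (Metric.closedBall_subset_ball (half_lt_self hr) hxχ)
    exact χ.contDiffAt.smul (hf.contDiffAt (hU.mem_nhds hxU))
  · simp only [χ.one_of_mem_closedBall (Metric.ball_subset_closedBall hx), one_smul]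

variable [CompleteSpace E]

lemma picardMap_eq_of_hasDerivAt (f : C(E, E)) {x : E} {l : ℝ} {y : ℝ → E} (hy₀ : y 0 = x)
    (hy : ∀ s ∈ I, HasDerivAt y (f (y (l * s))) (l * s)) {γ : C(I, E)}
    (hγ : ∀ t : I, γ t = y (l * t)) : picardMap f ((x, l), γ) = γ := by
  ext t
  change x + l • ∫ s in (0 : ℝ)..t, f (γ (projIcc 0 1 zero_le_one s)) = γ t
  have hint : ∫ s in (0 : ℝ)..t, l • f (γ (projIcc 0 1 zero_le_one s)) =
      y (l * t) - y (l * 0) := by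
    refine intervalIntegral.integral_eq_sub_of_hasDerivAt (f := fun s ↦ y (l * s)) (fun s hs ↦ ?_)
      ((continuous_const.smul (f.continuous.comp
        (γ.continuous.comp continuous_projIcc))).intervalIntegrable _ _)
    rw [uIcc_of_le t.2.1] at hs
    have hsI : s ∈ I := ⟨hs.1, hs.2.trans t.2.2⟩
    rw [projIcc_of_mem _ hsI, hγ]
    have hder := (hy s hsI).scomp s ((hasDerivAt_id s).const_mul l)
    rwa [mul_one] at hder
  rw [← intervalIntegral.integral_smul, hint, mul_zero, hy₀, hγ, add_sub_cancel]

lemma exists_flow_of_contDiffAt_one {f : E → E} {x₀ : E} (hf : ContDiffAt ℝ 1 f x₀) :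
    ∃ δ > 0, ∃ α : E × ℝ → E, ContinuousOn α (Metric.ball x₀ δ ×ˢ Ioo (-δ) δ) ∧
      ∀ x ∈ Metric.ball x₀ δ, α (x, 0) = x ∧
        ∀ t ∈ Ioo (-δ) δ, HasDerivAt (fun s ↦ α (x, s)) (f (α (x, t))) t := by
  obtain ⟨ε, hε, a, r, _, _, hr, hf⟩ := IsPicardLindelof.of_contDiffAt_one hf
  obtain ⟨α, hα, hαc⟩ := (hf 0).exists_forall_mem_closedBall_eq_hasDerivWithinAt_continuousOn
  simp only [zero_sub, zero_add] at hα hαc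
  have hball : Metric.ball x₀ (min r ε) ⊆ Metric.closedBall x₀ r :=
    Metric.ball_subset_closedBall.trans (Metric.closedBall_subset_closedBall (min_le_left _ _))
  have hIoo : Ioo (-min (r : ℝ) ε) (min r ε) ⊆ Ioo (-ε) ε :=
    Ioo_subset_Ioo (neg_le_neg (min_le_right _ _)) (min_le_right _ _)
  exact ⟨min r ε, lt_min hr hε, α,
    hαc.mono (prod_mono hball (hIoo.trans Ioo_subset_Icc_self)), fun x hx ↦
      ⟨(hα x (hball hx)).1, fun t ht ↦ ((hα x (hball hx)).2 t
        (Ioo_subset_Icc_self (hIoo ht))).hasDerivAt (Icc_mem_nhds (hIoo ht).1 (hIoo ht).2)⟩⟩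

lemma exists_flow_dist_lt {f : E → E} {x₀ : E} (hf : ContDiffAt ℝ 1 f x₀) {ρ : ℝ} (hρ : 0 < ρ) :
    ∃ δ > 0, δ ≤ ρ ∧ ∃ α : E × ℝ → E, ∀ x ∈ Metric.ball x₀ δ, α (x, 0) = x ∧
      ∀ t ∈ Ioo (-δ) δ, dist (α (x, t)) x₀ < ρ ∧
        HasDerivAt (fun s ↦ α (x, s)) (f (α (x, t))) t := by
  obtain ⟨δ₀, hδ₀, α, hαc, hα⟩ := exists_flow_of_contDiffAt_one hf
  have hα₀ : ContinuousAt α (x₀, 0) := hαc.continuousAt (prod_mem_nhds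
    (Metric.ball_mem_nhds _ hδ₀) (Ioo_mem_nhds (neg_lt_zero.2 hδ₀) hδ₀))
  obtain ⟨δ₁, hδ₁, hαδ₁⟩ := Metric.continuousAt_iff.1 hα₀ ρ hρ
  rw [(hα x₀ (Metric.mem_ball_self hδ₀)).1] at hαδ₁
  let δ := min δ₀ (min δ₁ ρ)
  have hδδ₀ : δ ≤ δ₀ := min_le_left _ _
  have hδδ₁ : δ ≤ δ₁ := (min_le_right _ _).trans (min_le_left _ _)
  refine ⟨δ, lt_min hδ₀ (lt_min hδ₁ hρ), (min_le_right _ _).trans (min_le_right _ _), α,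
    fun x hx ↦ ?_⟩
  have hαx := hα x (Metric.ball_subset_ball hδδ₀ hx)
  refine ⟨hαx.1, fun t ht ↦
    ⟨hαδ₁ ?_, hαx.2 t (Ioo_subset_Ioo (neg_le_neg hδδ₀) hδδ₀ ht)⟩⟩
  rw [Prod.dist_eq, Real.dist_0_eq_abs]
  exact max_lt (hx.trans_le hδδ₁) ((abs_lt.2 ht).trans_le hδδ₁)

theorem exists_contDiffOn_flow_dist_lt {f : E → E} (hf : ContDiff ℝ ∞ f) (x₀ : E) {r : ℝ}
    (hr : 0 < r) :
    ∃ δ > 0, ∃ α : E × ℝ → E, ContDiffOn ℝ ∞ α (Metric.ball x₀ δ ×ˢ Ioo (-δ) δ) ∧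
      ∀ x ∈ Metric.ball x₀ δ, α (x, 0) = x ∧ ∀ t ∈ Ioo (-δ) δ, dist (α (x, t)) x₀ < r ∧
        HasDerivAt (fun s ↦ α (x, s)) (f (α (x, t))) t := by
  let fc : C(E, E) := ⟨f, hf.continuous⟩
  obtain ⟨N, hN, V, ψ, hψ, hψN⟩ := exists_contDiffOn_fixedPoint (contDiff_picardMap fc hf) _
    (hasFDerivAt_picardMap fc hf x₀ (ContinuousMap.const I x₀))
  obtain ⟨ρ, hρ, hρN⟩ := Metric.mem_nhds_iff.1 hN
  obtain ⟨δ, hδ, hδρ, α, hα⟩ := exists_flow_dist_lt (hf.contDiffAt.of_le (by simp))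
    (lt_min hr (half_pos hρ))
  replace hδρ : δ < ρ := (hδρ.trans (min_le_right _ _)).trans_lt (half_lt_self hρ)
  refine ⟨δ, hδ, α, ?_, fun x hx ↦ ⟨(hα x hx).1, fun t ht ↦
    ⟨((hα x hx).2 t ht).1.trans_le (min_le_left _ _), ((hα x hx).2 t ht).2⟩⟩⟩
  have hmul : ∀ l ∈ Ioo (-δ) δ, ∀ s ∈ I, l * s ∈ Ioo (-δ) δ := fun l hl s hs ↦ by
    rw [mem_Ioo, ← abs_lt, abs_mul, abs_of_nonneg hs.1]
    exact (mul_le_of_le_one_right (abs_nonneg _) hs.2).trans_lt (abs_lt.2 hl)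
  have hsol : ∀ p ∈ Metric.ball x₀ δ ×ˢ Ioo (-δ) δ, p ∈ V ∧ ψ p 1 = α p := by
    rintro ⟨x, l⟩ ⟨hx, hl⟩
    have hαl : ∀ s ∈ I, dist (α (x, l * s)) x₀ < min r (ρ / 2) ∧ HasDerivAt (fun s ↦ α (x, s))
        (f (α (x, l * s))) (l * s) := fun s hs ↦ (hα x hx).2 _ (hmul l hl s hs)
    let γ : C(I, E) := ⟨fun t ↦ α (x, l * t), continuous_iff_continuousAt.2 fun t ↦
      (hαl t t.2).2.continuousAt.comp (f := fun t : I ↦ l * (t : ℝ)) (by fun_prop)⟩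
    have hγ : dist γ (ContinuousMap.const I x₀) < ρ :=
      ((ContinuousMap.dist_le (f := γ) (g := ContinuousMap.const I x₀) (half_pos hρ).le).2
        fun t ↦ ((hαl t t.2).1.trans_le (min_le_right _ _)).le).trans_lt (half_lt_self hρ)
    have hl₀ : dist l 0 < ρ := by
      rw [Real.dist_0_eq_abs]
      exact (abs_lt.2 hl).trans hδρ
    obtain ⟨hV, hψγ⟩ := hψN _ (hρN (max_lt (max_lt (hx.trans hδρ) hl₀) hγ))
      (picardMap_eq_of_hasDerivAt fc (hα x hx).1 (fun s hs ↦ (hαl s hs).2) fun _ ↦ rfl)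
    refine ⟨hV, ?_⟩
    rw [hψγ]
    exact congrArg (fun t ↦ α (x, t)) (mul_one l)
  have heval : ContDiffOn ℝ ∞ (fun p ↦ ψ p 1) (Metric.ball x₀ δ ×ˢ Ioo (-δ) δ) :=
    (ContinuousMap.evalCLM ℝ (1 : I) : C(I, E) →L[ℝ] E).contDiff.comp_contDiffOn
      (hψ.mono fun p hp ↦ (hsol p hp).1)
  exact heval.congr fun p hp ↦ (hsol p hp).2.symm

theorem exists_contDiffOn_flow [HasContDiffBump E] {f : E → E} {U : Set E} (hU : IsOpen U)
    (hf : ContDiffOn ℝ ∞ f U) {x₀ : E} (hx₀ : x₀ ∈ U) :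
    ∃ δ > 0, ∃ α : E × ℝ → E, ContDiffOn ℝ ∞ α (Metric.ball x₀ δ ×ˢ Ioo (-δ) δ) ∧
      ∀ x ∈ Metric.ball x₀ δ, α (x, 0) = x ∧ ∀ t ∈ Ioo (-δ) δ, α (x, t) ∈ U ∧
        HasDerivAt (fun s ↦ α (x, s)) (f (α (x, t))) t := by
  obtain ⟨r, hr, hrU, g, hg, hgf⟩ := exists_contDiff_eqOn_ball hU hf hx₀
  obtain ⟨δ, hδ, α, hα, hαg⟩ := exists_contDiffOn_flow_dist_lt hg x₀ hr
  refine ⟨δ, hδ, α, hα, fun x hx ↦ ⟨(hαg x hx).1, fun t ht ↦ ?_⟩⟩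
  obtain ⟨hαr, hαt⟩ := (hαg x hx).2 t ht
  exact ⟨hrU hαr, hgf hαr ▸ hαt⟩

end SmoothFlow

section Straightening

variable {E F G C : Type*} [NormedAddCommGroup E] [NormedSpace ℝ E]
  [NormedAddCommGroup F] [NormedSpace ℝ F] [NormedAddCommGroup G] [NormedSpace ℝ G]
  [NormedAddCommGroup C] [NormedSpace ℝ C]

lemma exists_straightening [FiniteDimensional ℝ E] [FiniteDimensional ℝ F] {φ : F → E} {U : Set F}
    (hU : IsOpen U) (hφ : ContDiffOn ℝ ∞ φ U) {u₀ : F} (hu₀ : u₀ ∈ U)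
    (hinj : Function.Injective (fderiv ℝ φ u₀)) :
    ∃ (C : Submodule ℝ E) (e : OpenPartialHomeomorph (F × C) E), (u₀, 0) ∈ e.source ∧
      (∀ p ∈ e.source, p.1 ∈ U) ∧ (∀ p, e p = φ p.1 + p.2) ∧ ContDiffOn ℝ ∞ e.symm e.target := by
  obtain ⟨C, hC⟩ := Submodule.exists_isCompl (LinearMap.range (fderiv ℝ φ u₀).toLinearMap)
  let A : (F × C) ≃L[ℝ] E := (((LinearEquiv.ofInjective _ hinj).prodCongr
    (LinearEquiv.refl ℝ C)).trans (Submodule.prodEquivOfIsCompl _ C hC)).toContinuousLinearEquiv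
  have hdiff : DifferentiableAt ℝ φ u₀ :=
    (hφ.contDiffAt (hU.mem_nhds hu₀)).differentiableAt (by simp)
  have hA : HasFDerivAt (fun p : F × C ↦ φ p.1 + (p.2 : E)) (A : F × C →L[ℝ] E) (u₀, 0) := by
    refine ((HasFDerivAt.comp (f := Prod.fst) (g := φ) (u₀, (0 : C)) hdiff.hasFDerivAt
      hasFDerivAt_fst).add
        (C.subtypeL.comp (ContinuousLinearMap.snd ℝ F C)).hasFDerivAt).congr_fderiv ?_
    exact ContinuousLinearMap.ext fun p ↦ rfl
  have hsmooth : ContDiffOn ℝ ∞ (fun p : F × C ↦ φ p.1 + (p.2 : E)) (U ×ˢ univ) :=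
    (hφ.comp contDiff_fst.contDiffOn fun p hp ↦ hp.1).add
      (C.subtypeL.contDiff.comp contDiff_snd).contDiffOn
  have : CompleteSpace (F × C) := FiniteDimensional.complete ℝ (F × C)
  obtain ⟨e, he₀, heU, heφ, he⟩ := exists_openPartialHomeomorph_contDiffOn_symm
    (hU.prod isOpen_univ) hsmooth (a := (u₀, 0)) ⟨hu₀, trivial⟩ A hA
  exact ⟨C, e, he₀, fun p hp ↦ (heU hp).1, fun p ↦ congrFun heφ p, he⟩

lemma exists_contDiffAt_leftInverse [FiniteDimensional ℝ E] [FiniteDimensional ℝ F] {φ : F → E}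
    {U : Set F} (hU : IsOpen U) (hφ : ContDiffOn ℝ ∞ φ U) {u₀ : F} (hu₀ : u₀ ∈ U)
    (hinj : Function.Injective (fderiv ℝ φ u₀)) :
    ∃ r : E → F, ContDiffAt ℝ ∞ r (φ u₀) ∧ ∀ᶠ u in 𝓝 u₀, r (φ u) = u := by
  obtain ⟨C, e, he₀, -, heφ, he⟩ := exists_straightening hU hφ hu₀ hinj
  have hφe : ∀ u, e (u, 0) = φ u := fun u ↦ by simp [heφ]
  refine ⟨fun x ↦ (e.symm x).1, ?_, ?_⟩
  · refine contDiff_fst.contDiffAt.comp _ (he.contDiffAt (e.open_target.mem_nhds ?_))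
    exact hφe u₀ ▸ e.map_source he₀
  · have hsource : ∀ᶠ u in 𝓝 u₀, ((u, 0) : F × C) ∈ e.source :=
      (Continuous.prodMk_left (0 : C)).continuousAt (e.open_source.mem_nhds he₀)
    filter_upwards [hsource] with u hu
    rw [← hφe, e.left_inv hu]

lemma eventually_norm_le_of_injective [FiniteDimensional ℝ F] {Z : Type*} [TopologicalSpace Z]
    {A : Z → F →L[ℝ] E} {z₀ : Z} (hA : ContinuousAt A z₀) (hinj : Function.Injective (A z₀)) :
    ∃ κ > 0, ∀ᶠ z in 𝓝 z₀, ∀ ζ, ‖ζ‖ ≤ κ * ‖A z ζ‖ := by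
  obtain ⟨κ, hκ, hanti⟩ := (A z₀).toLinearMap.exists_antilipschitzWith
    (LinearMap.ker_eq_bot.2 hinj)
  have : (0 : ℝ) < κ := hκ
  refine ⟨2 * κ, by positivity, ?_⟩
  filter_upwards [Metric.continuousAt_iff'.1 hA (1 / (2 * κ)) (by positivity)] with z hz ζ
  have hsub : ‖(A z - A z₀) ζ‖ ≤ 1 / (2 * κ) * ‖ζ‖ :=
    (A z - A z₀).le_of_opNorm_le (dist_eq_norm (A z) (A z₀) ▸ hz.le) ζ
  have hle : ‖ζ‖ ≤ κ * ‖A z ζ‖ + ‖ζ‖ / 2 :=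
    calc ‖ζ‖ ≤ κ * ‖A z₀ ζ‖ := by simpa only [dist_zero_right, map_zero,
          ContinuousLinearMap.coe_coe] using hanti.le_mul_dist ζ 0
      _ = κ * ‖A z ζ - (A z - A z₀) ζ‖ := by simp
      _ ≤ κ * (‖A z ζ‖ + 1 / (2 * κ) * ‖ζ‖) := by grw [norm_sub_le, hsub]
      _ = κ * ‖A z ζ‖ + ‖ζ‖ / 2 := by field_simp
  linarith

lemma eventually_injective [FiniteDimensional ℝ F] {Z : Type*} [TopologicalSpace Z]
    {A : Z → F →L[ℝ] E} {z₀ : Z} (hA : ContinuousAt A z₀) (hinj : Function.Injective (A z₀)) :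
    ∀ᶠ z in 𝓝 z₀, Function.Injective (A z) := by
  obtain ⟨κ, -, hκ⟩ := eventually_norm_le_of_injective hA hinj
  filter_upwards [hκ] with z hz
  refine (injective_iff_map_eq_zero (A z)).2 fun ζ hζ ↦ norm_le_zero_iff.1 ?_
  simpa [hζ] using hz ζ

lemma exists_eventually_norm_lift_le [FiniteDimensional ℝ F] {Z : Type*} [TopologicalSpace Z]
    {A : Z → F →L[ℝ] E} {B : Z → G →L[ℝ] E} {z₀ : Z} (hA : ContinuousAt A z₀)
    (hB : ContinuousAt B z₀) (hinj : Function.Injective (A z₀))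
    (hrange : ∀ᶠ z in 𝓝 z₀, (B z).range ≤ (A z).range) :
    ∃ R, ∀ᶠ z in 𝓝 z₀, ∀ ξ, ∃ ζ, A z ζ = B z ξ ∧ ‖ζ‖ ≤ R * ‖ξ‖ := by
  obtain ⟨κ, hκ, hκA⟩ := eventually_norm_le_of_injective hA hinj
  refine ⟨κ * (‖B z₀‖ + 1), ?_⟩
  filter_upwards [hκA, hB.norm.eventually_le_const (lt_add_one _), hrange] with z hκz hBz hz ξ
  obtain ⟨ζ, hζ⟩ := hz (LinearMap.mem_range_self _ ξ)
  refine ⟨ζ, hζ, (hκz ζ).trans ?_⟩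
  rw [mul_assoc, show A z ζ = B z ξ from hζ]
  gcongr
  exact (B z).le_of_opNorm_le hBz ξ

lemma exists_eventually_norm_le_mul_norm_snd {B : Type*} [NormedAddCommGroup B] [NormedSpace ℝ B]
    {c : F × C → B} {u₀ : F} (hc : ContDiffAt ℝ 1 c (u₀, 0))
    (hc₀ : ∀ᶠ u in 𝓝 u₀, c (u, 0) = 0) :
    ∃ K : ℝ, ∀ᶠ p in 𝓝 (u₀, 0), ‖c p‖ ≤ K * ‖p.2‖ := by
  obtain ⟨K, s, hs, hlip⟩ := hc.exists_lipschitzOnWith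
  have hfst : Filter.Tendsto (Prod.fst : F × C → F) (𝓝 (u₀, 0)) (𝓝 u₀) := continuous_fst.tendsto _
  refine ⟨K, ?_⟩
  filter_upwards [hs, hfst.eventually hc₀,
    (((Continuous.prodMk_left (0 : C)).tendsto u₀).comp hfst).eventually hs] with p hp hp₀ hps
  have hnorm := hlip.norm_sub_le hp hps
  rw [Function.comp_apply, hp₀, sub_zero] at hnorm
  simpa [Prod.norm_def] using hnorm

lemma eq_zero_of_norm_fderiv_le {w : G → C} {v₀ : G} {ρ K : ℝ}
    (hw : DifferentiableOn ℝ w (Metric.ball v₀ ρ)) (hw₀ : w v₀ = 0)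
    (hK : ∀ v ∈ Metric.ball v₀ ρ, ∀ ξ, ‖fderiv ℝ w v ξ‖ ≤ K * ‖w v‖ * ‖ξ‖) :
    ∀ v ∈ Metric.ball v₀ ρ, w v = 0 := by
  intro v hv
  let γ : ℝ → G := fun t ↦ v₀ + t • (v - v₀)
  have hγ : ∀ t ∈ Icc (0 : ℝ) 1, γ t ∈ Metric.ball v₀ ρ := fun t ht ↦
    (convex_ball v₀ ρ).add_smul_sub_mem
      (Metric.mem_ball_self (dist_nonneg.trans_lt (Metric.mem_ball.1 hv))) hv ht
  have hderiv : ∀ t ∈ Icc (0 : ℝ) 1,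
      HasDerivAt (fun t ↦ w (γ t)) (fderiv ℝ w (γ t) (v - v₀)) t := fun t ht ↦ by
    have hγt : HasDerivAt γ (v - v₀) t := by
      simpa [γ] using ((hasDerivAt_id t).smul_const (v - v₀)).const_add v₀
    exact (hw.differentiableAt
      (Metric.isOpen_ball.mem_nhds (hγ t ht))).hasFDerivAt.comp_hasDerivAt t hγt
  have hγ₁ := eq_zero_of_abs_deriv_le_mul_abs_self_of_eq_zero_right (K := K * ‖v - v₀‖)
    (fun t ht ↦ (hderiv t ht).continuousAt.continuousWithinAt)
    (fun t ht ↦ (hderiv t (Ico_subset_Icc_self ht)).hasDerivWithinAt) (by simpa [γ] using hw₀)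
    (fun t ht ↦ by
      rw [mul_right_comm]
      exact hK _ (hγ t (Ico_subset_Icc_self ht)) _) 1 (right_mem_Icc.2 zero_le_one)
  simpa [γ] using hγ₁

/- Along `g` the function `π ∘ g` satisfies a linear differential inequality, as `Y` is bounded
below near `g v₀`. -/
lemma eventually_comp_eq_zero_of_range_fderiv_le [FiniteDimensional ℝ F] {π : E → C}
    {Y : E → F →L[ℝ] E} {g : G → E} {v₀ : G} {K : ℝ}
    (hπ : ∀ᶠ x in 𝓝 (g v₀), DifferentiableAt ℝ π x) (hπ₀ : π (g v₀) = 0)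
    (hY : ContinuousAt Y (g v₀)) (hinj : Function.Injective (Y (g v₀)))
    (hπY : ∀ᶠ x in 𝓝 (g v₀), ‖(fderiv ℝ π x).comp (Y x)‖ ≤ K * ‖π x‖)
    (hg : ContDiffAt ℝ 1 g v₀) (hgY : ∀ᶠ v in 𝓝 v₀, (fderiv ℝ g v).range ≤ (Y (g v)).range) :
    ∀ᶠ v in 𝓝 v₀, π (g v) = 0 := by
  have hgc := hg.continuousAt
  obtain ⟨R, hR⟩ := exists_eventually_norm_lift_le (hY.comp hgc)
    (hg.continuousAt_fderiv one_ne_zero) hinj hgY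
  have hgd : ∀ᶠ v in 𝓝 v₀, DifferentiableAt ℝ g v :=
    (hg.eventually (by simp)).mono fun v hv ↦ hv.differentiableAt one_ne_zero
  obtain ⟨ρ, hρ, hball⟩ := Metric.eventually_nhds_iff_ball.1
    ((hgc.eventually hπ).and <| (hgc.eventually hπY).and <| hgd.and hR)
  refine Metric.eventually_nhds_iff_ball.2 ⟨ρ, hρ, eq_zero_of_norm_fderiv_le
    (w := fun v ↦ π (g v)) (K := K * R) (fun v hv ↦ ?_) hπ₀ fun v hv ξ ↦ ?_⟩
  all_goals obtain ⟨hπv, hπYv, hgv, hRv⟩ := hball v hv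
  · exact (hπv.comp v hgv).differentiableWithinAt
  · obtain ⟨ζ, hζ, hζξ⟩ := hRv ξ
    calc ‖fderiv ℝ (fun v ↦ π (g v)) v ξ‖ = ‖((fderiv ℝ π (g v)).comp (Y (g v))) ζ‖ := by
          rw [fderiv_fun_comp v hπv hgv, ContinuousLinearMap.comp_apply,
            ContinuousLinearMap.comp_apply, ← hζ, Function.comp_apply]
      _ ≤ K * ‖π (g v)‖ * (R * ‖ξ‖) := ContinuousLinearMap.le_of_opNorm_le_of_le _ hπYv hζξ
      _ = K * R * ‖π (g v)‖ * ‖ξ‖ := by ring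

lemma eventually_fderiv_snd_comp_eq_zero {Ψ : E → F × C} {φ : F → E} {u₀ : F}
    (hΨ : ContDiffAt ℝ 1 Ψ (φ u₀)) (hφ : ContDiffAt ℝ 1 φ u₀)
    (hΨφ : ∀ᶠ u in 𝓝 u₀, Ψ (φ u) = (u, 0)) {Y : E → F →L[ℝ] E}
    (hY : ∀ᶠ u in 𝓝 u₀, (Y (φ u)).range ≤ (fderiv ℝ φ u).range) :
    ∀ᶠ u in 𝓝 u₀, (fderiv ℝ (fun x ↦ (Ψ x).2) (φ u)).comp (Y (φ u)) = 0 := by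
  filter_upwards [hY, hΨφ.eventually_nhds, hφ.eventually (by simp),
    hφ.continuousAt.eventually (hΨ.eventually (by simp))] with u hYu hΨu hφu hΨφu
  refine ContinuousLinearMap.ext fun η ↦ ?_
  obtain ⟨ζ, hζ⟩ := hYu (LinearMap.mem_range_self _ η)
  have hcomp := fderiv_fun_comp u (hΨφu.differentiableAt one_ne_zero).snd
    (hφu.differentiableAt one_ne_zero)
  rw [Filter.EventuallyEq.fderiv_eq (f := fun _ ↦ (0 : C))
    (hΨu.mono fun v hv ↦ congrArg Prod.snd hv), fderiv_fun_const] at hcomp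
  calc fderiv ℝ (fun x ↦ (Ψ x).2) (φ u) (Y (φ u) η)
      = fderiv ℝ (fun x ↦ (Ψ x).2) (φ u) (fderiv ℝ φ u ζ) := congrArg _ hζ.symm
    _ = 0 := (DFunLike.congr_fun hcomp ζ).symm

lemma exists_straightening_norm_fderiv_le [FiniteDimensional ℝ E] [FiniteDimensional ℝ F]
    {φ : F → E} {U : Set F} (hU : IsOpen U) (hφ : ContDiffOn ℝ ∞ φ U) {u₀ : F} (hu₀ : u₀ ∈ U)
    (hinj : Function.Injective (fderiv ℝ φ u₀)) {Y : E → F →L[ℝ] E} (hY : ContDiffAt ℝ 1 Y (φ u₀))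
    (hφY : ∀ᶠ u in 𝓝 u₀, (Y (φ u)).range ≤ (fderiv ℝ φ u).range) :
    ∃ (C : Submodule ℝ E) (e : OpenPartialHomeomorph (F × C) E), (u₀, 0) ∈ e.source ∧
      (∀ p ∈ e.source, p.1 ∈ U) ∧ (∀ u, e (u, 0) = φ u) ∧ ContDiffOn ℝ ∞ e.symm e.target ∧
      ∃ K : ℝ, ∀ᶠ x in 𝓝 (φ u₀),
        ‖(fderiv ℝ (fun x ↦ (e.symm x).2) x).comp (Y x)‖ ≤ K * ‖(e.symm x).2‖ := by
  obtain ⟨C, e, he₀, heU, heφ, he⟩ := exists_straightening hU hφ hu₀ hinj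
  have hφe : ∀ u, e (u, 0) = φ u := fun u ↦ by simp [heφ]
  have htarget : φ u₀ ∈ e.target := hφe u₀ ▸ e.map_source he₀
  have hsymm : ContDiffAt ℝ ∞ e.symm (φ u₀) := he.contDiffAt (e.open_target.mem_nhds htarget)
  have hφ₀ : ContDiffAt ℝ 1 φ u₀ := (hφ.contDiffAt (hU.mem_nhds hu₀)).of_le (by simp)
  have hsymmφ : ∀ᶠ u in 𝓝 u₀, e.symm (φ u) = (u, 0) := by
    filter_upwards [(Continuous.prodMk_left (0 : C)).continuousAt (e.open_source.mem_nhds he₀)]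
      with u hu
    rw [← hφe, e.left_inv hu]
  have hb : ContDiffAt ℝ 1 (fun x ↦ (fderiv ℝ (fun x ↦ (e.symm x).2) x).comp (Y x)) (φ u₀) :=
    ((hsymm.snd.fderiv_right (m := ∞) le_rfl).of_le (by simp)).clm_comp hY
  have hsmooth : ContDiffAt ℝ 1 e (u₀, 0) := by
    rw [show (e : F × C → E) = fun p ↦ φ p.1 + p.2 from funext heφ]
    exact (ContDiffAt.comp (g := φ) (u₀, (0 : C)) hφ₀ contDiff_fst.contDiffAt).add
      (C.subtypeL.contDiff.comp contDiff_snd).contDiffAt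
  obtain ⟨K, hK⟩ := exists_eventually_norm_le_mul_norm_snd
    (ContDiffAt.comp (u₀, (0 : C)) (hφe u₀ ▸ hb) hsmooth)
    ((eventually_fderiv_snd_comp_eq_zero (hsymm.of_le (by simp)) hφ₀ hsymmφ hφY).mono
      fun u hu ↦ by rwa [Function.comp_apply, hφe])
  refine ⟨C, e, he₀, heU, hφe, he, K, ?_⟩
  rw [← hφe]
  filter_upwards [(e.tendsto_symm he₀).eventually hK, e.eventually_right_inverse' he₀] with x hx hex
  simpa only [Function.comp_apply, hex] using hx

/- In coordinates `(u, z)` straightening `φ`, the derivative of `z ∘ g` is bounded by a multiple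
of `z ∘ g`, because `Y` has no `z`-component along the image `z = 0` of `φ`. So `z ∘ g = 0`. -/
theorem exists_factorization [FiniteDimensional ℝ E] [FiniteDimensional ℝ F] {φ : F → E} {U : Set F}
    (hU : IsOpen U) (hφ : ContDiffOn ℝ ∞ φ U) {u₀ : F} (hu₀ : u₀ ∈ U)
    (hinj : Function.Injective (fderiv ℝ φ u₀)) {Y : E → F →L[ℝ] E}
    (hY : ContDiffAt ℝ 1 Y (φ u₀))
    (hφY : ∀ᶠ u in 𝓝 u₀, (Y (φ u)).range = (fderiv ℝ φ u).range)
    {g : G → E} {V : Set G} (hV : IsOpen V) (hg : ContDiffOn ℝ ∞ g V) {v₀ : G} (hv₀ : v₀ ∈ V)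
    (hgv : g v₀ = φ u₀) (hgY : ∀ᶠ v in 𝓝 v₀, (fderiv ℝ g v).range ≤ (Y (g v)).range) :
    ∃ (h : G → F) (W : Set G), IsOpen W ∧ v₀ ∈ W ∧ W ⊆ V ∧ ContDiffOn ℝ ∞ h W ∧ h v₀ = u₀ ∧
      ∀ v ∈ W, h v ∈ U ∧ g v = φ (h v) := by
  obtain ⟨C, e, he₀, heU, hφe, he, K, hK⟩ := exists_straightening_norm_fderiv_le hU hφ hu₀ hinj hY
    (hφY.mono fun u hu ↦ hu.le)
  have hYinj : Function.Injective (Y (φ u₀)) := by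
    have hrank := (Y (φ u₀)).toLinearMap.finrank_range_add_finrank_ker
    rw [hφY.self_of_nhds, LinearMap.finrank_range_of_inj hinj] at hrank
    rw [← ContinuousLinearMap.coe_coe, ← LinearMap.ker_eq_bot, ← Submodule.finrank_eq_zero]
    lia
  have hsymm₀ : e.symm (g v₀) = (u₀, 0) := by rw [hgv, ← hφe, e.left_inv he₀]
  have htarget : e.target ∈ 𝓝 (g v₀) :=
    e.open_target.mem_nhds (by rw [hgv, ← hφe]; exact e.map_source he₀)
  have hg₀ : ContDiffAt ℝ ∞ g v₀ := hg.contDiffAt (hV.mem_nhds hv₀)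
  rw [← hgv] at hK hY hYinj
  have hzero : ∀ᶠ v in 𝓝 v₀, (e.symm (g v)).2 = 0 := by
    refine eventually_comp_eq_zero_of_range_fderiv_le (π := fun x ↦ (e.symm x).2) ?_
      (congrArg Prod.snd hsymm₀) hY.continuousAt hYinj hK (hg₀.of_le (by simp)) hgY
    filter_upwards [eventually_mem_nhds_iff.2 htarget] with x hx
    exact ((he.contDiffAt hx).differentiableAt (by simp)).snd
  obtain ⟨W, hW, hWo, hvW⟩ := eventually_nhds_iff.1
    (hzero.and <| (hg₀.continuousAt.eventually htarget).and <| hV.mem_nhds hv₀)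
  refine ⟨fun v ↦ (e.symm (g v)).1, W, hWo, hvW, fun v hv ↦ (hW v hv).2.2, ?_,
    congrArg Prod.fst hsymm₀, fun v hv ↦ ⟨heU _ (e.map_target (hW v hv).2.1), ?_⟩⟩
  · exact contDiff_fst.comp_contDiffOn <|
      he.comp (hg.mono fun v hv ↦ (hW v hv).2.2) fun v hv ↦ (hW v hv).2.1
  · calc g v = e (e.symm (g v)) := (e.right_inv (hW v hv).2.1).symm
      _ = e ((e.symm (g v)).1, 0) := congrArg e (Prod.ext rfl (hW v hv).1)
      _ = φ (e.symm (g v)).1 := hφe _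

end Straightening

section PushForward

variable {E : Type*} [NormedAddCommGroup E] [NormedSpace ℝ E]
  {H : Type*} [TopologicalSpace H] {I : ModelWithCorners ℝ E H}
  {M : Type*} [TopologicalSpace M] [ChartedSpace H M] [IsManifold I ∞ M]
  {E' : Type*} [NormedAddCommGroup E'] [NormedSpace ℝ E']
  {H' : Type*} [TopologicalSpace H'] {I' : ModelWithCorners ℝ E' H'}
  {M' : Type*} [TopologicalSpace M'] [ChartedSpace H' M'] [IsManifold I' ∞ M']
  {E'' : Type*} [NormedAddCommGroup E''] [NormedSpace ℝ E'']
  {H'' : Type*} [TopologicalSpace H''] {I'' : ModelWithCorners ℝ E'' H''}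
  {N : Type*} [TopologicalSpace N] [ChartedSpace H'' N]

lemma contMDiffOn_mfderiv_apply {f : M → M'} {s : Set M} (hs : IsOpen s)
    (hf : ContMDiffOn I I' ∞ f s) {X : (x : M) → TangentSpace I x} {u : Set M}
    (hX : ContMDiffOn I I.tangent ∞ (fun x ↦ (⟨x, X x⟩ : TangentBundle I M)) u)
    {g : N → M} {t : Set N} (hg : ContMDiffOn I'' I ∞ g t) (hgs : MapsTo g t s)
    (hgu : MapsTo g t u) :
    ContMDiffOn I'' I'.tangent ∞
      (fun y ↦ (⟨f (g y), mfderiv I I' f (g y) (X (g y))⟩ : TangentBundle I' M')) t := by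
  have htangent := (hf.contMDiffOn_tangentMapWithin (m := ∞) le_rfl hs.uniqueMDiffOn).comp
    (hX.comp hg hgu) fun y hy ↦ hgs hy
  refine htangent.congr fun y hy ↦ ?_
  change _ = (⟨f (g y), mfderivWithin I I' f s (g y) (X (g y))⟩ : TangentBundle I' M')
  rw [mfderivWithin_of_isOpen hs (hgs hy)]

end PushForward

section Charts

variable {d : ℕ} {M : Type u} [TopologicalSpace M] [ChartedSpace (EuclideanSpace ℝ (Fin d)) M]

local notation "𝔼" => EuclideanSpace ℝ (Fin d)

lemma isOpen_extChartAt_target_inter_preimage (x₀ : M) {U : Set M} (hU : IsOpen U) :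
    IsOpen ((extChartAt (𝓡 d) x₀).target ∩ (extChartAt (𝓡 d) x₀).symm ⁻¹' U) :=
  (continuousOn_extChartAt_symm x₀).isOpen_inter_preimage (isOpen_extChartAt_target x₀) hU

variable [IsManifold (𝓡 d) ∞ M]

/-- The expression of a vector field in the chart around a point. -/
def chartField (x₀ : M) (X : (x : M) → TangentSpace (𝓡 d) x) (e : 𝔼) : 𝔼 :=
  mfderiv (𝓡 d) 𝓘(ℝ, 𝔼) (extChartAt (𝓡 d) x₀) ((extChartAt (𝓡 d) x₀).symm e)
    (X ((extChartAt (𝓡 d) x₀).symm e))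

lemma LocalVectorField.contDiffOn_chartField (X : LocalVectorField d M) (x₀ : M) :
    ContDiffOn ℝ ∞ (chartField x₀ X.toFun)
      ((extChartAt (𝓡 d) x₀).target ∩ (extChartAt (𝓡 d) x₀).symm ⁻¹' X.domain) := by
  have hlift := contMDiffOn_mfderiv_apply (isOpen_extChartAt_source (I := 𝓡 d) x₀)
    (contMDiffOn_extChartAt (n := ∞) (I := 𝓡 d) (x := x₀) |>.mono (by rw [extChartAt_source]))
    X.smooth (g := (extChartAt (𝓡 d) x₀).symm)
    (t := (extChartAt (𝓡 d) x₀).target ∩ (extChartAt (𝓡 d) x₀).symm ⁻¹' X.domain)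
    ((contMDiffOn_extChartAt_symm x₀).mono inter_subset_left)
    (fun e he ↦ (extChartAt (𝓡 d) x₀).map_target he.1) (fun e he ↦ he.2)
  exact ((contMDiff_snd_tangentBundle_modelSpace 𝔼 𝓘(ℝ, 𝔼)).comp_contMDiffOn hlift).contDiffOn

variable {x₀ : M} {e : EuclideanSpace ℝ (Fin d)}

lemma mdifferentiableAt_extChartAt_symm (he : e ∈ (extChartAt (𝓡 d) x₀).target) :
    MDifferentiableAt 𝓘(ℝ, 𝔼) (𝓡 d) (extChartAt (𝓡 d) x₀).symm e :=
  ((contMDiffOn_extChartAt_symm (n := ∞) x₀).contMDiffAt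
    ((isOpen_extChartAt_target x₀).mem_nhds he)).mdifferentiableAt (by simp)

lemma mfderiv_extChartAt_symm_mfderiv_extChartAt (he : e ∈ (extChartAt (𝓡 d) x₀).target)
    (v : TangentSpace (𝓡 d) ((extChartAt (𝓡 d) x₀).symm e)) :
    mfderiv 𝓘(ℝ, 𝔼) (𝓡 d) (extChartAt (𝓡 d) x₀).symm e
      (mfderiv (𝓡 d) 𝓘(ℝ, 𝔼) (extChartAt (𝓡 d) x₀) ((extChartAt (𝓡 d) x₀).symm e) v) = v := by
  rw [← mfderivWithin_univ, ← ModelWithCorners.range_eq_univ (𝓡 d)]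
  exact DFunLike.congr_fun (mfderivWithin_extChartAt_symm_comp_mfderiv_extChartAt he) v

lemma mfderiv_extChartAt_mfderiv_extChartAt_symm (he : e ∈ (extChartAt (𝓡 d) x₀).target) (v : 𝔼) :
    mfderiv (𝓡 d) 𝓘(ℝ, 𝔼) (extChartAt (𝓡 d) x₀) ((extChartAt (𝓡 d) x₀).symm e)
      (mfderiv 𝓘(ℝ, 𝔼) (𝓡 d) (extChartAt (𝓡 d) x₀).symm e v) = v := by
  have hcomp := mfderiv_extChartAt_comp_mfderivWithin_extChartAt_symm (I := 𝓡 d) he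
  rw [ModelWithCorners.range_eq_univ, mfderivWithin_univ] at hcomp
  exact DFunLike.congr_fun hcomp v

lemma hasMFDerivAt_extChartAt_symm_comp {X : (x : M) → TangentSpace (𝓡 d) x} {γ : ℝ → 𝔼} {t : ℝ}
    (ht : γ t ∈ (extChartAt (𝓡 d) x₀).target) (hγ : HasDerivAt γ (chartField x₀ X (γ t)) t) :
    HasMFDerivAt 𝓘(ℝ, ℝ) (𝓡 d) (fun s ↦ (extChartAt (𝓡 d) x₀).symm (γ s)) t
      ((1 : ℝ →L[ℝ] ℝ).smulRight (X ((extChartAt (𝓡 d) x₀).symm (γ t)))) := by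
  refine ((mdifferentiableAt_extChartAt_symm ht).hasMFDerivAt.comp t
    hγ.hasFDerivAt.hasMFDerivAt).congr_mfderiv (ContinuousLinearMap.ext fun a : ℝ ↦ ?_)
  let L : 𝔼 →L[ℝ] 𝔼 := mfderiv 𝓘(ℝ, 𝔼) (𝓡 d) (extChartAt (𝓡 d) x₀).symm (γ t)
  exact (L.map_smul a (chartField x₀ X (γ t))).trans
    (congrArg (fun v : 𝔼 ↦ a • v) (mfderiv_extChartAt_symm_mfderiv_extChartAt ht _))

end Charts

section Flow

variable {d : ℕ} {M : Type u} [TopologicalSpace M] [ChartedSpace (EuclideanSpace ℝ (Fin d)) M]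

variable [IsManifold (𝓡 d) ∞ M] {X : LocalVectorField d M}

lemma LocalVectorField.contMDiffAt (X : LocalVectorField d M) {x : M} (hx : x ∈ X.domain) :
    ContMDiffAt (𝓡 d) (𝓡 d).tangent ∞ (fun x ↦ (⟨x, X.toFun x⟩ : TangentBundle (𝓡 d) M)) x :=
  X.smooth.contMDiffAt (X.domain.isOpen.mem_nhds hx)

/-- `γ` is an integral curve of `X` over `s` which stays in the domain of `X`. -/
structure LocalVectorField.IsTrajectoryOn (X : LocalVectorField d M) (γ : ℝ → M) (s : Set ℝ) :
    Prop where
  isMIntegralCurveOn : IsMIntegralCurveOn γ X.toFun s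
  mapsTo : MapsTo γ s X.domain

namespace LocalVectorField.IsTrajectoryOn

variable {γ γ' : ℝ → M} {s s' : Set ℝ} {t t₀ : ℝ}

lemma mono (h : X.IsTrajectoryOn γ s) (hs : s' ⊆ s) : X.IsTrajectoryOn γ s' :=
  ⟨h.1.mono hs, h.2.mono_left hs⟩

lemma hasMFDerivAt (h : X.IsTrajectoryOn γ s) (hs : s ∈ 𝓝 t) :
    HasMFDerivAt 𝓘(ℝ, ℝ) (𝓡 d) γ t ((1 : ℝ →L[ℝ] ℝ).smulRight (X.toFun (γ t))) :=
  (h.1 t (mem_of_mem_nhds hs)).hasMFDerivAt hs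

lemma congr (h : X.IsTrajectoryOn γ s) (heq : EqOn γ' γ s) : X.IsTrajectoryOn γ' s :=
  ⟨fun t ht ↦ by
    rw [heq ht]
    exact (h.1 t ht).congr_mono heq (heq ht) Subset.rfl, h.2.congr heq.symm⟩

lemma union (h : X.IsTrajectoryOn γ s) (h' : X.IsTrajectoryOn γ s') (hs : IsOpen s)
    (hs' : IsOpen s') : X.IsTrajectoryOn γ (s ∪ s') := by
  refine ⟨?_, h.2.union h'.2⟩
  rintro t (ht | ht)
  · exact (h.hasMFDerivAt (hs.mem_nhds ht)).hasMFDerivWithinAt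
  · exact (h'.hasMFDerivAt (hs'.mem_nhds ht)).hasMFDerivWithinAt

lemma comp_add (h : X.IsTrajectoryOn γ s) (r : ℝ) :
    X.IsTrajectoryOn (γ ∘ (· + r)) ((· + r) ⁻¹' s) :=
  ⟨h.1.comp_add r, h.2.comp fun _ ht ↦ ht⟩

lemma isFlowCurve {a b : ℝ} (h : X.IsTrajectoryOn γ (Ioo a b)) (h₀ : 0 ∈ Ioo a b)
    (ht : t ∈ Ioo a b) : IsFlowCurve X t (γ 0) γ :=
  ⟨rfl, a, b, h₀, ht, h.1, h.2⟩

lemma eventuallyEq (h : X.IsTrajectoryOn γ s) (h' : X.IsTrajectoryOn γ' s) (hs : s ∈ 𝓝 t)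
    (heq : γ t = γ' t) : γ =ᶠ[𝓝 t] γ' :=
  isMIntegralCurveAt_eventuallyEq_of_contMDiffAt_boundaryless
    ((X.contMDiffAt (h.2 (mem_of_mem_nhds hs))).of_le (by simp)) (h.1.isMIntegralCurveAt hs)
    (h'.1.isMIntegralCurveAt hs) heq

variable [T2Space M]

lemma eqOn (h : X.IsTrajectoryOn γ s) (h' : X.IsTrajectoryOn γ' s) (hs : IsOpen s)
    (hsc : IsPreconnected s) (ht₀ : t₀ ∈ s) (heq : γ t₀ = γ' t₀) : EqOn γ γ' s := by
  have hsub : s ⊆ {t | ∀ᶠ r in 𝓝 t, γ r = γ' r} := by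
    refine hsc.subset_of_closure_inter_subset isOpen_setOfPred_eventually_nhds
      ⟨t₀, ht₀, h.eventuallyEq h' (hs.mem_nhds ht₀) heq⟩ ?_
    rintro t ⟨hcl, ht⟩
    refine h.eventuallyEq h' (hs.mem_nhds ht) ?_
    exact tendsto_nhds_unique_of_frequently_eq (h.hasMFDerivAt (hs.mem_nhds ht)).continuousAt
      (h'.hasMFDerivAt (hs.mem_nhds ht)).continuousAt
      ((mem_closure_iff_frequently.1 hcl).mono fun _ hr ↦ hr.self_of_nhds)
  exact fun t ht ↦ (hsub ht).self_of_nhds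

lemma exists_union {a b a' b' : ℝ} (h : X.IsTrajectoryOn γ (Ioo a b))
    (h' : X.IsTrajectoryOn γ' (Ioo a' b')) (ht : t ∈ Ioo a b) (ht' : t ∈ Ioo a' b')
    (heq : γ t = γ' t) :
    ∃ γ'' : ℝ → M, X.IsTrajectoryOn γ'' (Ioo (min a a') (max b b')) ∧
      EqOn γ'' γ (Ioo a b) ∧ EqOn γ'' γ' (Ioo a' b') := by
  classical
  have hinter : EqOn γ γ' (Ioo a b ∩ Ioo a' b') :=
    (h.mono inter_subset_left).eqOn (h'.mono inter_subset_right) (isOpen_Ioo.inter isOpen_Ioo)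
      (ordConnected_Ioo.inter ordConnected_Ioo).isPreconnected ⟨ht, ht'⟩ heq
  have heqγ : EqOn ((Ioo a b).piecewise γ γ') γ (Ioo a b) := piecewise_eqOn _ _ _
  have heqγ' : EqOn ((Ioo a b).piecewise γ γ') γ' (Ioo a' b') := fun r hr' ↦ by
    by_cases hr : r ∈ Ioo a b
    · rw [heqγ hr, hinter ⟨hr, hr'⟩]
    · exact piecewise_eq_of_notMem _ _ _ hr
  rw [← Ioo_union_Ioo' (ht'.1.trans ht.2) (ht.1.trans ht'.2)]
  exact ⟨_, (h.congr heqγ).union (h'.congr heqγ') isOpen_Ioo isOpen_Ioo, heqγ, heqγ'⟩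

end LocalVectorField.IsTrajectoryOn

lemma exists_smooth_trajectories {x₀ : M} (hx₀ : x₀ ∈ X.domain) :
    ∃ ε > 0, ∃ U : Set M, IsOpen U ∧ x₀ ∈ U ∧ ∃ F : ℝ × M → M,
      ContMDiffOn (𝓘(ℝ, ℝ).prod (𝓡 d)) (𝓡 d) ∞ F (Ioo (-ε) ε ×ˢ U) ∧
      ∀ x ∈ U, F (0, x) = x ∧ X.IsTrajectoryOn (fun t ↦ F (t, x)) (Ioo (-ε) ε) := by
  let ψ := extChartAt (𝓡 d) x₀
  obtain ⟨ε, hε, α, hα, hαf⟩ := exists_contDiffOn_flow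
    (isOpen_extChartAt_target_inter_preimage x₀ X.domain.isOpen) (X.contDiffOn_chartField x₀)
    (x₀ := ψ x₀) ⟨mem_extChartAt_target x₀, by rwa [mem_preimage, extChartAt_to_inv]⟩
  refine ⟨ε, hε, ψ.source ∩ ψ ⁻¹' Metric.ball (ψ x₀) ε,
    (continuousOn_extChartAt x₀).isOpen_inter_preimage (isOpen_extChartAt_source x₀)
      Metric.isOpen_ball, ⟨mem_extChartAt_source x₀, Metric.mem_ball_self hε⟩,
    fun p ↦ ψ.symm (α (ψ p.2, p.1)), ?_, ?_⟩
  · have hψ : ContMDiffOn (𝓘(ℝ, ℝ).prod (𝓡 d)) 𝓘(ℝ, EuclideanSpace ℝ (Fin d) × ℝ) ∞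
        (fun p : ℝ × M ↦ (ψ p.2, p.1))
        (Ioo (-ε) ε ×ˢ (ψ.source ∩ ψ ⁻¹' Metric.ball (ψ x₀) ε)) := by
      refine ContMDiffOn.prodMk_space (contMDiffOn_extChartAt.comp contMDiffOn_snd ?_)
        contMDiffOn_fst
      exact fun p hp ↦ by simpa [ψ] using hp.2.1
    exact (contMDiffOn_extChartAt_symm (n := ∞) x₀).comp
      (hα.contMDiffOn.comp hψ fun p hp ↦ ⟨hp.2.2, hp.1⟩)
      fun p hp ↦ ((hαf _ hp.2.2).2 _ hp.1).1.1
  · rintro x ⟨hxψ, hx⟩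
    obtain ⟨hα₀, hαx⟩ := hαf _ hx
    refine ⟨?_, fun t ht ↦ ?_, fun t ht ↦ (hαx t ht).1.2⟩
    · simp only [hα₀, ψ.left_inv hxψ]
    · exact (hasMFDerivAt_extChartAt_symm_comp (hαx t ht).1.1 (hαx t ht).2).hasMFDerivWithinAt

section FlowCurve

variable {t : ℝ} {m : M} {γ : ℝ → M}

lemma IsFlowCurve.exists_isTrajectoryOn (h : IsFlowCurve X t m γ) :
    ∃ a b : ℝ, 0 ∈ Ioo a b ∧ t ∈ Ioo a b ∧ X.IsTrajectoryOn γ (Ioo a b) :=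
  let ⟨_, a, b, h₀, ht, hγ, hγX⟩ := h
  ⟨a, b, h₀, ht, hγ, hγX⟩

variable [T2Space M]

lemma IsFlowCurve.eq {γ' : ℝ → M} (h : IsFlowCurve X t m γ) (h' : IsFlowCurve X t m γ') :
    γ t = γ' t := by
  obtain ⟨a, b, h₀, ht, hγ⟩ := h.exists_isTrajectoryOn
  obtain ⟨a', b', h₀', ht', hγ'⟩ := h'.exists_isTrajectoryOn
  exact (hγ.mono inter_subset_left).eqOn (hγ'.mono inter_subset_right) (isOpen_Ioo.inter isOpen_Ioo)
    (ordConnected_Ioo.inter ordConnected_Ioo).isPreconnected ⟨h₀, h₀'⟩ (h.1.trans h'.1.symm)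
    ⟨ht, ht'⟩

lemma IsFlowCurve.flow_eq (h : IsFlowCurve X t m γ) : flow X t m = γ t := by
  have hex : ∃ γ : ℝ → M, IsFlowCurve X t m γ := ⟨γ, h⟩
  rw [flow, dif_pos hex]
  exact hex.choose_spec.eq h

lemma LocalVectorField.IsTrajectoryOn.flow_sub {a b s : ℝ} (h : X.IsTrajectoryOn γ (Ioo a b))
    (hs : s ∈ Ioo a b) (ht : t ∈ Ioo a b) :
    (t - s, γ s) ∈ flowDomain X ∧ flow X (t - s) (γ s) = γ t := by
  have hshift : X.IsTrajectoryOn (γ ∘ (· + s)) (Ioo (a - s) (b - s)) := by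
    rw [← preimage_add_const_Ioo]
    exact h.comp_add s
  have hcurve : IsFlowCurve X (t - s) (γ s) (γ ∘ (· + s)) := by
    simpa using hshift.isFlowCurve (t := t - s) ⟨sub_neg.2 hs.1, sub_pos.2 hs.2⟩
      ⟨sub_lt_sub_right ht.1 s, sub_lt_sub_right ht.2 s⟩
  exact ⟨⟨_, hcurve⟩, by simp [hcurve.flow_eq]⟩

lemma exists_isTrajectoryOn_flow (h : (t, m) ∈ flowDomain X) :
    ∃ a b : ℝ, 0 ∈ Ioo a b ∧ t ∈ Ioo a b ∧ (∀ s ∈ Ioo a b, (s, m) ∈ flowDomain X) ∧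
      X.IsTrajectoryOn (fun s ↦ flow X s m) (Ioo a b) ∧ flow X 0 m = m := by
  obtain ⟨γ, hγ⟩ := h
  obtain ⟨a, b, h₀, ht, htraj⟩ := hγ.exists_isTrajectoryOn
  have hγ₀ : γ 0 = m := hγ.1
  have hcurve : ∀ s ∈ Ioo a b, IsFlowCurve X s m γ := fun s hs ↦ hγ₀ ▸ htraj.isFlowCurve h₀ hs
  have heq : EqOn (fun s ↦ flow X s m) γ (Ioo a b) := fun s hs ↦ (hcurve s hs).flow_eq
  exact ⟨a, b, h₀, ht, fun s hs ↦ ⟨γ, hcurve s hs⟩, htraj.congr heq, (heq h₀).trans hγ₀⟩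

lemma flow_neg (h : (t, m) ∈ flowDomain X) :
    (-t, flow X t m) ∈ flowDomain X ∧ flow X (-t) (flow X t m) = m := by
  obtain ⟨a, b, h₀, ht, -, hγ, hm⟩ := exists_isTrajectoryOn_flow h
  simpa [hm] using hγ.flow_sub ht h₀

lemma mem_domain_of_mem_flowDomain (h : (t, m) ∈ flowDomain X) : m ∈ X.domain := by
  obtain ⟨a, b, h₀, -, -, hγ, hm⟩ := exists_isTrajectoryOn_flow h
  exact (congrArg (· ∈ X.domain) hm).mp (hγ.mapsTo h₀)

lemma flow_mem_domain (h : (t, m) ∈ flowDomain X) : flow X t m ∈ X.domain :=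
  mem_domain_of_mem_flowDomain (flow_neg h).1

lemma hasMFDerivAt_flow_time (h : (t, m) ∈ flowDomain X) :
    HasMFDerivAt 𝓘(ℝ, ℝ) (𝓡 d) (fun s ↦ flow X s m) t
      ((1 : ℝ →L[ℝ] ℝ).smulRight (X.toFun (flow X t m))) := by
  obtain ⟨a, b, -, ht, -, hγ, -⟩ := exists_isTrajectoryOn_flow h
  exact hγ.hasMFDerivAt (Ioo_mem_nhds ht.1 ht.2)

lemma flow_add {s : ℝ} (hs : (s, m) ∈ flowDomain X) (ht : (t, flow X s m) ∈ flowDomain X) :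
    (s + t, m) ∈ flowDomain X ∧ flow X (s + t) m = flow X t (flow X s m) := by
  obtain ⟨a, b, h₀, hs', -, hγ, hm⟩ := exists_isTrajectoryOn_flow hs
  obtain ⟨a', b', h₀', ht', -, hγ', hm'⟩ := exists_isTrajectoryOn_flow ht
  have hshift : X.IsTrajectoryOn (fun r ↦ flow X (r - s) (flow X s m)) (Ioo (a' + s) (b' + s)) := by
    rw [← preimage_sub_const_Ioo]
    exact hγ'.comp_add (-s)
  have hs'' : s ∈ Ioo (a' + s) (b' + s) := by simpa using h₀'
  obtain ⟨γ, hγ'', heq, heq'⟩ := hγ.exists_union hshift hs' hs'' (by simp [hm'])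
  have hst : s + t ∈ Ioo (a' + s) (b' + s) := by simpa [add_comm s] using ht'
  have hγ₀ : γ 0 = m := (heq h₀).trans hm
  have hglue := hγ''.flow_sub (s := 0) (t := s + t)
    (Ioo_subset_Ioo (min_le_left _ _) (le_max_left _ _) h₀)
    (Ioo_subset_Ioo (min_le_right _ _) (le_max_right _ _) hst)
  simpa [hγ₀, heq' hst] using hglue

end FlowCurve

variable [T2Space M]

lemma exists_flow_box {x₀ : M} (hx₀ : x₀ ∈ X.domain) :
    ∃ ε > 0, ∃ U : Set M, IsOpen U ∧ x₀ ∈ U ∧ Ioo (-ε) ε ×ˢ U ⊆ flowDomain X ∧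
      ContMDiffOn (𝓘(ℝ, ℝ).prod (𝓡 d)) (𝓡 d) ∞ (fun p : ℝ × M ↦ flow X p.1 p.2)
        (Ioo (-ε) ε ×ˢ U) := by
  obtain ⟨ε, hε, U, hU, hxU, F, hF, hFX⟩ := exists_smooth_trajectories hx₀
  have hflow : ∀ p ∈ Ioo (-ε) ε ×ˢ U, p ∈ flowDomain X ∧ flow X p.1 p.2 = F p := by
    rintro ⟨t, x⟩ ⟨ht, hx⟩
    simpa only [sub_zero, (hFX x hx).1] using
      (hFX x hx).2.flow_sub (s := 0) ⟨neg_lt_zero.2 hε, hε⟩ ht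
  exact ⟨ε, hε, U, hU, hxU, fun p hp ↦ (hflow p hp).1, hF.congr fun p hp ↦ (hflow p hp).2⟩

lemma flow_zero {x : M} (hx : x ∈ X.domain) : (0, x) ∈ flowDomain X ∧ flow X 0 x = x := by
  obtain ⟨ε, hε, U, -, hxU, hsub, -⟩ := exists_flow_box hx
  have h₀ : (0, x) ∈ flowDomain X := hsub ⟨⟨neg_lt_zero.2 hε, hε⟩, hxU⟩
  obtain ⟨-, -, -, -, -, -, hx₀⟩ := exists_isTrajectoryOn_flow h₀
  exact ⟨h₀, hx₀⟩

/-- The flow of `X` is defined and smooth near `p`. -/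
def IsSmoothFlowPoint (X : LocalVectorField d M) (p : ℝ × M) : Prop :=
  flowDomain X ∈ 𝓝 p ∧
    ContMDiffAt (𝓘(ℝ, ℝ).prod (𝓡 d)) (𝓡 d) ∞ (fun p : ℝ × M ↦ flow X p.1 p.2) p

lemma IsSmoothFlowPoint.add {s t : ℝ} {m : M} (hs : IsSmoothFlowPoint X (s, m))
    (ht : IsSmoothFlowPoint X (t, flow X s m)) : IsSmoothFlowPoint X (s + t, m) := by
  have hfst : ContMDiffAt (𝓘(ℝ, ℝ).prod (𝓡 d)) (𝓡 d) ∞ (fun p : ℝ × M ↦ flow X s p.2)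
      (s + t, m) :=
    ContMDiffAt.comp (f := fun p : ℝ × M ↦ (s, p.2)) (s + t, m) hs.2
      (contMDiffAt_const.prodMk contMDiffAt_snd)
  have hpair : ContMDiffAt (𝓘(ℝ, ℝ).prod (𝓡 d)) (𝓘(ℝ, ℝ).prod (𝓡 d)) ∞
      (fun p : ℝ × M ↦ (p.1 - s, flow X s p.2)) (s + t, m) :=
    (contMDiffAt_fst.sub contMDiffAt_const).prodMk hfst
  have hval : (s + t - s, flow X s m) = (t, flow X s m) := by rw [add_sub_cancel_left]
  have hflow : ∀ᶠ p : ℝ × M in 𝓝 (s + t, m), p ∈ flowDomain X ∧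
      flow X p.1 p.2 = flow X (p.1 - s) (flow X s p.2) := by
    have hcont : ContinuousAt (fun p : ℝ × M ↦ (s, p.2)) (s + t, m) := by fun_prop
    filter_upwards [hcont.eventually hs.1, hpair.continuousAt.eventually (hval ▸ ht.1)]
      with p hp hp'
    simpa only [add_sub_cancel] using flow_add hp hp'
  refine ⟨hflow.mono fun p hp ↦ hp.1, ContMDiffAt.congr_of_eventuallyEq ?_
    (hflow.mono fun p hp ↦ hp.2)⟩
  exact ContMDiffAt.comp (g := fun p : ℝ × M ↦ flow X p.1 p.2) (s + t, m) (hval ▸ ht.2) hpair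

lemma eventually_isSmoothFlowPoint {x₀ : M} (hx₀ : x₀ ∈ X.domain) :
    ∀ᶠ p in 𝓝 ((0 : ℝ), x₀), IsSmoothFlowPoint X p := by
  obtain ⟨ε, hε, U, hU, hxU, hsub, hflow⟩ := exists_flow_box hx₀
  have hopen : IsOpen (Ioo (-ε) ε ×ˢ U) := isOpen_Ioo.prod hU
  filter_upwards [hopen.mem_nhds ⟨⟨neg_lt_zero.2 hε, hε⟩, hxU⟩] with p hp
  exact ⟨Filter.mem_of_superset (hopen.mem_nhds hp) hsub, hflow.contMDiffAt (hopen.mem_nhds hp)⟩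

/- Along a flow line smoothness propagates in both directions, because the time needed to flow
away from a point is locally uniform; so it holds along the whole line. -/
lemma isSmoothFlowPoint_of_mem_flowDomain {p : ℝ × M} (hp : p ∈ flowDomain X) :
    IsSmoothFlowPoint X p := by
  obtain ⟨t, m⟩ := p
  obtain ⟨a, b, h₀, ht, -, hγ, -⟩ := exists_isTrajectoryOn_flow hp
  refine (isPreconnected_Ioo.induction₂
    (fun s s' ↦ IsSmoothFlowPoint X (s, m) ↔ IsSmoothFlowPoint X (s', m)) (fun s hs ↦ ?_)
    (fun _ _ _ _ _ _ h h' ↦ h.trans h') (fun _ _ _ _ h ↦ h.symm) h₀ ht).1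
    (eventually_isSmoothFlowPoint (mem_domain_of_mem_flowDomain hp)).self_of_nhds
  have hcont : ContinuousAt (fun r ↦ flow X r m) s :=
    (hγ.hasMFDerivAt (Ioo_mem_nhds hs.1 hs.2)).continuousAt
  have hbox := eventually_isSmoothFlowPoint (hγ.mapsTo hs)
  have hforth : Filter.Tendsto (fun r ↦ (r - s, flow X s m)) (𝓝 s) (𝓝 (0, flow X s m)) :=
    Continuous.tendsto' (by fun_prop) _ _ (by simp)
  have hback : Filter.Tendsto (fun r ↦ (s - r, flow X r m)) (𝓝 s) (𝓝 (0, flow X s m)) := by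
    have hsub : Filter.Tendsto (fun r ↦ s - r) (𝓝 s) (𝓝 0) :=
      Continuous.tendsto' (by fun_prop) _ _ (by simp)
    exact hsub.prodMk_nhds hcont
  filter_upwards [nhdsWithin_le_nhds (hforth.eventually hbox),
    nhdsWithin_le_nhds (hback.eventually hbox)] with r hr hr'
  exact ⟨fun h ↦ by simpa using h.add hr, fun h ↦ by simpa using h.add hr'⟩

theorem isOpen_flowDomain (X : LocalVectorField d M) : IsOpen (flowDomain X) :=
  isOpen_iff_mem_nhds.2 fun _ hp ↦ (isSmoothFlowPoint_of_mem_flowDomain hp).1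

theorem contMDiffAt_flow {p : ℝ × M} (hp : p ∈ flowDomain X) :
    ContMDiffAt (𝓘(ℝ, ℝ).prod (𝓡 d)) (𝓡 d) ∞ (fun p : ℝ × M ↦ flow X p.1 p.2) p :=
  (isSmoothFlowPoint_of_mem_flowDomain hp).2

variable {t : ℝ} {m : M}

lemma contMDiffAt_flow_point (h : (t, m) ∈ flowDomain X) :
    ContMDiffAt (𝓡 d) (𝓡 d) ∞ (flow X t) m :=
  ContMDiffAt.comp (f := fun x : M ↦ (t, x)) m (contMDiffAt_flow h)
    (contMDiffAt_const.prodMk contMDiffAt_id)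

lemma eventually_mem_flowDomain (h : (t, m) ∈ flowDomain X) : ∀ᶠ x in 𝓝 m, (t, x) ∈ flowDomain X :=
  (Continuous.prodMk_right t).continuousAt ((isOpen_flowDomain X).mem_nhds h)

lemma mfderiv_flow_neg_mfderiv_flow (h : (t, m) ∈ flowDomain X) (v : TangentSpace (𝓡 d) m) :
    mfderiv (𝓡 d) (𝓡 d) (flow X (-t)) (flow X t m) (mfderiv (𝓡 d) (𝓡 d) (flow X t) m v) = v := by
  have hcomp := ((contMDiffAt_flow_point (flow_neg h).1).mdifferentiableAt
    (by simp)).hasMFDerivAt.comp m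
      ((contMDiffAt_flow_point h).mdifferentiableAt (by simp)).hasMFDerivAt
  have hid : HasMFDerivAt (𝓡 d) (𝓡 d) (flow X (-t) ∘ flow X t) m
      (ContinuousLinearMap.id ℝ (TangentSpace (𝓡 d) m)) :=
    (hasMFDerivAt_id m).congr_of_eventuallyEq
      ((eventually_mem_flowDomain h).mono fun x hx ↦ (flow_neg hx).2)
  exact DFunLike.congr_fun (hasMFDerivAt_unique hcomp hid) v

end Flow

/-! ### Compositions of flows and the distribution `P_D` -/

section Words

variable {d : ℕ} {M : Type u} [TopologicalSpace M] [ChartedSpace (EuclideanSpace ℝ (Fin d)) M]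
  [IsManifold (𝓡 d) ∞ M] {D : Set (LocalVectorField d M)} {X : LocalVectorField d M}

/-- The word with the single letter `X`. -/
def Word.single (hX : X ∈ D) : Word D :=
  ⟨⟨1, le_rfl⟩, fun _ ↦ ⟨X, hX⟩⟩

/-- The word `w` with the letter `X` added in front, so that the flow of `X` is applied last. -/
def Word.cons (hX : X ∈ D) (w : Word D) : Word D :=
  ⟨⟨w.length + 1, Nat.le_add_left _ _⟩, Fin.cons (⟨X, hX⟩ : D) w.2⟩

lemma Word.mem_timeDomain_single (hX : X ∈ D) {T : Fin 1 → ℝ} {m : M} :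
    T ∈ timeDomain (Word.single hX).fields m ↔ (T 0, m) ∈ flowDomain X :=
  ⟨fun h ↦ h.2, fun h ↦ ⟨trivial, h⟩⟩

lemma Word.multiflow_cons (hX : X ∈ D) (w : Word D) (t : ℝ) (T : Fin w.length → ℝ) (m : M) :
    multiflow (Word.cons hX w).fields (Fin.cons t T : Fin (w.length + 1) → ℝ) m =
      flow X t (multiflow w.fields T m) := rfl

lemma Word.mem_timeDomain_cons (hX : X ∈ D) (w : Word D) {t : ℝ} {T : Fin w.length → ℝ}
    {m : M} : (Fin.cons t T : Fin (w.length + 1) → ℝ) ∈ timeDomain (Word.cons hX w).fields m ↔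
      T ∈ timeDomain w.fields m ∧ (t, multiflow w.fields T m) ∈ flowDomain X := Iff.rfl

lemma multiflow_induction {m : M} {Q : (M → M) → Prop} (hid : Q id)
    (hflow : ∀ X ∈ D, ∀ (t : ℝ) (f : M → M), Q f → (t, f m) ∈ flowDomain X → Q (flow X t ∘ f))
    (w : Word D) (T : Fin w.length → ℝ) (hT : T ∈ timeDomain w.fields m) :
    Q (multiflow w.fields T) := by
  suffices ∀ (n : ℕ) (ξ : Fin n → LocalVectorField d M), (∀ i, ξ i ∈ D) →
      ∀ T ∈ timeDomain ξ m, Q (multiflow ξ T) from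
    this w.length w.fields (fun i ↦ (w.2 i).2) T hT
  intro n
  induction n with
  | zero => exact fun _ _ _ _ ↦ hid
  | succ n ih =>
    exact fun ξ hξ T hT ↦
      hflow _ (hξ 0) _ _ (ih (Fin.tail ξ) (fun i ↦ hξ i.succ) (Fin.tail T) hT.1) hT.2

lemma mem_orbitDistribution (hX : X ∈ D) {m : M} (hm : m ∈ X.domain) :
    X.toFun m ∈ orbitDistribution D m :=
  (orbitDistribution_isLeast D).1.2 m (Submodule.subset_span ⟨X, hX, hm, rfl⟩)

variable [T2Space M]

section Family

variable {E : Type*} [NormedAddCommGroup E] [NormedSpace ℝ E]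
  {H : Type*} [TopologicalSpace H] {I : ModelWithCorners ℝ E H}
  {P : Type*} [TopologicalSpace P] [ChartedSpace H P] {τ : P → ℝ} {g : P → M} {p : P}

lemma hasMFDerivAt_flow_family {τ' : TangentSpace I p →L[ℝ] ℝ}
    {g' : TangentSpace I p →L[ℝ] TangentSpace (𝓡 d) (g p)}
    (hτ : HasMFDerivAt I 𝓘(ℝ, ℝ) τ p τ') (hg : HasMFDerivAt I (𝓡 d) g p g')
    (hX : (τ p, g p) ∈ flowDomain X) :
    HasMFDerivAt I (𝓡 d) (fun p ↦ flow X (τ p) (g p)) p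
      (τ'.smulRight (X.toFun (flow X (τ p) (g p))) +
        (mfderiv (𝓡 d) (𝓡 d) (flow X (τ p)) (g p)).comp g') := by
  have hflow : MDifferentiableAt (𝓘(ℝ, ℝ).prod (𝓡 d)) (𝓡 d) (fun q : ℝ × M ↦ flow X q.1 q.2)
      (τ p, g p) := (contMDiffAt_flow hX).mdifferentiableAt (by simp)
  refine (hflow.hasMFDerivAt.comp p (hτ.prodMk hg)).congr_mfderiv
    (ContinuousLinearMap.ext fun ξ ↦ (mfderiv_prod_eq_add_apply hflow).trans ?_)
  exact congrArg₂ (· + ·) (DFunLike.congr_fun (hasMFDerivAt_flow_time hX).mfderiv (τ' ξ)) rfl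

lemma contMDiffAt_flow_family (hτ : ContMDiffAt I 𝓘(ℝ, ℝ) ∞ τ p)
    (hg : ContMDiffAt I (𝓡 d) ∞ g p) (hX : (τ p, g p) ∈ flowDomain X) :
    ContMDiffAt I (𝓡 d) ∞ (fun p ↦ flow X (τ p) (g p)) p :=
  ContMDiffAt.comp (I' := 𝓘(ℝ, ℝ).prod (𝓡 d)) (f := fun p ↦ (τ p, g p))
    (g := fun q : ℝ × M ↦ flow X q.1 q.2) p (contMDiffAt_flow hX) (hτ.prodMk hg)

end Family

lemma multiflowDomain_mem_nhds_and_contMDiffAt {n : ℕ} (ξ : Fin n → LocalVectorField d M)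
    {p : (Fin n → ℝ) × M} (hp : p ∈ multiflowDomain ξ) :
    multiflowDomain ξ ∈ 𝓝 p ∧ ContMDiffAt (𝓘(ℝ, Fin n → ℝ).prod (𝓡 d)) (𝓡 d) ∞
      (fun p : (Fin n → ℝ) × M ↦ multiflow ξ p.1 p.2) p := by
  induction n with
  | zero => exact ⟨Filter.univ_mem, contMDiffAt_snd⟩
  | succ n ih =>
    obtain ⟨hnhds, hsmooth⟩ := ih (Fin.tail ξ) hp.1
    have hhead : ContMDiffAt (𝓘(ℝ, Fin (n + 1) → ℝ).prod (𝓡 d)) 𝓘(ℝ, ℝ) ∞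
        (fun p : (Fin (n + 1) → ℝ) × M ↦ p.1 0) p :=
      (contDiff_apply ℝ ℝ (0 : Fin (n + 1))).contMDiff.contMDiffAt.comp p contMDiffAt_fst
    have htail : ContMDiffAt (𝓘(ℝ, Fin (n + 1) → ℝ).prod (𝓡 d))
        (𝓘(ℝ, Fin n → ℝ).prod (𝓡 d)) ∞
        (fun p : (Fin (n + 1) → ℝ) × M ↦ ((Fin.tail p.1 : Fin n → ℝ), p.2)) p :=
      (ContMDiffAt.comp p
        (contDiff_pi.2 fun i ↦ contDiff_apply ℝ ℝ (Fin.succ i)).contMDiff.contMDiffAt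
        contMDiffAt_fst).prodMk contMDiffAt_snd
    have hsmooth' : ContMDiffAt (𝓘(ℝ, Fin (n + 1) → ℝ).prod (𝓡 d)) (𝓡 d) ∞
        (fun p : (Fin (n + 1) → ℝ) × M ↦ multiflow (Fin.tail ξ) (Fin.tail p.1) p.2) p :=
      ContMDiffAt.comp (f := fun p : (Fin (n + 1) → ℝ) × M ↦ (Fin.tail p.1, p.2)) p hsmooth htail
    refine ⟨Filter.inter_mem (htail.continuousAt hnhds) ?_,
      contMDiffAt_flow_family hhead hsmooth' hp.2⟩
    exact (hhead.continuousAt.prodMk hsmooth'.continuousAt).preimage_mem_nhds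
      ((isOpen_flowDomain (ξ 0)).mem_nhds hp.2)

lemma isOpen_timeDomain {n : ℕ} (ξ : Fin n → LocalVectorField d M) (m : M) :
    IsOpen (timeDomain ξ m) :=
  isOpen_iff_mem_nhds.2 fun _ hT ↦ (Continuous.prodMk_left m).continuousAt.preimage_mem_nhds
    (multiflowDomain_mem_nhds_and_contMDiffAt ξ hT).1

lemma contMDiffAt_multiflow_time {n : ℕ} (ξ : Fin n → LocalVectorField d M) {m : M}
    {T : Fin n → ℝ} (hT : T ∈ timeDomain ξ m) :
    ContMDiffAt 𝓘(ℝ, Fin n → ℝ) (𝓡 d) ∞ (fun T ↦ multiflow ξ T m) T :=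
  ContMDiffAt.comp (f := fun T : Fin n → ℝ ↦ (T, m)) T
    (multiflowDomain_mem_nhds_and_contMDiffAt ξ hT).2 (contMDiffAt_id.prodMk contMDiffAt_const)

lemma Distribution.isInvariant_iff {Δ : Distribution d M} :
    Δ.IsInvariant D ↔ ∀ X ∈ D, ∀ (t : ℝ) (m : M), (t, m) ∈ flowDomain X →
      ∀ v ∈ Δ m, mfderiv (𝓡 d) (𝓡 d) (flow X t) m v ∈ Δ (flow X t m) := by
  refine ⟨fun h X hX t m ht ↦
    h (Word.single hX) (fun _ ↦ t) m ((Word.mem_timeDomain_single hX).2 ht),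
    fun h w T m hT v hv ↦ ?_⟩
  refine (multiflow_induction (Q := fun f ↦ MDifferentiableAt (𝓡 d) (𝓡 d) f m ∧
    mfderiv (𝓡 d) (𝓡 d) f m v ∈ Δ (f m)) ⟨mdifferentiableAt_id, ?_⟩ ?_ w T hT).2
  · rwa [mfderiv_id]
  · rintro X hX t f ⟨hf, hfv⟩ ht
    have hX' : MDifferentiableAt (𝓡 d) (𝓡 d) (flow X t) (f m) :=
      (contMDiffAt_flow_point ht).mdifferentiableAt (by simp)
    refine ⟨hX'.comp m hf, ?_⟩
    rw [mfderiv_comp m hX' hf]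
    exact h X hX t (f m) ht _ hfv

lemma mfderiv_flow_mem_orbitDistribution (hX : X ∈ D) {t : ℝ} {m : M}
    (ht : (t, m) ∈ flowDomain X) {v : TangentSpace (𝓡 d) m} (hv : v ∈ orbitDistribution D m) :
    mfderiv (𝓡 d) (𝓡 d) (flow X t) m v ∈ orbitDistribution D (flow X t m) :=
  Distribution.isInvariant_iff.1 (orbitDistribution_isLeast D).1.1 X hX t m ht v hv

lemma orbitDistribution_le {Δ : Distribution d M} (hD : ∀ X ∈ D, ∀ m ∈ X.domain, X.toFun m ∈ Δ m)
    (hΔ : ∀ X ∈ D, ∀ (t : ℝ) (m : M), (t, m) ∈ flowDomain X →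
      ∀ v ∈ Δ m, mfderiv (𝓡 d) (𝓡 d) (flow X t) m v ∈ Δ (flow X t m)) :
    orbitDistribution D ≤ Δ := by
  refine (orbitDistribution_isLeast D).2 ⟨Distribution.isInvariant_iff.2 hΔ, fun m ↦ ?_⟩
  refine Submodule.span_le.2 ?_
  rintro _ ⟨X, hX, hm, rfl⟩
  exact hD X hX m hm

/-- `Generator D x v` says that the tangent vector `v` at `x` arises from a value of a member of
`D` by finitely many tangent maps of flows of members of `D`. These vectors span `P_D`. -/
inductive Generator (D : Set (LocalVectorField d M)) : (x : M) → TangentSpace (𝓡 d) x → Prop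
  | base {X : LocalVectorField d M} (hX : X ∈ D) {x : M} (hx : x ∈ X.domain) :
    Generator D x (X.toFun x)
  | push {X : LocalVectorField d M} (hX : X ∈ D) {t : ℝ} {x : M} (ht : (t, x) ∈ flowDomain X)
    {v : TangentSpace (𝓡 d) x} (hv : Generator D x v) :
    Generator D (flow X t x) (mfderiv (𝓡 d) (𝓡 d) (flow X t) x v)

lemma orbitDistribution_eq_span_generator (x : M) :
    orbitDistribution D x = Submodule.span ℝ {v | Generator D x v} := by
  refine le_antisymm ?_ (Submodule.span_le.2 fun v hv ↦ ?_)
  · refine orbitDistribution_le (Δ := fun x ↦ Submodule.span ℝ {v | Generator D x v})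
      (fun X hX m hm ↦ Submodule.subset_span (Generator.base hX hm)) (fun X hX t m ht ↦ ?_) x
    change Submodule.span ℝ {v | Generator D m v} ≤
      (Submodule.span ℝ {v | Generator D (flow X t m) v}).comap
        (mfderiv (𝓡 d) (𝓡 d) (flow X t) m).toLinearMap
    exact Submodule.span_le.2 fun v hv ↦ Submodule.subset_span (Generator.push hX ht hv)
  · induction hv with
    | base hX hx => exact mem_orbitDistribution hX hx
    | push hX ht _ ih => exact mfderiv_flow_mem_orbitDistribution hX ht ih

namespace LocalVectorField

/-- The image of `Y` under the local diffeomorphism `Fl^X_t`. -/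
def push (X Y : LocalVectorField d M) (t : ℝ) : LocalVectorField d M where
  domain := ⟨{x | (-t, x) ∈ flowDomain X ∧ flow X (-t) x ∈ Y.domain},
    isOpen_iff_mem_nhds.2 fun _ hx ↦ Filter.inter_mem (eventually_mem_flowDomain hx.1)
      ((contMDiffAt_flow_point hx.1).continuousAt (Y.domain.isOpen.mem_nhds hx.2))⟩
  toFun x := mfderiv (𝓡 d) (𝓡 d) (flow X t) (flow X (-t) x) (Y.toFun (flow X (-t) x))
  smooth := by
    refine (contMDiffOn_mfderiv_apply (f := flow X t)
      (isOpen_iff_mem_nhds.2 fun x hx ↦ eventually_mem_flowDomain hx)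
      (fun x hx ↦ (contMDiffAt_flow_point hx).contMDiffWithinAt) Y.smooth (g := flow X (-t))
      (t := {x | (-t, x) ∈ flowDomain X ∧ flow X (-t) x ∈ Y.domain})
      (fun x hx ↦ (contMDiffAt_flow_point hx.1).contMDiffWithinAt)
      (fun x hx ↦ by simpa using (flow_neg hx.1).1) (fun x hx ↦ hx.2)).congr fun x hx ↦ ?_
    have hback : flow X t (flow X (-t) x) = x := by simpa using (flow_neg hx.1).2
    exact congrArg (fun y ↦ (⟨y, mfderiv (𝓡 d) (𝓡 d) (flow X t) (flow X (-t) x)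
      (Y.toFun (flow X (-t) x))⟩ : TangentBundle (𝓡 d) M)) hback.symm

variable {Y : LocalVectorField d M} {t : ℝ} {x y : M}

lemma mem_domain_push :
    x ∈ (X.push Y t).domain ↔ ∃ y ∈ Y.domain, (t, y) ∈ flowDomain X ∧ flow X t y = x := by
  refine ⟨fun ⟨hx, hY⟩ ↦ ⟨flow X (-t) x, hY, by simpa using flow_neg hx⟩, ?_⟩
  rintro ⟨y, hY, hy, rfl⟩
  exact ⟨(flow_neg hy).1, (congrArg (· ∈ Y.domain) (flow_neg hy).2).mpr hY⟩

lemma push_apply (hy : (t, y) ∈ flowDomain X) :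
    (X.push Y t).toFun (flow X t y) = mfderiv (𝓡 d) (𝓡 d) (flow X t) y (Y.toFun y) := by
  change mfderiv (𝓡 d) (𝓡 d) (flow X t) (flow X (-t) (flow X t y))
    (Y.toFun (flow X (-t) (flow X t y))) = _
  rw [(flow_neg hy).2]

lemma push_mem_fields (hX : X ∈ D) (hY : Y ∈ (orbitDistribution D).fields) :
    X.push Y t ∈ (orbitDistribution D).fields := by
  intro x hx
  obtain ⟨y, hyY, hy, rfl⟩ := mem_domain_push.1 hx
  rw [push_apply hy]
  exact mfderiv_flow_mem_orbitDistribution hX hy (hY y hyY)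

end LocalVectorField

lemma orbitDistribution_eq_spanned_fields (D : Set (LocalVectorField d M)) :
    orbitDistribution D = spanned (orbitDistribution D).fields := by
  refine le_antisymm (orbitDistribution_le ?_ fun X hX t m ht ↦ ?_) fun x ↦ Submodule.span_le.2 ?_
  · exact fun X hX m hm ↦
      Submodule.subset_span ⟨X, fun m hm ↦ mem_orbitDistribution hX hm, hm, rfl⟩
  · change spanned (orbitDistribution D).fields m ≤
      (spanned (orbitDistribution D).fields (flow X t m)).comap
        (mfderiv (𝓡 d) (𝓡 d) (flow X t) m).toLinearMap
    refine Submodule.span_le.2 ?_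
    rintro _ ⟨Y, hY, hm, rfl⟩
    exact Submodule.subset_span ⟨X.push Y t, LocalVectorField.push_mem_fields hX hY,
      LocalVectorField.mem_domain_push.2 ⟨m, hm, ht, rfl⟩, LocalVectorField.push_apply ht⟩
  · rintro _ ⟨X, hX, hm, rfl⟩
    exact hX x hm

theorem orbitDistribution_isSmooth (hD : EverywhereDefined D) :
    (orbitDistribution D).IsSmooth :=
  ⟨_, fun m ↦ let ⟨X, hX, hm⟩ := hD m; ⟨X, fun _ h ↦ mem_orbitDistribution hX h, hm⟩,
    orbitDistribution_eq_spanned_fields D⟩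

end Words

section Orbit

variable {d : ℕ} {M : Type u} [TopologicalSpace M] [ChartedSpace (EuclideanSpace ℝ (Fin d)) M]
  [IsManifold (𝓡 d) ∞ M] {D : Set (LocalVectorField d M)} {X : LocalVectorField d M} {t : ℝ}
  {m x y : M}

lemma orbit_induction {Q : M → Prop} (hm : Q m)
    (hQ : ∀ X ∈ D, ∀ (t : ℝ) (y : M), Q y → (t, y) ∈ flowDomain X → Q (flow X t y)) :
    ∀ x ∈ orbit D m, Q x := by
  rintro x ⟨w, T, hT, rfl⟩
  exact multiflow_induction (Q := fun f ↦ Q (f m)) hm (fun X hX t f ↦ hQ X hX t (f m)) w T hT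

lemma flow_mem_orbit (hX : X ∈ D) (hy : y ∈ orbit D m) (ht : (t, y) ∈ flowDomain X) :
    flow X t y ∈ orbit D m := by
  obtain ⟨w, T, hT, rfl⟩ := hy
  exact ⟨Word.cons hX w, Fin.cons t T, (Word.mem_timeDomain_cons hX w).2 ⟨hT, ht⟩,
    Word.multiflow_cons hX w t T m⟩

lemma orbit_trans (hx : x ∈ orbit D m) (hy : y ∈ orbit D x) : y ∈ orbit D m :=
  orbit_induction (Q := (· ∈ orbit D m)) hx
    (fun _ hX _ _ hy ht ↦ flow_mem_orbit hX hy ht) y hy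

variable [T2Space M]

lemma mem_orbit_self (hD : EverywhereDefined D) (m : M) : m ∈ orbit D m := by
  obtain ⟨X, hX, hm⟩ := hD m
  exact ⟨Word.single hX, fun _ ↦ 0, (Word.mem_timeDomain_single hX).2 (flow_zero hm).1,
    (flow_zero hm).2⟩

lemma orbit_symm (hD : EverywhereDefined D) (hx : x ∈ orbit D m) : m ∈ orbit D x := by
  refine orbit_induction (Q := fun x ↦ m ∈ orbit D x) (mem_orbit_self hD m) ?_ x hx
  intro X hX t y hy ht
  obtain ⟨ht', hback⟩ := flow_neg ht
  have hy' := flow_mem_orbit hX (mem_orbit_self hD (flow X t y)) ht'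
  rw [hback] at hy'
  exact orbit_trans hy' hy

instance (x : M) : FiniteDimensional ℝ (TangentSpace (𝓡 d) x) :=
  inferInstanceAs (FiniteDimensional ℝ (EuclideanSpace ℝ (Fin d)))

lemma finrank_orbitDistribution_flow_le (hX : X ∈ D) (ht : (t, m) ∈ flowDomain X) :
    Module.finrank ℝ (orbitDistribution D m) ≤
      Module.finrank ℝ (orbitDistribution D (flow X t m)) := by
  have hinj : Function.Injective (mfderiv (𝓡 d) (𝓡 d) (flow X t) m) :=
    Function.LeftInverse.injective (mfderiv_flow_neg_mfderiv_flow ht)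
  refine LinearMap.finrank_le_finrank_of_injective
    (f := ((mfderiv (𝓡 d) (𝓡 d) (flow X t) m).toLinearMap.restrict
      (fun v hv ↦ mfderiv_flow_mem_orbitDistribution hX ht hv))) ?_
  exact fun v w h ↦ Subtype.ext (hinj (congrArg Subtype.val h))

lemma finrank_orbitDistribution_flow (hX : X ∈ D) (ht : (t, m) ∈ flowDomain X) :
    Module.finrank ℝ (orbitDistribution D (flow X t m)) =
      Module.finrank ℝ (orbitDistribution D m) := by
  refine le_antisymm ?_ (finrank_orbitDistribution_flow_le hX ht)
  obtain ⟨ht', hback⟩ := flow_neg ht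
  have hle := finrank_orbitDistribution_flow_le hX ht'
  rwa [hback] at hle

theorem finrank_orbitDistribution_of_mem_orbit (hx : x ∈ orbit D m) :
    Module.finrank ℝ (orbitDistribution D x) = Module.finrank ℝ (orbitDistribution D m) :=
  orbit_induction (Q := fun x ↦ Module.finrank ℝ (orbitDistribution D x) =
    Module.finrank ℝ (orbitDistribution D m)) rfl
    (fun _ hX _ _ hy ht ↦ (finrank_orbitDistribution_flow hX ht).trans hy) x hx

end Orbit

/-! ### Plaques -/

section ChartReading

variable {d : ℕ} {M : Type u} [TopologicalSpace M] [ChartedSpace (EuclideanSpace ℝ (Fin d)) M]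
  [IsManifold (𝓡 d) ∞ M] {F : Type*} [NormedAddCommGroup F] [NormedSpace ℝ F] {x₀ : M} {φ : F → M}
  {u : F} {U : Set F}

local notation "𝔼" => EuclideanSpace ℝ (Fin d)

lemma injective_mfderiv_extChartAt {x : M} (hx : x ∈ (extChartAt (𝓡 d) x₀).source) :
    Function.Injective (mfderiv (𝓡 d) 𝓘(ℝ, 𝔼) (extChartAt (𝓡 d) x₀) x) := by
  obtain ⟨A, hA⟩ := isInvertible_mfderiv_extChartAt (I := 𝓡 d) hx
  rw [← hA]
  exact A.injective

lemma fderiv_extChartAt_comp (hφ : MDifferentiableAt 𝓘(ℝ, F) (𝓡 d) φ u)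
    (hu : φ u ∈ (extChartAt (𝓡 d) x₀).source) :
    fderiv ℝ (fun u ↦ extChartAt (𝓡 d) x₀ (φ u)) u =
      (mfderiv (𝓡 d) 𝓘(ℝ, 𝔼) (extChartAt (𝓡 d) x₀) (φ u)).comp
        (mfderiv 𝓘(ℝ, F) (𝓡 d) φ u) := by
  rw [← mfderiv_eq_fderiv]
  exact mfderiv_comp u (mdifferentiableAt_extChartAt (by rwa [extChartAt_source] at hu)) hφ

lemma injective_fderiv_extChartAt_comp_iff (hφ : MDifferentiableAt 𝓘(ℝ, F) (𝓡 d) φ u)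
    (hu : φ u ∈ (extChartAt (𝓡 d) x₀).source) :
    Function.Injective (fderiv ℝ (fun u ↦ extChartAt (𝓡 d) x₀ (φ u)) u) ↔
      Function.Injective (mfderiv 𝓘(ℝ, F) (𝓡 d) φ u) := by
  rw [fderiv_extChartAt_comp hφ hu]
  exact (injective_mfderiv_extChartAt hu).of_comp_iff _

lemma range_fderiv_extChartAt_comp (hφ : MDifferentiableAt 𝓘(ℝ, F) (𝓡 d) φ u)
    (hu : φ u ∈ (extChartAt (𝓡 d) x₀).source) :
    (fderiv ℝ (fun u ↦ extChartAt (𝓡 d) x₀ (φ u)) u).range =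
      (mfderiv 𝓘(ℝ, F) (𝓡 d) φ u).range.map
        (mfderiv (𝓡 d) 𝓘(ℝ, 𝔼) (extChartAt (𝓡 d) x₀) (φ u)).toLinearMap := by
  rw [fderiv_extChartAt_comp hφ hu]
  exact LinearMap.range_comp _ _

lemma contDiffOn_extChartAt_comp (x₀ : M) (hφ : ContMDiffOn 𝓘(ℝ, F) (𝓡 d) ∞ φ U) :
    ContDiffOn ℝ ∞ (fun u ↦ extChartAt (𝓡 d) x₀ (φ u))
      (U ∩ φ ⁻¹' (extChartAt (𝓡 d) x₀).source) := by
  refine ((contMDiffOn_extChartAt (n := ∞) (I := 𝓡 d) (x := x₀)).comp (hφ.mono inter_subset_left)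
    fun _ hu ↦ ?_).contDiffOn
  rw [← extChartAt_source (𝓡 d)]
  exact hu.2

variable [FiniteDimensional ℝ F]

lemma exists_leftInverse_of_injective_mfderiv (hU : IsOpen U)
    (hφ : ContMDiffOn 𝓘(ℝ, F) (𝓡 d) ∞ φ U) (hu : u ∈ U)
    (hinj : Function.Injective (mfderiv 𝓘(ℝ, F) (𝓡 d) φ u)) :
    ∃ r : M → F, ContMDiffAt (𝓡 d) 𝓘(ℝ, F) ∞ r (φ u) ∧ ∀ᶠ u' in 𝓝 u, r (φ u') = u' := by
  have hsrc : φ u ∈ (extChartAt (𝓡 d) (φ u)).source := mem_extChartAt_source (φ u)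
  have hd : MDifferentiableAt 𝓘(ℝ, F) (𝓡 d) φ u :=
    (hφ.contMDiffAt (hU.mem_nhds hu)).mdifferentiableAt (by simp)
  obtain ⟨r, hr, hru⟩ := exists_contDiffAt_leftInverse
    (hφ.continuousOn.isOpen_inter_preimage hU (isOpen_extChartAt_source (φ u)))
    (contDiffOn_extChartAt_comp (φ u) hφ) ⟨hu, hsrc⟩
    ((injective_fderiv_extChartAt_comp_iff hd hsrc).2 hinj)
  exact ⟨fun x ↦ r (extChartAt (𝓡 d) (φ u) x),
    hr.contMDiffAt.comp (φ u) (contMDiffAt_extChartAt), hru⟩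

lemma eventually_injective_mfderiv (hU : IsOpen U) (hφ : ContMDiffOn 𝓘(ℝ, F) (𝓡 d) ∞ φ U)
    (hu : u ∈ U) (hinj : Function.Injective (mfderiv 𝓘(ℝ, F) (𝓡 d) φ u)) :
    ∀ᶠ u' in 𝓝 u, Function.Injective (mfderiv 𝓘(ℝ, F) (𝓡 d) φ u') := by
  have hd {u' : F} (hu' : u' ∈ U) : MDifferentiableAt 𝓘(ℝ, F) (𝓡 d) φ u' :=
    (hφ.contMDiffAt (hU.mem_nhds hu')).mdifferentiableAt (by simp)
  have hsrc : φ u ∈ (extChartAt (𝓡 d) (φ u)).source := mem_extChartAt_source (φ u)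
  have hnhds := (hφ.continuousOn.isOpen_inter_preimage hU
    (isOpen_extChartAt_source (I := 𝓡 d) (φ u))).mem_nhds ⟨hu, hsrc⟩
  have hcont := ((contDiffOn_extChartAt_comp (φ u) hφ).contDiffAt hnhds).continuousAt_fderiv
    (by simp)
  filter_upwards [eventually_injective hcont
    ((injective_fderiv_extChartAt_comp_iff (hd hu) hsrc).2 hinj), hnhds] with u' hinj' hu'
  exact (injective_fderiv_extChartAt_comp_iff (hd hu'.1) hu'.2).1 hinj'

end ChartReading

section Frames

variable {d : ℕ} {M : Type u} [TopologicalSpace M] [ChartedSpace (EuclideanSpace ℝ (Fin d)) M]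
  {F : Type*} [NormedAddCommGroup F] [NormedSpace ℝ F] [FiniteDimensional ℝ F]
  {ι : Type*} {x₀ x : M}

local notation "𝔼" => EuclideanSpace ℝ (Fin d)

lemma chartField_extChartAt (hx : x ∈ (extChartAt (𝓡 d) x₀).source)
    (X : (x : M) → TangentSpace (𝓡 d) x) :
    chartField x₀ X (extChartAt (𝓡 d) x₀ x) =
      mfderiv (𝓡 d) 𝓘(ℝ, 𝔼) (extChartAt (𝓡 d) x₀) x (X x) := by
  rw [chartField, (extChartAt (𝓡 d) x₀).left_inv hx]

variable [IsManifold (𝓡 d) ∞ M]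

lemma exists_linearIndependent_of_mem (D : Set (LocalVectorField d M)) (x₀ : M) :
    ∃ X : Fin (Module.finrank ℝ (spanned D x₀)) → LocalVectorField d M,
      (∀ i, X i ∈ D) ∧ (∀ i, x₀ ∈ (X i).domain) ∧ LinearIndependent ℝ fun i ↦ (X i).toFun x₀ := by
  obtain ⟨f, hf, -, hind⟩ := Submodule.exists_fun_fin_finrank_span_eq ℝ
    {v | ∃ X ∈ D, x₀ ∈ X.domain ∧ X.toFun x₀ = v}
  choose X hXD hX hXf using hf
  exact ⟨X, hXD, hX, funext hXf ▸ hind⟩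

/-- The linear map that takes the basis `b` to the vector fields `X i`, read at the point with
coordinates `e` in the chart around `x₀`. -/
def chartFrame (b : Module.Basis ι ℝ F) (X : ι → LocalVectorField d M) (x₀ : M) (e : 𝔼) :
    F →L[ℝ] 𝔼 :=
  LinearMap.toContinuousLinearMap (b.constr ℝ fun i ↦ chartField x₀ (X i).toFun e)

variable {b : Module.Basis ι ℝ F} {X : ι → LocalVectorField d M}

lemma contDiffAt_chartFrame [Finite ι] (hX : ∀ i, x₀ ∈ (X i).domain) :
    ContDiffAt ℝ ∞ (chartFrame b X x₀) (extChartAt (𝓡 d) x₀ x₀) := by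
  have := Fintype.ofFinite ι
  have hfields : ContDiffAt ℝ ∞ (fun e i ↦ chartField x₀ (X i).toFun e)
      (extChartAt (𝓡 d) x₀ x₀) :=
    contDiffAt_pi.2 fun i ↦ ((X i).contDiffOn_chartField x₀).contDiffAt
      ((isOpen_extChartAt_target_inter_preimage x₀ (X i).domain.isOpen).mem_nhds
        ⟨mem_extChartAt_target x₀, by simpa using hX i⟩)
  let L : (ι → 𝔼) →ₗ[ℝ] F →L[ℝ] 𝔼 :=
    LinearMap.toContinuousLinearMap.toLinearMap ∘ₗ (b.constr ℝ).toLinearMap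
  exact L.toContinuousLinearMap.contDiff.contDiffAt.comp _ hfields

lemma range_chartFrame (hx : x ∈ (extChartAt (𝓡 d) x₀).source) :
    (chartFrame b X x₀ (extChartAt (𝓡 d) x₀ x)).range =
      (Submodule.span ℝ (range fun i ↦ (X i).toFun x)).map
        (mfderiv (𝓡 d) 𝓘(ℝ, 𝔼) (extChartAt (𝓡 d) x₀) x).toLinearMap := by
  rw [Submodule.map_span, ← range_comp]
  refine (b.constr_range ℝ).trans ?_
  simp only [chartField_extChartAt hx]
  rfl

lemma injective_chartFrame (hx : x ∈ (extChartAt (𝓡 d) x₀).source)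
    (hX : LinearIndependent ℝ fun i ↦ (X i).toFun x) :
    Function.Injective (chartFrame b X x₀ (extChartAt (𝓡 d) x₀ x)) := by
  refine b.injective_constr_of_linearIndependent ?_
  simp only [chartField_extChartAt hx]
  exact hX.map' _ (LinearMap.ker_eq_bot.2 (injective_mfderiv_extChartAt hx))

theorem Distribution.IsSmooth.exists_frame {Δ : Distribution d M} (hΔ : Δ.IsSmooth) (x₀ : M)
    (hF : Module.finrank ℝ (Δ x₀) = Module.finrank ℝ F) :
    ∃ Y : 𝔼 → F →L[ℝ] 𝔼, ContDiffAt ℝ ∞ Y (extChartAt (𝓡 d) x₀ x₀) ∧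
      ∀ᶠ x in 𝓝 x₀, Module.finrank ℝ (Δ x) = Module.finrank ℝ F →
        (Y (extChartAt (𝓡 d) x₀ x)).range =
          (Δ x).map (mfderiv (𝓡 d) 𝓘(ℝ, 𝔼) (extChartAt (𝓡 d) x₀) x).toLinearMap := by
  obtain ⟨D, -, rfl⟩ := hΔ
  obtain ⟨X, hXD, hX, hind⟩ := exists_linearIndependent_of_mem D x₀
  let b : Module.Basis (Fin (Module.finrank ℝ (spanned D x₀))) ℝ F :=
    Module.finBasisOfFinrankEq ℝ F hF.symm
  have hY : ContDiffAt ℝ ∞ (chartFrame b X x₀) (extChartAt (𝓡 d) x₀ x₀) :=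
    contDiffAt_chartFrame hX
  refine ⟨chartFrame b X x₀, hY, ?_⟩
  filter_upwards [(continuousAt_extChartAt x₀).eventually (eventually_injective hY.continuousAt
      (injective_chartFrame (mem_extChartAt_source x₀) hind)),
    extChartAt_source_mem_nhds (I := 𝓡 d) x₀,
    Filter.eventually_all.2 fun i ↦ (X i).domain.isOpen.mem_nhds (hX i)] with x hinj hx hXx hrank
  have hfin (Q : Submodule ℝ 𝔼) : FiniteDimensional ℝ Q := inferInstance
  refine @Submodule.eq_of_le_of_finrank_eq ℝ 𝔼 _ _ _ _ _ (hfin _) ?_ ?_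
  · rw [range_chartFrame hx]
    exact Submodule.map_mono (Submodule.span_mono
      (range_subset_iff.2 fun i ↦ ⟨X i, hXD i, hXx i, rfl⟩))
  · rw [LinearMap.finrank_range_of_inj hinj, ← hrank]
    exact (Submodule.equivMapOfInjective _ (injective_mfderiv_extChartAt hx) _).finrank_eq

end Frames

section Plaques

variable {d : ℕ} {M : Type u} [TopologicalSpace M] [ChartedSpace (EuclideanSpace ℝ (Fin d)) M]
  {F : Type*} [NormedAddCommGroup F] [NormedSpace ℝ F]
  {Δ : Distribution d M} {U : Set F} {φ : F → M} {u₀ : F}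

/-- A parametrized integral manifold of `Δ`: an immersion `φ`, defined on an open subset `U` of a
vector space, with tangent spaces `Δ`. It need not be injective. -/
structure IsPlaque (Δ : Distribution d M) (U : Set F) (φ : F → M) : Prop where
  isOpen : IsOpen U
  contMDiffOn : ContMDiffOn 𝓘(ℝ, F) (𝓡 d) ∞ φ U
  injective : ∀ u ∈ U, Function.Injective (mfderiv 𝓘(ℝ, F) (𝓡 d) φ u)
  range_eq : ∀ u ∈ U, (mfderiv 𝓘(ℝ, F) (𝓡 d) φ u).range = Δ (φ u)

lemma IsPlaque.mdifferentiableAt (h : IsPlaque Δ U φ) (hu₀ : u₀ ∈ U) :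
    MDifferentiableAt 𝓘(ℝ, F) (𝓡 d) φ u₀ :=
  (h.contMDiffOn.contMDiffAt (h.isOpen.mem_nhds hu₀)).mdifferentiableAt (by simp)

lemma IsPlaque.finrank_eq (h : IsPlaque Δ U φ) (hu₀ : u₀ ∈ U) :
    Module.finrank ℝ (Δ (φ u₀)) = Module.finrank ℝ F := by
  rw [← h.range_eq u₀ hu₀]
  exact LinearMap.finrank_range_of_inj (h.injective u₀ hu₀)

variable [IsManifold (𝓡 d) ∞ M] [FiniteDimensional ℝ F]

lemma IsPlaque.exists_factorization_vectorSpace (hΔ : Δ.IsSmooth) (hφ : IsPlaque Δ U φ)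
    (hu₀ : u₀ ∈ U) {G : Type*} [NormedAddCommGroup G] [NormedSpace ℝ G] {g : G → M} {V : Set G}
    (hV : IsOpen V) (hg : ContMDiffOn 𝓘(ℝ, G) (𝓡 d) ∞ g V) {v₀ : G} (hv₀ : v₀ ∈ V)
    (hgφ : g v₀ = φ u₀) (hgΔ : ∀ v ∈ V, (mfderiv 𝓘(ℝ, G) (𝓡 d) g v).range ≤ Δ (g v))
    (hrank : ∀ v ∈ V, Module.finrank ℝ (Δ (g v)) = Module.finrank ℝ F) :
    ∃ (h : G → F) (W : Set G), IsOpen W ∧ v₀ ∈ W ∧ W ⊆ V ∧ ContDiffOn ℝ ∞ h W ∧ h v₀ = u₀ ∧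
      ∀ v ∈ W, h v ∈ U ∧ g v = φ (h v) := by
  have hsrc : φ u₀ ∈ (extChartAt (𝓡 d) (φ u₀)).source := mem_extChartAt_source _
  have hgsrc : g v₀ ∈ (extChartAt (𝓡 d) (φ u₀)).source := hgφ ▸ hsrc
  have hU' := hφ.contMDiffOn.continuousOn.isOpen_inter_preimage hφ.isOpen
    (isOpen_extChartAt_source (I := 𝓡 d) (φ u₀))
  have hV' := hg.continuousOn.isOpen_inter_preimage hV
    (isOpen_extChartAt_source (I := 𝓡 d) (φ u₀))
  obtain ⟨Y, hY, hYΔ⟩ := hΔ.exists_frame (φ u₀) (hφ.finrank_eq hu₀)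
  have hφY : ∀ᶠ u in 𝓝 u₀, (Y (extChartAt (𝓡 d) (φ u₀) (φ u))).range =
      (fderiv ℝ (fun u ↦ extChartAt (𝓡 d) (φ u₀) (φ u)) u).range := by
    filter_upwards [(hφ.mdifferentiableAt hu₀).continuousAt.eventually hYΔ,
      hU'.mem_nhds ⟨hu₀, hsrc⟩] with u hYu hu
    rw [hYu (hφ.finrank_eq hu.1), range_fderiv_extChartAt_comp (hφ.mdifferentiableAt hu.1) hu.2,
      hφ.range_eq u hu.1]
  have hgY : ∀ᶠ v in 𝓝 v₀, (fderiv ℝ (fun v ↦ extChartAt (𝓡 d) (φ u₀) (g v)) v).range ≤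
      (Y (extChartAt (𝓡 d) (φ u₀) (g v))).range := by
    rw [← hgφ] at hYΔ
    filter_upwards [(hg.continuousOn.continuousAt (hV.mem_nhds hv₀)).eventually hYΔ,
      hV'.mem_nhds ⟨hv₀, hgsrc⟩] with v hYv hv
    rw [← hgφ, hYv (hrank v hv.1), range_fderiv_extChartAt_comp
      ((hg.contMDiffAt (hV.mem_nhds hv.1)).mdifferentiableAt (by simp)) (hgφ ▸ hv.2)]
    exact Submodule.map_mono (hgΔ v hv.1)
  obtain ⟨h, W, hW, hvW, hWV, hh, hh₀, hfac⟩ := exists_factorization hU'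
    (contDiffOn_extChartAt_comp (φ u₀) hφ.contMDiffOn) ⟨hu₀, hsrc⟩
    ((injective_fderiv_extChartAt_comp_iff (hφ.mdifferentiableAt hu₀) hsrc).2
      (hφ.injective u₀ hu₀))
    (hY.of_le (by simp)) hφY hV' (contDiffOn_extChartAt_comp (φ u₀) hg) ⟨hv₀, hgsrc⟩
    (congrArg _ hgφ) hgY
  refine ⟨h, W, hW, hvW, fun v hv ↦ (hWV hv).1, hh, hh₀, fun v hv ↦ ⟨(hfac v hv).1.1, ?_⟩⟩
  exact (extChartAt (𝓡 d) (φ u₀)).injOn (hWV hv).2 (hfac v hv).1.2 (hfac v hv).2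

theorem IsPlaque.exists_factorization (hΔ : Δ.IsSmooth) (hφ : IsPlaque Δ U φ) (hu₀ : u₀ ∈ U)
    {E H : Type*} [NormedAddCommGroup E] [NormedSpace ℝ E] [TopologicalSpace H]
    {I : ModelWithCorners ℝ E H} [I.Boundaryless] {P : Type*} [TopologicalSpace P]
    [ChartedSpace H P] [IsManifold I ∞ P] {g : P → M} {V : Set P} (hV : IsOpen V)
    (hg : ContMDiffOn I (𝓡 d) ∞ g V) {v₀ : P} (hv₀ : v₀ ∈ V) (hgφ : g v₀ = φ u₀)
    (hgΔ : ∀ v ∈ V, (mfderiv I (𝓡 d) g v).range ≤ Δ (g v))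
    (hrank : ∀ v ∈ V, Module.finrank ℝ (Δ (g v)) = Module.finrank ℝ F) :
    ∃ (h : P → F) (W : Set P), IsOpen W ∧ v₀ ∈ W ∧ W ⊆ V ∧ ContMDiffOn I 𝓘(ℝ, F) ∞ h W ∧
      h v₀ = u₀ ∧ ∀ v ∈ W, h v ∈ U ∧ g v = φ (h v) := by
  set θ := extChartAt I v₀
  have hθsymm : ContMDiffOn 𝓘(ℝ, E) I ∞ θ.symm θ.target := contMDiffOn_extChartAt_symm v₀
  have hθ₀ : θ.symm (θ v₀) = v₀ := extChartAt_to_inv v₀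
  have hrange : ∀ e ∈ θ.target ∩ θ.symm ⁻¹' V,
      (mfderiv 𝓘(ℝ, E) (𝓡 d) (g ∘ θ.symm) e).range ≤ Δ (g (θ.symm e)) := fun e he ↦ by
    rw [mfderiv_comp e ((hg.contMDiffAt (hV.mem_nhds he.2)).mdifferentiableAt (by simp))
      ((hθsymm.contMDiffAt ((isOpen_extChartAt_target v₀).mem_nhds he.1)).mdifferentiableAt
        (by simp))]
    exact (LinearMap.range_comp_le_range _ _).trans (hgΔ _ he.2)
  obtain ⟨h, W, hW, hvW, hWV, hh, hh₀, hfac⟩ := hφ.exists_factorization_vectorSpace hΔ hu₀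
    (hθsymm.continuousOn.isOpen_inter_preimage (isOpen_extChartAt_target v₀) hV)
    (hg.comp (hθsymm.mono inter_subset_left) fun e he ↦ he.2)
    ⟨mem_extChartAt_target v₀, by rwa [mem_preimage, hθ₀]⟩
    (by rw [Function.comp_apply, hθ₀, hgφ]) hrange (fun e he ↦ hrank _ he.2)
  refine ⟨h ∘ θ, θ.source ∩ θ ⁻¹' W,
    (continuousOn_extChartAt v₀).isOpen_inter_preimage (isOpen_extChartAt_source v₀) hW,
    ⟨mem_extChartAt_source v₀, hvW⟩, fun v hv ↦ ?_, ?_, hh₀, fun v hv ↦ ?_⟩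
  · simpa only [mem_preimage, θ.left_inv hv.1] using (hWV hv.2).2
  · refine hh.contMDiffOn.comp ((contMDiffOn_extChartAt (n := ∞) (I := I) (x := v₀)).mono ?_)
      fun v hv ↦ hv.2
    rw [← extChartAt_source I]
    exact inter_subset_left
  · simpa only [Function.comp_apply, θ.left_inv hv.1] using hfac _ hv.2

end Plaques

/-! ### Plaques of orbits -/

section OrbitFamilies

variable {d : ℕ} {M : Type u} [TopologicalSpace M] [ChartedSpace (EuclideanSpace ℝ (Fin d)) M]
  [IsManifold (𝓡 d) ∞ M] {D : Set (LocalVectorField d M)} {X : LocalVectorField d M}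
  {F : Type*} [NormedAddCommGroup F] [NormedSpace ℝ F] {m x : M} {W : Set F} {φ : F → M}

local notation "𝔼" => EuclideanSpace ℝ (Fin d)

/-- The points `φ u` of the orbit of `m` have the form `ξ_{A(u)} (m)`, with `A` smooth on `W`. -/
def IsOrbitFamily (D : Set (LocalVectorField d M)) (m : M) (W : Set F) (φ : F → M) : Prop :=
  ∃ (w : Word D) (A : F → Fin w.length → ℝ), ContDiffOn ℝ ∞ A W ∧
    ∀ u ∈ W, A u ∈ timeDomain w.fields m ∧ multiflow w.fields (A u) m = φ u

namespace IsOrbitFamily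

lemma const (hx : x ∈ orbit D m) (W : Set F) : IsOrbitFamily D m W (fun _ ↦ x) := by
  obtain ⟨w, T, hT, rfl⟩ := hx
  exact ⟨w, fun _ ↦ T, contDiffOn_const, fun _ _ ↦ ⟨hT, rfl⟩⟩

lemma mono (h : IsOrbitFamily D m W φ) {W' : Set F} (hW : W' ⊆ W) : IsOrbitFamily D m W' φ := by
  obtain ⟨w, A, hA, hφ⟩ := h
  exact ⟨w, A, hA.mono hW, fun u hu ↦ hφ u (hW hu)⟩

lemma mem_orbit (h : IsOrbitFamily D m W φ) {u : F} (hu : u ∈ W) : φ u ∈ orbit D m := by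
  obtain ⟨w, A, -, hφ⟩ := h
  exact ⟨w, A u, hφ u hu⟩

lemma flow (h : IsOrbitFamily D m W φ) (hX : X ∈ D) {τ : F → ℝ} (hτ : ContDiffOn ℝ ∞ τ W)
    (hdom : ∀ u ∈ W, (τ u, φ u) ∈ flowDomain X) :
    IsOrbitFamily D m W (fun u ↦ Sussmann.flow X (τ u) (φ u)) := by
  obtain ⟨w, A, hA, hφ⟩ := h
  refine ⟨Word.cons hX w, fun u ↦ (Fin.cons (τ u) (A u) : Fin (w.length + 1) → ℝ),
    contDiffOn_pi.2 (Fin.cases hτ (contDiffOn_pi.1 hA)), fun u hu ↦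
      ⟨(Word.mem_timeDomain_cons hX w).2 ⟨(hφ u hu).1, ?_⟩,
        (Word.multiflow_cons hX w _ _ m).trans ?_⟩⟩
  · rw [(hφ u hu).2]
    exact hdom u hu
  · rw [(hφ u hu).2]

end IsOrbitFamily

/-- The linear map `L` is the derivative at `0` of a family of points of the orbit of `m` that
passes through `x`. As for local vector fields, `T_x M` is the model space. -/
def IsOrbitDerivative (D : Set (LocalVectorField d M)) (m x : M) (L : F →L[ℝ] 𝔼) : Prop :=
  ∃ (W : Set F) (φ : F → M), IsOpen W ∧ 0 ∈ W ∧ IsOrbitFamily D m W φ ∧ φ 0 = x ∧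
    HasMFDerivAt 𝓘(ℝ, F) (𝓡 d) φ 0 L

lemma IsOrbitDerivative.zero (hx : x ∈ orbit D m) : IsOrbitDerivative D m x (0 : F →L[ℝ] 𝔼) :=
  ⟨univ, fun _ ↦ x, isOpen_univ, trivial, IsOrbitFamily.const hx _, rfl, hasMFDerivAt_const x 0⟩

variable [T2Space M]

lemma mfderiv_multiflow_time_mem {n : ℕ} (ξ : Fin n → LocalVectorField d M) (hξ : ∀ i, ξ i ∈ D)
    {T : Fin n → ℝ} (hT : T ∈ timeDomain ξ m) (a : Fin n → ℝ) :
    mfderiv 𝓘(ℝ, Fin n → ℝ) (𝓡 d) (fun T ↦ multiflow ξ T m) T a ∈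
      orbitDistribution D (multiflow ξ T m) := by
  induction n with
  | zero =>
    change mfderiv 𝓘(ℝ, Fin 0 → ℝ) (𝓡 d) (fun _ ↦ m) T a ∈ _
    rw [mfderiv_const]
    exact Submodule.zero_mem _
  | succ n ih =>
    obtain ⟨hTtail, hT₀⟩ := hT
    let head : (Fin (n + 1) → ℝ) →L[ℝ] ℝ := ContinuousLinearMap.proj 0
    let tail : (Fin (n + 1) → ℝ) →L[ℝ] Fin n → ℝ :=
      ContinuousLinearMap.pi fun i ↦ ContinuousLinearMap.proj i.succ
    have hhead : HasMFDerivAt 𝓘(ℝ, Fin (n + 1) → ℝ) 𝓘(ℝ, ℝ) (fun T ↦ T 0) T head :=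
      head.hasFDerivAt.hasMFDerivAt
    have htail : HasMFDerivAt 𝓘(ℝ, Fin (n + 1) → ℝ) 𝓘(ℝ, Fin n → ℝ) Fin.tail T tail :=
      tail.hasFDerivAt.hasMFDerivAt
    have hmultiflow := (((contMDiffAt_multiflow_time (Fin.tail ξ) hTtail).mdifferentiableAt
      (by simp)).hasMFDerivAt).comp T htail
    have hcons := (hasMFDerivAt_flow_family (X := ξ 0) hhead hmultiflow hT₀).mfderiv
    change mfderiv 𝓘(ℝ, Fin (n + 1) → ℝ) (𝓡 d) (fun T ↦ flow (ξ 0) (T 0)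
      (((fun T ↦ multiflow (Fin.tail ξ) T m) ∘ Fin.tail) T)) T a ∈ _
    rw [hcons]
    exact Submodule.add_mem _
      (Submodule.smul_mem _ _ (mem_orbitDistribution (hξ 0) (flow_mem_domain hT₀)))
      (mfderiv_flow_mem_orbitDistribution (hξ 0) hT₀
        (ih (Fin.tail ξ) (fun i ↦ hξ i.succ) hTtail _))

namespace IsOrbitFamily

lemma contMDiffOn (h : IsOrbitFamily D m W φ) : ContMDiffOn 𝓘(ℝ, F) (𝓡 d) ∞ φ W := by
  obtain ⟨w, A, hA, hφ⟩ := h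
  have hmultiflow : ContMDiffOn 𝓘(ℝ, Fin w.length → ℝ) (𝓡 d) ∞
      (fun T ↦ multiflow w.fields T m) (timeDomain w.fields m) := fun T hT ↦
    (contMDiffAt_multiflow_time w.fields hT).contMDiffWithinAt
  exact (hmultiflow.comp hA.contMDiffOn fun u hu ↦ (hφ u hu).1).congr fun u hu ↦ (hφ u hu).2.symm

lemma mfderiv_mem (h : IsOrbitFamily D m W φ) (hW : IsOpen W) {u : F} (hu : u ∈ W)
    (ζ : TangentSpace 𝓘(ℝ, F) u) :
    mfderiv 𝓘(ℝ, F) (𝓡 d) φ u ζ ∈ orbitDistribution D (φ u) := by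
  obtain ⟨w, A, hA, hφ⟩ := h
  have hcomp := ((contMDiffAt_multiflow_time w.fields (hφ u hu).1).mdifferentiableAt
    (by simp)).hasMFDerivAt.comp u
    ((hA.contDiffAt (hW.mem_nhds hu)).differentiableAt (by simp)).hasFDerivAt.hasMFDerivAt
  have heq : φ =ᶠ[𝓝 u] (fun T ↦ multiflow w.fields T m) ∘ A := by
    filter_upwards [hW.mem_nhds hu] with u' hu'
    exact (hφ u' hu').2.symm
  rw [(hcomp.congr_of_eventuallyEq heq).mfderiv, ← (hφ u hu).2]
  exact mfderiv_multiflow_time_mem w.fields (fun i ↦ (w.2 i).2) (hφ u hu).1 _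

end IsOrbitFamily

namespace IsOrbitDerivative

variable {L : F →L[ℝ] EuclideanSpace ℝ (Fin d)} {t : ℝ}

lemma flow_time (h : IsOrbitDerivative D m x L) (hX : X ∈ D) (ht : (t, x) ∈ flowDomain X)
    {B : 𝔼 →L[ℝ] 𝔼} (hB : HasMFDerivAt (𝓡 d) (𝓡 d) (Sussmann.flow X t) x B) (ℓ : F →L[ℝ] ℝ) :
    IsOrbitDerivative D m (flow X t x)
      (ℓ.smulRight (M₂ := 𝔼) (X.toFun (flow X t x)) + B.comp L) := by
  obtain ⟨W, φ, hW, h₀, hφ, rfl, hL⟩ := h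
  have hτ : ContDiff ℝ ∞ fun u ↦ t + ℓ u := contDiff_const.add ℓ.contDiff
  have hτ₀ : t + ℓ 0 = t := by simp
  have hτ' : HasMFDerivAt 𝓘(ℝ, F) 𝓘(ℝ, ℝ) (fun u ↦ t + ℓ u) 0 ℓ :=
    (ℓ.hasFDerivAt.const_add t).hasMFDerivAt
  have hflow := hasMFDerivAt_flow_family hτ' hL (by rwa [hτ₀])
  rw [hτ₀, hB.mfderiv] at hflow
  exact ⟨W ∩ (fun u ↦ (t + ℓ u, φ u)) ⁻¹' flowDomain X, fun u ↦ flow X (t + ℓ u) (φ u),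
    (hτ.continuous.continuousOn.prodMk hφ.contMDiffOn.continuousOn).isOpen_inter_preimage hW
      (isOpen_flowDomain X), ⟨h₀, by rwa [mem_preimage, hτ₀]⟩,
    (hφ.mono inter_subset_left).flow hX hτ.contDiffOn fun u hu ↦ hu.2,
    congrArg (fun s ↦ Sussmann.flow X s (φ 0)) hτ₀, hflow⟩

lemma flow (h : IsOrbitDerivative D m x L) (hX : X ∈ D) (ht : (t, x) ∈ flowDomain X)
    {B : 𝔼 →L[ℝ] 𝔼} (hB : HasMFDerivAt (𝓡 d) (𝓡 d) (Sussmann.flow X t) x B) :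
    IsOrbitDerivative D m (flow X t x) (B.comp L) := by
  have hzero : (0 : F →L[ℝ] ℝ).smulRight (M₂ := 𝔼) (X.toFun (Sussmann.flow X t x)) = 0 :=
    ContinuousLinearMap.ext fun _ ↦ zero_smul ℝ _
  have hflow := h.flow_time hX ht hB 0
  rwa [hzero, zero_add] at hflow

lemma add_smulRight_field (h : IsOrbitDerivative D m x L) (hX : X ∈ D) (hx : x ∈ X.domain)
    (ℓ : F →L[ℝ] ℝ) : IsOrbitDerivative D m x (L + ℓ.smulRight (M₂ := 𝔼) (X.toFun x)) := by
  have hid : HasMFDerivAt (𝓡 d) (𝓡 d) (Sussmann.flow X 0) x (ContinuousLinearMap.id ℝ 𝔼) := by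
    refine (hasMFDerivAt_id x).congr_of_eventuallyEq ?_
    filter_upwards [X.domain.isOpen.mem_nhds hx] with y hy using (flow_zero hy).2
  have hflow := h.flow_time hX (flow_zero hx).1 hid ℓ
  rwa [(flow_zero hx).2, ContinuousLinearMap.id_comp, add_comm] at hflow

end IsOrbitDerivative

lemma mfderiv_flow_mfderiv_flow_neg {t : ℝ} (h : (t, m) ∈ flowDomain X)
    (v : TangentSpace (𝓡 d) (flow X t m)) :
    mfderiv (𝓡 d) (𝓡 d) (flow X t) m (mfderiv (𝓡 d) (𝓡 d) (flow X (-t)) (flow X t m) v) = v := by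
  have hv := mfderiv_flow_neg_mfderiv_flow (flow_neg h).1 v
  rwa [neg_neg, (flow_neg h).2] at hv

lemma IsOrbitDerivative.add_smulRight_generator {v : TangentSpace (𝓡 d) x}
    (hv : Generator D x v) {L : F →L[ℝ] 𝔼} (h : IsOrbitDerivative D m x L) (ℓ : F →L[ℝ] ℝ) :
    IsOrbitDerivative D m x (L + ℓ.smulRight (M₂ := 𝔼) v) := by
  induction hv generalizing L with
  | base hX hx => exact h.add_smulRight_field hX hx ℓ
  | @push X hX t x ht v _ ih =>
    -- Flow back to `x`, change the derivative there, and return.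
    have hneg : HasMFDerivAt (𝓡 d) (𝓡 d) (Sussmann.flow X (-t)) (Sussmann.flow X t x) _ :=
      ((contMDiffAt_flow_point (flow_neg ht).1).mdifferentiableAt (by simp)).hasMFDerivAt
    have hpos : HasMFDerivAt (𝓡 d) (𝓡 d) (Sussmann.flow X t) x _ :=
      ((contMDiffAt_flow_point ht).mdifferentiableAt (by simp)).hasMFDerivAt
    have hback := h.flow hX (flow_neg ht).1 hneg
    rw [(flow_neg ht).2] at hback
    convert (ih hback).flow hX ht hpos using 1
    refine ContinuousLinearMap.ext fun ζ ↦ ?_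
    refine (congrArg₂ (fun a b : 𝔼 ↦ a + b) (mfderiv_flow_mfderiv_flow_neg ht (L ζ)) ?_).symm.trans
      (map_add (mfderiv (𝓡 d) (𝓡 d) (Sussmann.flow X t) x) _ _).symm
    exact map_smul (mfderiv (𝓡 d) (𝓡 d) (Sussmann.flow X t) x) _ _

lemma IsOrbitDerivative.sum_smulRight {ι : Type*} (s : Finset ι) (hx : x ∈ orbit D m)
    {v : ι → TangentSpace (𝓡 d) x} (hv : ∀ i, Generator D x (v i)) (ℓ : ι → F →L[ℝ] ℝ) :
    IsOrbitDerivative D m x (∑ i ∈ s, (ℓ i).smulRight (M₂ := 𝔼) (v i)) := by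
  classical
  induction s using Finset.induction_on with
  | empty => exact IsOrbitDerivative.zero hx
  | insert i s hi ih =>
    rw [Finset.sum_insert hi, add_comm]
    exact ih.add_smulRight_generator (hv i) (ℓ i)

end OrbitFamilies

section OrbitPlaques

variable {d : ℕ} {M : Type u} [TopologicalSpace M] [ChartedSpace (EuclideanSpace ℝ (Fin d)) M]
  [IsManifold (𝓡 d) ∞ M] [T2Space M] {D : Set (LocalVectorField d M)} {m x : M} {k : ℕ}

lemma exists_linearIndependent_generator
    (hk : Module.finrank ℝ (orbitDistribution D x) = k) :
    ∃ v : Fin k → TangentSpace (𝓡 d) x, (∀ i, Generator D x (v i)) ∧ LinearIndependent ℝ v := by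
  rw [orbitDistribution_eq_span_generator] at hk
  subst hk
  obtain ⟨v, hv, -, hind⟩ := Submodule.exists_fun_fin_finrank_span_eq ℝ {v | Generator D x v}
  exact ⟨v, hv, hind⟩

lemma exists_orbitFamily_injective_mfderiv (hx : x ∈ orbit D m)
    (hk : Module.finrank ℝ (orbitDistribution D x) = k) :
    ∃ (W : Set (EuclideanSpace ℝ (Fin k))) (φ : EuclideanSpace ℝ (Fin k) → M), IsOpen W ∧ 0 ∈ W ∧
      IsOrbitFamily D m W φ ∧ φ 0 = x ∧
        Function.Injective (mfderiv 𝓘(ℝ, EuclideanSpace ℝ (Fin k)) (𝓡 d) φ 0) := by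
  obtain ⟨v, hv, hind⟩ := exists_linearIndependent_generator hk
  obtain ⟨W, φ, hW, h₀, hφ, hφ₀, hL⟩ :=
    IsOrbitDerivative.sum_smulRight Finset.univ hx hv fun i ↦ EuclideanSpace.proj (𝕜 := ℝ) i
  refine ⟨W, φ, hW, h₀, hφ, hφ₀, ?_⟩
  rw [hL.mfderiv]
  refine (injective_iff_map_eq_zero (∑ i : Fin k, (EuclideanSpace.proj (𝕜 := ℝ) i).smulRight
    (M₂ := EuclideanSpace ℝ (Fin d)) (v i))).2 fun ζ hζ ↦ ?_
  ext i
  refine Fintype.linearIndependent_iff.1 hind (fun i ↦ ζ i) ?_ i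
  rw [sum_apply] at hζ
  exact hζ

theorem exists_orbit_plaque (hx : x ∈ orbit D m)
    (hk : Module.finrank ℝ (orbitDistribution D m) = k) :
    ∃ (U : Set (EuclideanSpace ℝ (Fin k))) (φ : EuclideanSpace ℝ (Fin k) → M),
      IsPlaque (orbitDistribution D) U φ ∧ 0 ∈ U ∧ φ 0 = x ∧ IsOrbitFamily D m U φ ∧
        InjOn φ U := by
  obtain ⟨W, φ, hW, h₀, hφ, hφ₀, hinj⟩ := exists_orbitFamily_injective_mfderiv hx
    ((finrank_orbitDistribution_of_mem_orbit hx).trans hk)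
  obtain ⟨r, -, hr⟩ := exists_leftInverse_of_injective_mfderiv hW hφ.contMDiffOn h₀ hinj
  obtain ⟨U, hsub, hU, hU₀⟩ := eventually_nhds_iff.1
    ((eventually_injective_mfderiv hW hφ.contMDiffOn h₀ hinj).and (hr.and (hW.mem_nhds h₀)))
  have hφU : IsOrbitFamily D m U φ := hφ.mono fun u hu ↦ (hsub u hu).2.2
  refine ⟨U, φ, ⟨hU, hφU.contMDiffOn, fun u hu ↦ (hsub u hu).1, fun u hu ↦ ?_⟩, hU₀, hφ₀, hφU,
    LeftInvOn.injOn fun u hu ↦ (hsub u hu).2.1⟩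
  refine Submodule.eq_of_le_of_finrank_eq
    (LinearMap.range_le_iff_comap.2 (eq_top_iff.2 fun ζ _ ↦ hφU.mfderiv_mem hU hu ζ)) ?_
  rw [finrank_orbitDistribution_of_mem_orbit (hφU.mem_orbit hu), hk]
  exact (LinearMap.finrank_range_of_inj (hsub u hu).1).trans finrank_euclideanSpace_fin

end OrbitPlaques

/-! ### The Poincaré–Volterra theorem -/

section Countability

lemma countable_setOf_reflTransGen {ι : Type*} {r : ι → ι → Prop}
    (hr : ∀ i, {j | r i j}.Countable) (i : ι) : {j | Relation.ReflTransGen r i j}.Countable := by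
  let reach (n : ℕ) : Set ι := (fun s ↦ ⋃ j ∈ s, {k | r j k})^[n] {i}
  have hsucc (n : ℕ) : reach (n + 1) = ⋃ j ∈ reach n, {k | r j k} :=
    Function.iterate_succ_apply' _ n _
  have hcountable (n : ℕ) : (reach n).Countable := by
    induction n with
    | zero => exact countable_singleton i
    | succ n ih => exact hsucc n ▸ ih.biUnion fun j _ ↦ hr j
  refine (countable_iUnion hcountable).mono fun j hj ↦ ?_
  induction hj with
  | refl => exact mem_iUnion.2 ⟨0, rfl⟩
  | @tail j k _ hjk ih =>
    obtain ⟨n, hn⟩ := mem_iUnion.1 ih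
    exact mem_iUnion.2 ⟨n + 1, hsucc n ▸ mem_iUnion₂.2 ⟨j, hn, hjk⟩⟩

lemma countable_setOf_nonempty_of_iUnion_eq_univ {P ι : Type*} [TopologicalSpace P]
    [PreconnectedSpace P] {U : ι → Set P} (hU : ∀ i, IsOpen (U i)) (hcover : ⋃ i, U i = univ)
    (hcount : ∀ i, {j | (U i ∩ U j).Nonempty}.Countable) : {i | (U i).Nonempty}.Countable := by
  rcases eq_empty_or_nonempty {i | (U i).Nonempty} with hempty | ⟨i₀, p, hp⟩
  · exact hempty ▸ countable_empty
  let Meets (i j : ι) : Prop := (U i ∩ U j).Nonempty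
  let Reachable (q : P) : Prop := ∃ i, Relation.ReflTransGen Meets i₀ i ∧ q ∈ U i
  have hreachable {i : ι} {q q' : P} (hq : q ∈ U i) (hq' : q' ∈ U i) (h : Reachable q) :
      Reachable q' := by
    obtain ⟨k, hk, hqk⟩ := h
    exact ⟨i, hk.tail ⟨q, hqk, hq⟩, hq'⟩
  have hconst : IsLocallyConstant Reachable := (IsLocallyConstant.iff_exists_open _).2 fun q ↦ by
    obtain ⟨i, hi⟩ := mem_iUnion.1 (hcover ▸ mem_univ q)
    exact ⟨U i, hU i, hi, fun q' hq' ↦ propext ⟨hreachable hq' hi, hreachable hi hq'⟩⟩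
  refine (countable_setOf_reflTransGen hcount i₀).mono ?_
  rintro j ⟨q, hq⟩
  have hreach : Reachable q := (hconst.apply_eq_of_preconnectedSpace p q).mp ⟨i₀, .refl, hp⟩
  obtain ⟨i, hi, hqi⟩ := hreach
  exact hi.tail ⟨q, hqi, hq⟩

lemma sigmaCompactSpace_of_paracompactSpace {X : Type*} [TopologicalSpace X] [T2Space X]
    [LocallyCompactSpace X] [ParacompactSpace X] [PreconnectedSpace X] : SigmaCompactSpace X := by
  choose K hKc hK using fun x : X ↦ exists_compact_mem_nhds x
  obtain ⟨V, hV, hcover, hfinite, hVK⟩ := precise_refinement (fun x ↦ interior (K x))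
    (fun _ ↦ isOpen_interior)
    (eq_univ_of_forall fun x ↦ mem_iUnion.2 ⟨x, mem_interior_iff_mem_nhds.2 (hK x)⟩)
  have hcountable : {x | (V x).Nonempty}.Countable := by
    refine countable_setOf_nonempty_of_iUnion_eq_univ hV hcover fun x ↦
      ((hfinite.finite_nonempty_inter_compact (hKc x)).subset ?_).countable
    rintro y ⟨z, hzx, hzy⟩
    exact ⟨z, hzy, interior_subset (hVK x hzx)⟩
  have := hcountable.to_subtype
  refine ⟨(isSigmaCompact_iUnion_of_isCompact (fun x : {x | (V x).Nonempty} ↦ K x)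
    fun x ↦ hKc x).of_isClosed_subset isClosed_univ fun z _ ↦ ?_⟩
  obtain ⟨x, hx⟩ := mem_iUnion.1 (hcover ▸ mem_univ z)
  exact mem_iUnion.2 ⟨⟨x, z, hx⟩, interior_subset (hVK x hx)⟩

end Countability

section PoincareVolterra

variable {M P : Type*} [TopologicalSpace M] [TopologicalSpace P]

lemma countable_setOf_connectedComponentIn_inter_nonempty [LocallyConnectedSpace P]
    {𝒱 : Set (Set P)} (h𝒱 : 𝒱.Countable) (hopen : ∀ V ∈ 𝒱, IsOpen V) {s : Set P}
    (hs : IsSeparable s) :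
    {C | ∃ V ∈ 𝒱, ∃ p ∈ V, C = connectedComponentIn V p ∧ (s ∩ C).Nonempty}.Countable := by
  obtain ⟨Q, hQ, hsQ⟩ := hs
  refine (h𝒱.biUnion fun V _ ↦ hQ.image fun q ↦ connectedComponentIn V q).mono ?_
  rintro _ ⟨V, hV, p, -, rfl, z, hzs, hz⟩
  obtain ⟨q, hq, hqQ⟩ := mem_closure_iff.1 (hsQ hzs) _ (hopen V hV).connectedComponentIn hz
  exact mem_iUnion₂.2 ⟨V, hV, q, hqQ, (connectedComponentIn_eq hq).symm⟩

-- A component of `j ⁻¹' b` through the interior of `K` that leaves `K` meets the frontier of `K`.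
lemma exists_connectedComponentIn_preimage_subset [T2Space M] [T2Space P] {B : Set (Set M)}
    (hB : IsTopologicalBasis B) {j : P → M} (hj : Continuous j) (hinj : Function.Injective j)
    {p : P} {K : Set P} (hKc : IsCompact K) (hK : K ∈ 𝓝 p) :
    ∃ b ∈ B, j p ∈ b ∧ connectedComponentIn (j ⁻¹' b) p ⊆ K := by
  have hp : p ∈ interior K := mem_interior_iff_mem_nhds.2 hK
  have hfrontier : IsCompact (frontier K) :=
    hKc.of_isClosed_subset isClosed_frontier hKc.isClosed.frontier_subset
  have hjp : j p ∈ (j '' frontier K)ᶜ := by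
    rintro ⟨q, hq, hqp⟩
    exact hq.2 (hinj hqp ▸ hp)
  obtain ⟨b, hb, hpb, hbK⟩ :=
    hB.exists_subset_of_mem_open hjp (hfrontier.image hj).isClosed.isOpen_compl
  refine ⟨b, hb, hpb, (isPreconnected_connectedComponentIn.subset_left_of_subset_union
    isOpen_interior hKc.isClosed.isOpen_compl (disjoint_compl_right_iff_subset.2 interior_subset)
    (fun q hq ↦ ?_) ⟨p, mem_connectedComponentIn hpb, hp⟩).trans interior_subset⟩
  by_contra hnot
  rw [mem_union, not_or, mem_compl_iff, not_not] at hnot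
  exact hbK (connectedComponentIn_subset (j ⁻¹' b) p hq)
    ⟨q, ⟨subset_closure hnot.2, hnot.1⟩, rfl⟩

theorem sigmaCompactSpace_of_injective [T2Space M] [SecondCountableTopology M]
    [PreconnectedSpace P] [LocallyConnectedSpace P] [LocallyCompactSpace P]
    (hsep : ∀ p : P, ∃ s ∈ 𝓝 p, IsSeparable s) {j : P → M} (hj : Continuous j)
    (hinj : Function.Injective j) : SigmaCompactSpace P := by
  have : T2Space P := T2Space.of_injective_continuous hinj hj
  let 𝒱 : Set (Set P) := preimage j '' countableBasis M
  have hopen : ∀ V ∈ 𝒱, IsOpen V := by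
    rintro _ ⟨b, hb, rfl⟩
    exact (isOpen_of_mem_countableBasis hb).preimage hj
  let 𝒰 : Set (Set P) := {C | (∃ V ∈ 𝒱, ∃ p ∈ V, C = connectedComponentIn V p) ∧
    ∃ K, IsCompact K ∧ IsSeparable K ∧ C ⊆ K}
  have hcover : ⋃ C : 𝒰, C.1 = univ := eq_univ_of_forall fun p ↦ by
    obtain ⟨s, hs, hs'⟩ := hsep p
    obtain ⟨K, hKp, hKs, hKc⟩ := local_compact_nhds hs
    obtain ⟨b, hb, hpb, hbK⟩ := exists_connectedComponentIn_preimage_subset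
      (isBasis_countableBasis M) hj hinj hKc hKp
    exact mem_iUnion.2 ⟨⟨_, ⟨_, mem_image_of_mem _ hb, p, hpb, rfl⟩, K, hKc, hs'.mono hKs, hbK⟩,
      mem_connectedComponentIn hpb⟩
  have hcountable : {C : 𝒰 | C.1.Nonempty}.Countable := by
    refine countable_setOf_nonempty_of_iUnion_eq_univ (fun C ↦ ?_) hcover fun C ↦ ?_
    · obtain ⟨_, ⟨V, hV, p, -, rfl⟩, -⟩ := C
      exact (hopen V hV).connectedComponentIn
    · obtain ⟨K, -, hK, hCK⟩ := C.2.2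
      refine ((countable_setOf_connectedComponentIn_inter_nonempty
        ((countable_countableBasis M).image _) hopen (hK.mono hCK)).preimage
          Subtype.val_injective).mono fun C' hC' ↦ ?_
      obtain ⟨V, hV, p, hp, hC'V⟩ := C'.2.1
      exact ⟨V, hV, p, hp, hC'V, hC'⟩
  have := hcountable.to_subtype
  choose K hK _ hCK using fun C : 𝒰 ↦ C.2.2
  refine ⟨(isSigmaCompact_iUnion_of_isCompact (fun C : {C : 𝒰 | C.1.Nonempty} ↦ K C)
    fun C ↦ hK C).of_isClosed_subset isClosed_univ fun p _ ↦ ?_⟩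
  obtain ⟨C, hC⟩ := mem_iUnion.1 (hcover ▸ mem_univ p)
  exact mem_iUnion.2 ⟨⟨C, p, hC⟩, hCK C hC⟩

theorem paracompactSpace_of_injective (E F : Type*) [NormedAddCommGroup E] [NormedSpace ℝ E]
    [FiniteDimensional ℝ E] [NormedAddCommGroup F] [NormedSpace ℝ F] [FiniteDimensional ℝ F]
    [T2Space M] [ParacompactSpace M] [ChartedSpace E M] [ConnectedSpace P] [ChartedSpace F P]
    {j : P → M} (hj : Continuous j) (hinj : Function.Injective j) : ParacompactSpace P := by
  have : LocallyCompactSpace M := ChartedSpace.locallyCompactSpace E M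
  have : LocallyConnectedSpace M := ChartedSpace.locallyConnectedSpace E M
  have : LocallyCompactSpace P := ChartedSpace.locallyCompactSpace F P
  have : LocallyConnectedSpace P := ChartedSpace.locallyConnectedSpace F P
  have : T2Space P := T2Space.of_injective_continuous hinj hj
  obtain ⟨p⟩ := ‹ConnectedSpace P›.toNonempty
  let C : Opens M := ⟨connectedComponent (j p), isOpen_connectedComponent⟩
  have : ParacompactSpace C :=
    (isClosed_connectedComponent (x := j p)).isClosedEmbedding_subtypeVal.paracompactSpace
  have : LocallyCompactSpace C := C.isOpen.locallyCompactSpace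
  have : PreconnectedSpace C := Subtype.preconnectedSpace isPreconnected_connectedComponent
  have : SigmaCompactSpace C := sigmaCompactSpace_of_paracompactSpace
  have : SecondCountableTopology C := ChartedSpace.secondCountable_of_sigmaCompact E C
  have hmem (q : P) : j q ∈ C :=
    (isPreconnected_range hj).subset_connectedComponent (mem_range_self p) (mem_range_self q)
  have hsep (q : P) : ∃ s ∈ 𝓝 q, IsSeparable s := by
    have := (chartAt F q).secondCountableTopology_source
    exact ⟨(chartAt F q).source, (chartAt F q).open_source.mem_nhds (mem_chart_source F q),
      .of_subtype _⟩
  have : SigmaCompactSpace P := sigmaCompactSpace_of_injective hsep (hj.subtype_mk hmem)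
    fun q q' hq ↦ hinj (congrArg Subtype.val hq)
  infer_instance

end PoincareVolterra

/-! ### The manifold structure of an orbit -/

/-- The charted space structure whose atlas consists of the chosen charts `e p`. -/
@[reducible]
def chartedSpaceOfCharts {F P : Type*} [TopologicalSpace F] [TopologicalSpace P]
    (e : P → OpenPartialHomeomorph P F) (he : ∀ p, p ∈ (e p).source) :
    ChartedSpace F P where
  atlas := range e
  chartAt := e
  mem_chart_source := he
  chart_mem_atlas := mem_range_self

lemma comp_chartAt_symm_comp_chartAt_eventuallyEq {Y F P : Type*} [TopologicalSpace F]
    [TopologicalSpace P] [ChartedSpace F P] (j : P → Y) (p : P) :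
    (j ∘ (chartAt F p).symm) ∘ chartAt F p =ᶠ[𝓝 p] j := by
  filter_upwards [(chartAt F p).open_source.mem_nhds (mem_chart_source F p)] with q hq
  simp only [Function.comp_apply, (chartAt F p).left_inv hq]

section PlaqueAtlas

variable {d : ℕ} {M : Type u} [TopologicalSpace M] [ChartedSpace (EuclideanSpace ℝ (Fin d)) M]
  {F : Type*} [NormedAddCommGroup F] [NormedSpace ℝ F] {P : Type*} [TopologicalSpace P]
  {Δ : Distribution d M} {j : P → M} {U V : Set F} {φ φ' : F → M}

lemma IsPlaque.mono (h : IsPlaque Δ U φ) (hV : IsOpen V) (hVU : V ⊆ U) : IsPlaque Δ V φ :=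
  ⟨hV, h.contMDiffOn.mono hVU, fun u hu ↦ h.injective u (hVU hu),
    fun u hu ↦ h.range_eq u (hVU hu)⟩

lemma IsPlaque.congr (h : IsPlaque Δ U φ) (heq : EqOn φ' φ U) : IsPlaque Δ U φ' := by
  have hmfderiv {u : F} (hu : u ∈ U) := (heq.eventuallyEq_of_mem (h.isOpen.mem_nhds hu)).mfderiv_eq
    (I := 𝓘(ℝ, F)) (I' := 𝓡 d)
  refine ⟨h.isOpen, h.contMDiffOn.congr heq, fun u hu ↦ ?_, fun u hu ↦ ?_⟩
  · rw [hmfderiv hu]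
    exact h.injective u hu
  · have hrange := h.range_eq u hu
    rw [← heq hu] at hrange
    rwa [hmfderiv hu]

/-- Every chart of the atlas of `P` turns `j : P → M` into a plaque of `Δ`, so that `P` becomes an
immersed integral manifold of `Δ`. -/
def IsPlaqueAtlas (F : Type*) [NormedAddCommGroup F] [NormedSpace ℝ F] [ChartedSpace F P]
    (Δ : Distribution d M) (j : P → M) : Prop :=
  ∀ e ∈ atlas F P, IsPlaque Δ e.target (j ∘ e.symm)

lemma IsPlaqueAtlas.contMDiffAt_comp_chartAt_symm [ChartedSpace F P] (hP : IsPlaqueAtlas F Δ j)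
    (p : P) : ContMDiffAt 𝓘(ℝ, F) (𝓡 d) ∞ (j ∘ (chartAt F p).symm) (chartAt F p p) :=
  (hP _ (chart_mem_atlas F p)).contMDiffOn.contMDiffAt
    ((chartAt F p).open_target.mem_nhds (mem_chart_target F p))

variable [IsManifold (𝓡 d) ∞ M] [FiniteDimensional ℝ F]

lemma contDiffOn_transition_of_isPlaque {e e' : OpenPartialHomeomorph P F}
    (he : IsPlaque Δ e.target (j ∘ e.symm)) (he' : IsPlaque Δ e'.target (j ∘ e'.symm)) :
    ContDiffOn ℝ ∞ (e' ∘ e.symm) (e.symm.trans e').source := by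
  intro u hu
  have hsource {v : F} (hv : v ∈ (e.symm.trans e').source) :
      v ∈ e.target ∧ e.symm v ∈ e'.source := by
    rwa [OpenPartialHomeomorph.trans_source] at hv
  obtain ⟨hue, hue'⟩ := hsource hu
  obtain ⟨r, hr, hre'⟩ := exists_leftInverse_of_injective_mfderiv he'.isOpen he'.contMDiffOn
    (e'.map_source hue') (he'.injective _ (e'.map_source hue'))
  rw [Function.comp_apply, e'.left_inv hue'] at hr
  have hsmooth : ContMDiffAt 𝓘(ℝ, F) 𝓘(ℝ, F) ∞ (r ∘ j ∘ e.symm) u :=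
    hr.comp u (he.contMDiffOn.contMDiffAt (he.isOpen.mem_nhds hue))
  have hcont : ContinuousAt (e' ∘ e.symm) u :=
    (e'.continuousAt hue').comp (e.symm.continuousAt hue)
  refine (hsmooth.contDiffAt.congr_of_eventuallyEq ?_).contDiffWithinAt
  filter_upwards [hcont.eventually hre', (e.symm.trans e').open_source.mem_nhds hu] with v hv hvs
  rw [← hv]
  simp only [Function.comp_apply, e'.left_inv (hsource hvs).2]

namespace IsPlaqueAtlas

variable [ChartedSpace F P]

lemma isManifold (hP : IsPlaqueAtlas F Δ j) : IsManifold 𝓘(ℝ, F) ∞ P :=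
  isManifold_of_contDiffOn 𝓘(ℝ, F) ∞ P fun e e' he he' ↦
    (contDiffOn_transition_of_isPlaque (hP e he) (hP e' he')).mono fun _ hu ↦ hu.1

lemma contMDiff (hP : IsPlaqueAtlas F Δ j) : ContMDiff 𝓘(ℝ, F) (𝓡 d) ∞ j := fun p ↦
  have := hP.isManifold
  ((hP.contMDiffAt_comp_chartAt_symm p).comp p
    (contMDiffAt_extChartAt (I := 𝓘(ℝ, F)) (x := p))).congr_of_eventuallyEq
      (comp_chartAt_symm_comp_chartAt_eventuallyEq j p).symm

lemma mfderiv_eq (hP : IsPlaqueAtlas F Δ j) (p : P) :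
    mfderiv 𝓘(ℝ, F) (𝓡 d) j p =
      (mfderiv 𝓘(ℝ, F) (𝓡 d) (j ∘ (chartAt F p).symm) (chartAt F p p)).comp
        (mfderiv 𝓘(ℝ, F) 𝓘(ℝ, F) (chartAt F p) p) := by
  have := hP.isManifold
  rw [← (comp_chartAt_symm_comp_chartAt_eventuallyEq (F := F) j p).mfderiv_eq]
  exact mfderiv_comp p ((hP.contMDiffAt_comp_chartAt_symm p).mdifferentiableAt (by simp))
    ((contMDiffAt_extChartAt (I := 𝓘(ℝ, F)) (x := p) (n := ∞)).mdifferentiableAt (by simp))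

lemma bijective_mfderiv_chartAt (hP : IsPlaqueAtlas F Δ j) (p : P) :
    Function.Bijective (mfderiv 𝓘(ℝ, F) 𝓘(ℝ, F) (chartAt F p) p) :=
  have := hP.isManifold
  (isInvertible_mfderiv_extChartAt (I := 𝓘(ℝ, F)) (mem_extChartAt_source p)).bijective

lemma injective_mfderiv (hP : IsPlaqueAtlas F Δ j) (p : P) :
    Function.Injective (mfderiv 𝓘(ℝ, F) (𝓡 d) j p) := by
  rw [hP.mfderiv_eq]
  exact ((hP _ (chart_mem_atlas F p)).injective _ (mem_chart_target F p)).comp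
    (hP.bijective_mfderiv_chartAt p).injective

lemma range_mfderiv (hP : IsPlaqueAtlas F Δ j) (p : P) :
    (mfderiv 𝓘(ℝ, F) (𝓡 d) j p).range = Δ (j p) := by
  have hrange := (hP _ (chart_mem_atlas F p)).range_eq _ (mem_chart_target F p)
  rw [Function.comp_apply, (chartAt F p).left_inv (mem_chart_source F p)] at hrange
  rw [hP.mfderiv_eq, ← hrange]
  exact LinearMap.range_comp_of_range_eq_top _
    (LinearMap.range_eq_top.2 (hP.bijective_mfderiv_chartAt p).surjective)

end IsPlaqueAtlas

end PlaqueAtlas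

lemma exists_lift_pts {X : Type*} {Y : Type u} {S : Set Y} {φ : X → Y} {U : Set X}
    (hφ : MapsTo φ U S) (x : Pts S) : ∃ Φ : X → Pts S, ∀ u ∈ U, (Φ u).1 = φ u := by
  classical
  exact ⟨fun u ↦ if hu : u ∈ U then ⟨φ u, hφ hu⟩ else x,
    fun u hu ↦ congrArg Subtype.val (dif_pos hu)⟩

section OrbitManifold

variable {d : ℕ} {M : Type u} [TopologicalSpace M] [ChartedSpace (EuclideanSpace ℝ (Fin d)) M]
  [IsManifold (𝓡 d) ∞ M] {D : Set (LocalVectorField d M)} {m : M} {S : Set M}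

/-- The map `T ↦ ξ_T (m)` with values in a set that is the orbit of `m`. -/
def orbitParam (h : S = orbit D m) (w : Word D) (T : timeDomain w.fields m) : Pts S :=
  ⟨(orbitMap D m w T).1, h ▸ (orbitMap D m w T).2⟩

lemma orbitTopology_eq (h : S = orbit D m) :
    orbitTopology D m S h =
      ⨆ w : Word D, TopologicalSpace.coinduced (orbitParam h w) inferInstance :=
  rfl

lemma continuous_orbitParam (h : S = orbit D m) (w : Word D) :
    Continuous[inferInstance, orbitTopology D m S h] (orbitParam h w) := by
  rw [continuous_iff_coinduced_le, orbitTopology_eq]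
  exact le_iSup (fun w : Word D ↦ TopologicalSpace.coinduced (orbitParam h w) inferInstance) w

lemma isOpen_orbitTopology_iff (h : S = orbit D m) {V : Set (Pts S)} :
    IsOpen[orbitTopology D m S h] V ↔ ∀ w : Word D, IsOpen (orbitParam h w ⁻¹' V) := by
  rw [orbitTopology_eq, isOpen_iSup_iff]
  rfl

variable {F : Type*} [NormedAddCommGroup F] [NormedSpace ℝ F] {φ : F → M} {Φ : F → Pts S}

lemma IsOrbitFamily.continuousOn (h : S = orbit D m) {W : Set F} (hφ : IsOrbitFamily D m W φ)
    (hΦ : ∀ u ∈ W, (Φ u).1 = φ u) :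
    letI := orbitTopology D m S h
    ContinuousOn Φ W := by
  let := orbitTopology D m S h
  obtain ⟨w, A, hA, hAφ⟩ := hφ
  let time (u : W) : timeDomain w.fields m := ⟨A u, (hAφ u u.2).1⟩
  have htime : Continuous time :=
    (continuousOn_iff_continuous_domRestrict.1 hA.continuousOn).subtype_mk _
  have hfactor : W.domRestrict Φ = orbitParam h w ∘ time :=
    funext fun u ↦ Subtype.ext ((hΦ u u.2).trans (hAφ u u.2).2.symm)
  rw [continuousOn_iff_continuous_domRestrict, hfactor]
  exact (continuous_orbitParam h w).comp htime

variable [T2Space M]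

lemma continuous_incl_orbitTopology (h : S = orbit D m) :
    Continuous[orbitTopology D m S h, inferInstance] (fun x : Pts S ↦ x.1) := by
  rw [orbitTopology_eq, continuous_iSup_dom]
  intro w
  rw [continuous_coinduced_dom, continuous_iff_continuousAt]
  rintro ⟨T, hT⟩
  exact ContinuousAt.comp (f := Subtype.val) (g := fun T ↦ multiflow w.fields T m)
    (contMDiffAt_multiflow_time w.fields hT).continuousAt continuousAt_subtype_val

-- By the factorization lemma, each map `T ↦ ξ_T (m)` locally factors through the plaque.
lemma isOpen_image_of_isPlaque [FiniteDimensional ℝ F] (hD : EverywhereDefined D)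
    (h : S = orbit D m) (hk : Module.finrank ℝ (orbitDistribution D m) = Module.finrank ℝ F)
    {U : Set F} (hφ : IsPlaque (orbitDistribution D) U φ) (hΦ : ∀ u ∈ U, (Φ u).1 = φ u) :
    IsOpen[orbitTopology D m S h] (Φ '' U) := by
  rw [isOpen_orbitTopology_iff]
  refine fun w ↦ isOpen_iff_mem_nhds.2 ?_
  rintro ⟨T, hT⟩ ⟨u, hu, huT⟩
  have hsmooth : ContMDiffOn 𝓘(ℝ, Fin w.length → ℝ) (𝓡 d) ∞ (fun T ↦ multiflow w.fields T m)
      (timeDomain w.fields m) := fun T hT ↦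
    (contMDiffAt_multiflow_time w.fields hT).contMDiffWithinAt
  obtain ⟨g, W, hW, hTW, -, -, -, hg⟩ := hφ.exists_factorization_vectorSpace
    (orbitDistribution_isSmooth hD) hu (isOpen_timeDomain w.fields m) hsmooth hT
    ((congrArg Subtype.val huT).symm.trans (hΦ u hu))
    (fun T hT ↦ by
      rintro _ ⟨a, rfl⟩
      exact mfderiv_multiflow_time_mem w.fields (fun i ↦ (w.2 i).2) hT a)
    (fun T hT ↦ (finrank_orbitDistribution_of_mem_orbit (m := m) ⟨w, T, hT, rfl⟩).trans hk)
  filter_upwards [continuousAt_subtype_val.preimage_mem_nhds (hW.mem_nhds hTW)] with T' hT'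
  exact ⟨g T', (hg T' hT').1, Subtype.ext ((hΦ _ (hg T' hT').1).trans (hg T' hT').2.symm)⟩

lemma isOpenMap_domRestrict_of_isPlaque [FiniteDimensional ℝ F] (hD : EverywhereDefined D)
    (h : S = orbit D m) (hk : Module.finrank ℝ (orbitDistribution D m) = Module.finrank ℝ F)
    {U : Set F} (hφ : IsPlaque (orbitDistribution D) U φ) (hΦ : ∀ u ∈ U, (Φ u).1 = φ u) :
    letI := orbitTopology D m S h
    IsOpenMap (U.domRestrict Φ) := by
  rintro _ ⟨V, hV, rfl⟩
  rw [image_domRestrict, inter_comm]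
  exact isOpen_image_of_isPlaque hD h hk (hφ.mono (hφ.isOpen.inter hV) inter_subset_left)
    fun u hu ↦ hΦ u hu.1

lemma exists_orbit_chart (hD : EverywhereDefined D) (h : S = orbit D m) {k : ℕ}
    (hk : Module.finrank ℝ (orbitDistribution D m) = k) (x : Pts S) :
    letI := orbitTopology D m S h
    ∃ e : OpenPartialHomeomorph (Pts S) (EuclideanSpace ℝ (Fin k)), x ∈ e.source ∧
      IsPlaque (orbitDistribution D) e.target ((fun x : Pts S ↦ x.1) ∘ e.symm) := by
  let := orbitTopology D m S h
  obtain ⟨U, φ, hφ, h₀, hφ₀, hfamily, hinj⟩ := exists_orbit_plaque (h ▸ x.2 : x.1 ∈ orbit D m) hk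
  obtain ⟨Φ, hΦ⟩ := exists_lift_pts (fun u hu ↦ h ▸ hfamily.mem_orbit hu : MapsTo φ U S) x
  have hΦinj : InjOn Φ U := fun u hu v hv huv ↦
    hinj hu hv (by rw [← hΦ u hu, ← hΦ v hv, huv])
  let e := OpenPartialHomeomorph.ofContinuousOpenRestrict hΦinj.toPartialEquiv
    (hfamily.continuousOn h hΦ)
    (isOpenMap_domRestrict_of_isPlaque hD h (hk.trans finrank_euclideanSpace_fin.symm) hφ hΦ)
    hφ.isOpen
  exact ⟨e.symm, ⟨0, h₀, Subtype.ext ((hΦ 0 h₀).trans hφ₀)⟩, hφ.congr hΦ⟩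

lemma exists_isPreconnected_flow {X : LocalVectorField d M} (hX : X ∈ D) (h : S = orbit D m)
    {t : ℝ} {y : Pts S} (ht : (t, y.1) ∈ flowDomain X) :
    letI := orbitTopology D m S h
    ∃ s : Set (Pts S), IsPreconnected s ∧ y ∈ s ∧
      ∃ z ∈ s, z.1 = flow X t y.1 := by
  let := orbitTopology D m S h
  obtain ⟨a, b, h₀, htab, hdom, -, hflow₀⟩ := exists_isTrajectoryOn_flow ht
  have hfamily : IsOrbitFamily D m (Ioo a b) (fun s ↦ flow X s y.1) :=
    (IsOrbitFamily.const (h ▸ y.2) (Ioo a b)).flow hX contDiffOn_id hdom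
  have hmaps : MapsTo (fun s ↦ flow X s y.1) (Ioo a b) S := fun s hs ↦ h ▸ hfamily.mem_orbit hs
  obtain ⟨Φ, hΦ⟩ := exists_lift_pts hmaps y
  exact ⟨Φ '' Ioo a b, isPreconnected_Ioo.image _ (hfamily.continuousOn h hΦ),
    ⟨0, h₀, Subtype.ext ((hΦ 0 h₀).trans hflow₀)⟩, Φ t, mem_image_of_mem Φ htab, hΦ t htab⟩

lemma connectedSpace_orbitTopology (hD : EverywhereDefined D) (h : S = orbit D m) :
    @ConnectedSpace (Pts S) (orbitTopology D m S h) := by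
  let := orbitTopology D m S h
  let base : Pts S := ⟨m, h ▸ mem_orbit_self hD m⟩
  have hcomponent : ∀ x ∈ orbit D m, ∃ y ∈ connectedComponent base, y.1 = x := by
    refine orbit_induction ⟨base, mem_connectedComponent, rfl⟩ ?_
    rintro X hX t _ ⟨y, hy, rfl⟩ ht
    obtain ⟨s, hs, hys, z, hzs, hz⟩ := exists_isPreconnected_flow hX h ht
    exact ⟨z, connectedComponent_eq hy ▸ hs.subset_connectedComponent hys hzs, hz⟩
  have huniv : connectedComponent base = univ := eq_univ_of_forall fun x ↦ by
    obtain ⟨y, hy, hyx⟩ := hcomponent x.1 (h ▸ x.2)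
    exact Subtype.ext hyx ▸ hy
  exact connectedSpace_iff_univ.2 (huniv ▸ isConnected_connectedComponent)

theorem exists_immersiveStructure_orbitTopology [ParacompactSpace M] (hD : EverywhereDefined D)
    (h : S = orbit D m) (hk : 1 ≤ Module.finrank ℝ (orbitDistribution D m)) :
    ∃ N : ImmersiveStructure d S, N.topology = orbitTopology D m S h ∧
      N.IsIntegral (orbitDistribution D) ∧
      N.dim = Module.finrank ℝ (orbitDistribution D m) := by
  let := orbitTopology D m S h
  choose e he hplaque using
    exists_orbit_chart hD h (k := Module.finrank ℝ (orbitDistribution D m)) rfl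
  let := chartedSpaceOfCharts e he
  have hatlas : IsPlaqueAtlas (EuclideanSpace ℝ (Fin (Module.finrank ℝ (orbitDistribution D m))))
      (orbitDistribution D) (fun x : Pts S ↦ x.1) := by
    rintro _ ⟨p, rfl⟩
    exact hplaque p
  have := hatlas.isManifold
  have := connectedSpace_orbitTopology hD h
  have hcont := continuous_incl_orbitTopology h
  have hinj : Function.Injective (fun x : Pts S ↦ x.1) := fun _ _ h ↦ Subtype.ext h
  have := T2Space.of_injective_continuous hinj hcont
  have := paracompactSpace_of_injective (EuclideanSpace ℝ (Fin d))
    (EuclideanSpace ℝ (Fin (Module.finrank ℝ (orbitDistribution D m)))) hcont hinj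
  let N : ImmersiveStructure d S :=
    { dim := Module.finrank ℝ (orbitDistribution D m)
      one_le_dim := hk
      contMDiff_incl := hatlas.contMDiff
      injective_mfderiv := hatlas.injective_mfderiv }
  exact ⟨N, rfl, hatlas.range_mfderiv, rfl⟩

end OrbitManifold

/-! ### Involutivity -/

section LieBracketImmersion

variable {E F : Type*} [NormedAddCommGroup E] [NormedSpace ℝ E] [NormedAddCommGroup F]
  [NormedSpace ℝ F] {f : F → E} {u₀ : F}

lemma fderiv_apply_fderiv_of_comp_eventuallyEq {Z : E → E} {c : F → F}
    (hf : DifferentiableAt ℝ f u₀) (hf' : DifferentiableAt ℝ (fderiv ℝ f) u₀)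
    (hZ : DifferentiableAt ℝ Z (f u₀)) (hc : DifferentiableAt ℝ c u₀)
    (hZc : ∀ᶠ u in 𝓝 u₀, Z (f u) = fderiv ℝ f u (c u)) (ζ : F) :
    fderiv ℝ Z (f u₀) (fderiv ℝ f u₀ ζ) =
      fderiv ℝ f u₀ (fderiv ℝ c u₀ ζ) + fderiv ℝ (fderiv ℝ f) u₀ ζ (c u₀) := by
  have hcomp := hZ.hasFDerivAt.comp u₀ hf.hasFDerivAt
  have hlift := hf'.hasFDerivAt.clm_apply hc.hasFDerivAt
  simpa using DFunLike.congr_fun (hcomp.unique (hlift.congr_of_eventuallyEq hZc)) ζ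

lemma fderiv_lieBracket_of_comp_eventuallyEq {V W : E → E} {a b : F → F}
    (hf : ContDiffAt ℝ ∞ f u₀) (hV : DifferentiableAt ℝ V (f u₀))
    (hW : DifferentiableAt ℝ W (f u₀)) (ha : DifferentiableAt ℝ a u₀)
    (hb : DifferentiableAt ℝ b u₀) (hVa : ∀ᶠ u in 𝓝 u₀, V (f u) = fderiv ℝ f u (a u))
    (hWb : ∀ᶠ u in 𝓝 u₀, W (f u) = fderiv ℝ f u (b u)) :
    fderiv ℝ f u₀ (VectorField.lieBracket ℝ a b u₀) = VectorField.lieBracket ℝ V W (f u₀) := by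
  have hsymm : IsSymmSndFDerivAt ℝ f u₀ := hf.isSymmSndFDerivAt (by
    rw [minSmoothness_of_isRCLikeNormedField]
    exact WithTop.coe_le_coe.2 (le_top : (2 : ℕ∞) ≤ ⊤))
  have hdf : DifferentiableAt ℝ f u₀ := hf.differentiableAt (by simp)
  have hddf : DifferentiableAt ℝ (fderiv ℝ f) u₀ :=
    (hf.fderiv_right (m := ∞) (by simp)).differentiableAt (by simp)
  rw [VectorField.lieBracket, VectorField.lieBracket, hVa.self_of_nhds, hWb.self_of_nhds,
    fderiv_apply_fderiv_of_comp_eventuallyEq hdf hddf hW hb hWb,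
    fderiv_apply_fderiv_of_comp_eventuallyEq hdf hddf hV ha hVa, hsymm (b u₀) (a u₀), map_sub]
  abel

variable [FiniteDimensional ℝ E] [FiniteDimensional ℝ F]

-- The lift is `Dr ∘ V ∘ f` for a local left inverse `r` of `f`.
lemma exists_contDiffAt_lift_of_mem_range {U : Set F} (hU : IsOpen U) (hf : ContDiffOn ℝ ∞ f U)
    (hu₀ : u₀ ∈ U) (hinj : Function.Injective (fderiv ℝ f u₀)) {V : E → E}
    (hV : ContDiffAt ℝ ∞ V (f u₀)) (hVf : ∀ᶠ u in 𝓝 u₀, V (f u) ∈ (fderiv ℝ f u).range) :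
    ∃ a : F → F, ContDiffAt ℝ ∞ a u₀ ∧ ∀ᶠ u in 𝓝 u₀, V (f u) = fderiv ℝ f u (a u) := by
  obtain ⟨r, hr, hru⟩ := exists_contDiffAt_leftInverse hU hf hu₀ hinj
  have hfu₀ : ContDiffAt ℝ ∞ f u₀ := hf.contDiffAt (hU.mem_nhds hu₀)
  have hr' : ContDiffAt ℝ ∞ (fderiv ℝ r) (f u₀) := hr.fderiv_right (by simp)
  have hdr : ∀ᶠ x in 𝓝 (f u₀), DifferentiableAt ℝ r x :=
    ((hr.of_le (m := 1) (by simp)).eventually (by simp)).mono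
      fun x hx ↦ hx.differentiableAt (by simp)
  refine ⟨fun u ↦ fderiv ℝ r (f u) (V (f u)),
    (hr'.comp u₀ hfu₀).clm_apply (hV.comp u₀ hfu₀), ?_⟩
  filter_upwards [hVf, hU.mem_nhds hu₀, hfu₀.continuousAt.eventually hdr, hru.eventually_nhds]
    with u ⟨ζ, hζ⟩ huU hdru hru
  have hdf : DifferentiableAt ℝ f u :=
    (hf.contDiffAt (hU.mem_nhds huU)).differentiableAt (by simp)
  have hid : (fderiv ℝ r (f u)).comp (fderiv ℝ f u) = ContinuousLinearMap.id ℝ F :=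
    (hdru.hasFDerivAt.comp u hdf.hasFDerivAt).unique
      ((hasFDerivAt_id u).congr_of_eventuallyEq hru)
  have hlift : fderiv ℝ r (f u) (V (f u)) = ζ := hζ ▸ DFunLike.congr_fun hid ζ
  rw [hlift]
  exact hζ.symm

lemma lieBracket_mem_range_fderiv {U : Set F} (hU : IsOpen U) (hf : ContDiffOn ℝ ∞ f U)
    (hu₀ : u₀ ∈ U) (hinj : Function.Injective (fderiv ℝ f u₀)) {V W : E → E}
    (hV : ContDiffAt ℝ ∞ V (f u₀)) (hVf : ∀ᶠ u in 𝓝 u₀, V (f u) ∈ (fderiv ℝ f u).range)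
    (hW : ContDiffAt ℝ ∞ W (f u₀)) (hWf : ∀ᶠ u in 𝓝 u₀, W (f u) ∈ (fderiv ℝ f u).range) :
    VectorField.lieBracket ℝ V W (f u₀) ∈ (fderiv ℝ f u₀).range := by
  obtain ⟨a, ha, hVa⟩ := exists_contDiffAt_lift_of_mem_range hU hf hu₀ hinj hV hVf
  obtain ⟨b, hb, hWb⟩ := exists_contDiffAt_lift_of_mem_range hU hf hu₀ hinj hW hWf
  exact ⟨_, fderiv_lieBracket_of_comp_eventuallyEq (hf.contDiffAt (hU.mem_nhds hu₀))
    (hV.differentiableAt (by simp)) (hW.differentiableAt (by simp))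
    (ha.differentiableAt (by simp)) (hb.differentiableAt (by simp)) hVa hWb⟩

end LieBracketImmersion

section Involutive

variable {d : ℕ} {M : Type u} [TopologicalSpace M] [ChartedSpace (EuclideanSpace ℝ (Fin d)) M]
  [IsManifold (𝓡 d) ∞ M]

local notation "𝔼" => EuclideanSpace ℝ (Fin d)

lemma mpullbackWithin_extChartAt_symm_eventuallyEq (V : (x : M) → TangentSpace (𝓡 d) x)
    (x₀ : M) :
    (VectorField.mpullbackWithin 𝓘(ℝ, 𝔼) (𝓡 d) (extChartAt (𝓡 d) x₀).symm V (range (𝓡 d)) :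
      𝔼 → 𝔼) =ᶠ[𝓝 (extChartAt (𝓡 d) x₀ x₀)] chartField x₀ V := by
  filter_upwards [extChartAt_target_mem_nhds (I := 𝓡 d) x₀] with e he
  obtain ⟨A, hA⟩ := isInvertible_mfderivWithin_extChartAt_symm (I := 𝓡 d) he
  have hleft := mfderiv_extChartAt_symm_mfderiv_extChartAt he (V ((extChartAt (𝓡 d) x₀).symm e))
  rw [← mfderivWithin_univ, ← ModelWithCorners.Boundaryless.range_eq_univ (I := 𝓡 d), ← hA]
    at hleft
  change (mfderivWithin 𝓘(ℝ, 𝔼) (𝓡 d) (extChartAt (𝓡 d) x₀).symm (range (𝓡 d)) e).inverse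
    (V ((extChartAt (𝓡 d) x₀).symm e)) = _
  rw [← hA, ContinuousLinearMap.inverse_equiv]
  exact A.symm_apply_eq.2 hleft.symm

lemma mfderiv_extChartAt_mlieBracket (V W : (x : M) → TangentSpace (𝓡 d) x) (x₀ : M) :
    mfderiv (𝓡 d) 𝓘(ℝ, 𝔼) (extChartAt (𝓡 d) x₀) x₀ (VectorField.mlieBracket (𝓡 d) V W x₀) =
      VectorField.lieBracket ℝ (chartField x₀ V) (chartField x₀ W) (extChartAt (𝓡 d) x₀ x₀) := by
  let pullback (Z : (x : M) → TangentSpace (𝓡 d) x) : 𝔼 → 𝔼 :=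
    VectorField.mpullbackWithin 𝓘(ℝ, 𝔼) (𝓡 d) (extChartAt (𝓡 d) x₀).symm Z (range (𝓡 d))
  have hchart : VectorField.lieBracketWithin ℝ (pullback V) (pullback W)
      ((extChartAt (𝓡 d) x₀).symm ⁻¹' univ ∩ range (𝓡 d)) (extChartAt (𝓡 d) x₀ x₀) =
      VectorField.lieBracket ℝ (chartField x₀ V) (chartField x₀ W) (extChartAt (𝓡 d) x₀ x₀) := by
    rw [preimage_univ, univ_inter, ModelWithCorners.Boundaryless.range_eq_univ,
      VectorField.lieBracketWithin_univ]
    exact (mpullbackWithin_extChartAt_symm_eventuallyEq V x₀).lieBracket_vectorField_eq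
      (mpullbackWithin_extChartAt_symm_eventuallyEq W x₀)
  obtain ⟨A, hA⟩ := isInvertible_mfderiv_extChartAt (I := 𝓡 d) (mem_extChartAt_source (I := 𝓡 d) x₀)
  rw [← VectorField.mlieBracketWithin_univ, VectorField.mlieBracketWithin_apply, ← hA,
    ContinuousLinearMap.inverse_equiv]
  exact (A.apply_symm_apply _).trans hchart

lemma LocalVectorField.contDiffAt_chartField (X : LocalVectorField d M) {x₀ : M}
    (hx₀ : x₀ ∈ X.domain) :
    ContDiffAt ℝ ∞ (chartField x₀ X.toFun) (extChartAt (𝓡 d) x₀ x₀) := by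
  refine (X.contDiffOn_chartField x₀).contDiffAt
    ((isOpen_extChartAt_target_inter_preimage x₀ X.domain.isOpen).mem_nhds
      ⟨mem_extChartAt_target x₀, ?_⟩)
  rw [mem_preimage, extChartAt_to_inv]
  exact hx₀

variable {F : Type*} [NormedAddCommGroup F] [NormedSpace ℝ F] {Δ : Distribution d M} {U : Set F}
  {φ : F → M} {u : F} {X Y : LocalVectorField d M}

lemma IsPlaque.chartField_mem_range_fderiv (hφ : IsPlaque Δ U φ) {x₀ : M} (hu : u ∈ U)
    (hux₀ : φ u ∈ (extChartAt (𝓡 d) x₀).source) (hX : X ∈ Δ.fields) (hXu : φ u ∈ X.domain) :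
    chartField x₀ X.toFun (extChartAt (𝓡 d) x₀ (φ u)) ∈
      (fderiv ℝ (fun u ↦ extChartAt (𝓡 d) x₀ (φ u)) u).range := by
  rw [chartField_extChartAt hux₀, fderiv_extChartAt_comp (hφ.mdifferentiableAt hu) hux₀]
  obtain ⟨ζ, hζ⟩ : X.toFun (φ u) ∈ (mfderiv 𝓘(ℝ, F) (𝓡 d) φ u).range :=
    (hφ.range_eq u hu).symm ▸ hX _ hXu
  exact ⟨ζ, congrArg (mfderiv (𝓡 d) 𝓘(ℝ, 𝔼) (extChartAt (𝓡 d) x₀) (φ u)) hζ⟩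

lemma IsPlaque.mlieBracket_mem [FiniteDimensional ℝ F] (hφ : IsPlaque Δ U φ) (hu : u ∈ U)
    (hX : X ∈ Δ.fields) (hY : Y ∈ Δ.fields) (hXu : φ u ∈ X.domain) (hYu : φ u ∈ Y.domain) :
    VectorField.mlieBracket (𝓡 d) X.toFun Y.toFun (φ u) ∈ Δ (φ u) := by
  have hcont : ContinuousAt φ u :=
    hφ.contMDiffOn.continuousOn.continuousAt (hφ.isOpen.mem_nhds hu)
  have hsource : φ u ∈ (extChartAt (𝓡 d) (φ u)).source := mem_extChartAt_source (φ u)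
  have hopen := hφ.contMDiffOn.continuousOn.isOpen_inter_preimage hφ.isOpen
    (isOpen_extChartAt_source (I := 𝓡 d) (φ u))
  have htangent {Z : LocalVectorField d M} (hZ : Z ∈ Δ.fields) (hZu : φ u ∈ Z.domain) :
      ∀ᶠ v in 𝓝 u, chartField (φ u) Z.toFun (extChartAt (𝓡 d) (φ u) (φ v)) ∈
        (fderiv ℝ (fun v ↦ extChartAt (𝓡 d) (φ u) (φ v)) v).range := by
    filter_upwards [hopen.mem_nhds ⟨hu, hsource⟩, hcont (Z.domain.isOpen.mem_nhds hZu)]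
      with v hv hvZ
    exact hφ.chartField_mem_range_fderiv hv.1 hv.2 hZ hvZ
  obtain ⟨ζ, hζ⟩ := lieBracket_mem_range_fderiv hopen
    (contDiffOn_extChartAt_comp (φ u) hφ.contMDiffOn) ⟨hu, hsource⟩
    (injective_fderiv_extChartAt_comp_iff (hφ.mdifferentiableAt hu) hsource |>.2
      (hφ.injective u hu))
    (X.contDiffAt_chartField hXu) (htangent hX hXu) (Y.contDiffAt_chartField hYu)
    (htangent hY hYu)
  rw [← mfderiv_extChartAt_mlieBracket, fderiv_extChartAt_comp (hφ.mdifferentiableAt hu) hsource]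
    at hζ
  rw [← hφ.range_eq u hu]
  exact ⟨ζ, injective_mfderiv_extChartAt hsource hζ⟩

theorem orbitDistribution_isInvolutive [T2Space M] {D : Set (LocalVectorField d M)}
    (hD : EverywhereDefined D) : (orbitDistribution D).IsInvolutive := by
  intro X hX Y hY m hm
  obtain ⟨U, φ, hφ, h₀, hφ₀, -, -⟩ := exists_orbit_plaque (mem_orbit_self hD m) rfl
  have hmem := hφ.mlieBracket_mem h₀ hX hY (hφ₀.symm ▸ hm.1) (hφ₀.symm ▸ hm.2)
  rwa [hφ₀] at hmem

end Involutive

/-! ### Integral manifolds of a smooth distribution -/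

namespace ImmersiveStructure

variable {d : ℕ} {M : Type u} [TopologicalSpace M] [ChartedSpace (EuclideanSpace ℝ (Fin d)) M]
  [IsManifold (𝓡 d) ∞ M] {R S : Set M} {Δ : Distribution d M} (N : ImmersiveStructure d S)

lemma smooth_incl : ContMDiff (𝓡 N.dim) (𝓡 d) ∞ N.incl := N.contMDiff_incl

lemma injective_mfderiv_incl (x : N.Carrier) :
    Function.Injective (mfderiv (𝓡 N.dim) (𝓡 d) N.incl x) := N.injective_mfderiv x

lemma injective_incl : Function.Injective N.incl := fun _ _ h ↦ Subtype.ext h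

lemma incl_mem (x : N.Carrier) : N.incl x ∈ S := x.2

lemma contMDiffOn_incl_extChartAt_symm (x : N.Carrier) :
    ContMDiffOn 𝓘(ℝ, EuclideanSpace ℝ (Fin N.dim)) (𝓡 d) ∞
      (N.incl ∘ (extChartAt (𝓡 N.dim) x).symm) (extChartAt (𝓡 N.dim) x).target :=
  N.smooth_incl.comp_contMDiffOn (contMDiffOn_extChartAt_symm x)

variable {N} {x : N.Carrier} {u : EuclideanSpace ℝ (Fin N.dim)}

lemma mfderiv_incl_extChartAt_symm (hu : u ∈ (extChartAt (𝓡 N.dim) x).target) :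
    mfderiv 𝓘(ℝ, EuclideanSpace ℝ (Fin N.dim)) (𝓡 d) (N.incl ∘ (extChartAt (𝓡 N.dim) x).symm) u =
      (mfderiv (𝓡 N.dim) (𝓡 d) N.incl ((extChartAt (𝓡 N.dim) x).symm u)).comp
        (mfderiv 𝓘(ℝ, EuclideanSpace ℝ (Fin N.dim)) (𝓡 N.dim)
          (extChartAt (𝓡 N.dim) x).symm u) :=
  mfderiv_comp u (N.smooth_incl.mdifferentiableAt (by simp))
    (mdifferentiableAt_extChartAt_symm hu)

lemma injective_mfderiv_incl_extChartAt_symm (hu : u ∈ (extChartAt (𝓡 N.dim) x).target) :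
    Function.Injective (mfderiv 𝓘(ℝ, EuclideanSpace ℝ (Fin N.dim)) (𝓡 d)
      (N.incl ∘ (extChartAt (𝓡 N.dim) x).symm) u) := by
  rw [mfderiv_incl_extChartAt_symm hu]
  exact (N.injective_mfderiv_incl _).comp
    (Function.LeftInverse.injective (mfderiv_extChartAt_mfderiv_extChartAt_symm hu))

lemma IsIntegral.isPlaque (hN : N.IsIntegral Δ) (x : N.Carrier) :
    IsPlaque Δ (extChartAt (𝓡 N.dim) x).target (N.incl ∘ (extChartAt (𝓡 N.dim) x).symm) := by
  refine ⟨isOpen_extChartAt_target x, N.contMDiffOn_incl_extChartAt_symm x,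
    fun u hu ↦ injective_mfderiv_incl_extChartAt_symm hu, fun u hu ↦ ?_⟩
  have hsurj : Function.Surjective (mfderiv 𝓘(ℝ, EuclideanSpace ℝ (Fin N.dim)) (𝓡 N.dim)
      (extChartAt (𝓡 N.dim) x).symm u) :=
    Function.RightInverse.surjective (mfderiv_extChartAt_symm_mfderiv_extChartAt hu)
  rw [mfderiv_incl_extChartAt_symm hu]
  exact (LinearMap.range_comp_of_range_eq_top _ (LinearMap.range_eq_top.2 hsurj)).trans
    (hN ((extChartAt (𝓡 N.dim) x).symm u))

lemma IsIntegral.finrank_eq (hN : N.IsIntegral Δ) (x : N.Carrier) :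
    Module.finrank ℝ (Δ (N.incl x)) = N.dim := by
  rw [← hN x]
  exact (LinearMap.finrank_range_of_inj (N.injective_mfderiv_incl x)).trans
    finrank_euclideanSpace_fin

lemma IsIntegral.ne_bot (hN : N.IsIntegral Δ) (x : N.Carrier) : Δ (N.incl x) ≠ ⊥ := fun hbot ↦ by
  have hdim := hN.finrank_eq x
  rw [hbot, finrank_bot] at hdim
  exact Nat.one_le_iff_ne_zero.1 N.one_le_dim hdim.symm

lemma contMDiffAt_of_contMDiffAt_incl {E H P : Type*} [NormedAddCommGroup E] [NormedSpace ℝ E]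
    [TopologicalSpace H] {I : ModelWithCorners ℝ E H} [TopologicalSpace P] [ChartedSpace H P]
    {f : P → N.Carrier} {p : P} (hf : ContinuousAt f p)
    (hincl : ContMDiffAt I (𝓡 d) ∞ (fun q ↦ N.incl (f q)) p) :
    ContMDiffAt I (𝓡 N.dim) ∞ f p := by
  set ψ := extChartAt (𝓡 N.dim) (f p) with hψ
  have hψp : ψ (f p) ∈ ψ.target := mem_extChartAt_target (f p)
  obtain ⟨r, hr, hleft⟩ := exists_leftInverse_of_injective_mfderiv (isOpen_extChartAt_target (f p))
    (N.contMDiffOn_incl_extChartAt_symm (f p)) hψp (injective_mfderiv_incl_extChartAt_symm hψp)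
  rw [← hψ, Function.comp_apply, ψ.left_inv (mem_extChartAt_source (f p))] at hr
  refine contMDiffAt_iff_target.2 ⟨hf, (hr.comp p hincl).congr_of_eventuallyEq ?_⟩
  have hψf : ContinuousAt (ψ ∘ f) p :=
    ContinuousAt.comp (f := f) (continuousAt_extChartAt (f p)) hf
  filter_upwards [hψf.eventually hleft, hf (extChartAt_source_mem_nhds (I := 𝓡 N.dim) (f p))]
    with q hq hqsource
  rw [Function.comp_apply, Function.comp_apply, ψ.left_inv hqsource] at hq
  exact hq.symm

variable {N' : ImmersiveStructure d R}

lemma contMDiff_inclusion_of_continuous {h : R ⊆ S} (hc : Continuous (N'.inclusion N h)) :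
    ContMDiff (𝓡 N'.dim) (𝓡 N.dim) ∞ (N'.inclusion N h) := fun _ ↦
  contMDiffAt_of_contMDiffAt_incl hc.continuousAt N'.smooth_incl.contMDiffAt

theorem same_of_topology_eq {N N' : ImmersiveStructure d S} (h : N'.topology = N.topology) :
    N'.Same N :=
  ⟨contMDiff_inclusion_of_continuous (continuous_id_iff_le.2 h.le),
    contMDiff_inclusion_of_continuous (continuous_id_iff_le.2 h.ge)⟩

lemma IsIntegral.exists_local_map (hΔ : Δ.IsSmooth) (hN : N.IsIntegral Δ)
    (hN' : N'.IsIntegral Δ) {x' : N'.Carrier} (hx : N'.incl x' = N.incl x) :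
    ∃ (h : N'.Carrier → N.Carrier) (W : Set N'.Carrier), IsOpen W ∧ x' ∈ W ∧
      ContMDiffOn (𝓡 N'.dim) (𝓡 N.dim) ∞ h W ∧ ∀ y ∈ W, N.incl (h y) = N'.incl y := by
  have hbase : N'.incl x' =
      (N.incl ∘ (extChartAt (𝓡 N.dim) x).symm) (extChartAt (𝓡 N.dim) x x) := by
    rw [Function.comp_apply, extChartAt_to_inv x, hx]
  have hrank (y : N'.Carrier) : Module.finrank ℝ (Δ (N'.incl y)) =
      Module.finrank ℝ (EuclideanSpace ℝ (Fin N.dim)) := by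
    rw [hN'.finrank_eq y, ← hN'.finrank_eq x', hx, hN.finrank_eq x, finrank_euclideanSpace_fin]
  obtain ⟨h, W, hW, hxW, -, hsmooth, -, hfactor⟩ := (hN.isPlaque x).exists_factorization hΔ
    (mem_extChartAt_target x) isOpen_univ N'.smooth_incl.contMDiffOn (mem_univ x') hbase
    (fun y _ ↦ (hN' y).le) (fun y _ ↦ hrank y)
  exact ⟨(extChartAt (𝓡 N.dim) x).symm ∘ h, W, hW, hxW,
    (contMDiffOn_extChartAt_symm x).comp hsmooth fun y hy ↦ (hfactor y hy).1,
    fun y hy ↦ (hfactor y hy).2.symm⟩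

lemma IsIntegral.contMDiff_inclusion (hΔ : Δ.IsSmooth) (hN : N.IsIntegral Δ)
    (hN' : N'.IsIntegral Δ) (hRS : R ⊆ S) :
    ContMDiff (𝓡 N'.dim) (𝓡 N.dim) ∞ (N'.inclusion N hRS) := by
  intro x'
  obtain ⟨h, W, hW, hxW, hsmooth, hh⟩ :=
    hN.exists_local_map hΔ hN' (x := N'.inclusion N hRS x') (x' := x') rfl
  refine (hsmooth.contMDiffAt (hW.mem_nhds hxW)).congr_of_eventuallyEq ?_
  filter_upwards [hW.mem_nhds hxW] with y hy
  exact N.injective_incl (hh y hy).symm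

theorem IsIntegral.isOpenSubmanifold (hΔ : Δ.IsSmooth) (hN : N.IsIntegral Δ)
    (hN' : N'.IsIntegral Δ) (hRS : R ⊆ S) : N'.IsOpenSubmanifold N := by
  refine ⟨hRS, fun x' ↦ ?_⟩
  have hincl := hN.contMDiff_inclusion hΔ hN' hRS
  obtain ⟨h, W, hW, hxW, hsmooth, hh⟩ :=
    hN'.exists_local_map hΔ hN (x := x') (x' := N'.inclusion N hRS x') rfl
  have hright : ∀ z ∈ W, N'.inclusion N hRS (h z) = z := fun z hz ↦ N.injective_incl (hh z hz)
  exact ⟨{ toFun := N'.inclusion N hRS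
           invFun := h
           source := N'.inclusion N hRS ⁻¹' W
           target := W
           map_source' := fun _ hy ↦ hy
           map_target' := fun z hz ↦ (congrArg (· ∈ W) (hright z hz)).mpr hz
           left_inv' := fun _ hy ↦ N'.injective_incl (hh _ hy)
           right_inv' := hright
           open_source := hW.preimage hincl.continuous
           open_target := hW
           contMDiffOn_toFun := hincl.contMDiffOn
           contMDiffOn_invFun := hsmooth }, hxW, fun _ _ ↦ rfl⟩

theorem IsIntegral.topology_eq {N N' : ImmersiveStructure d S} (hΔ : Δ.IsSmooth)
    (hN : N.IsIntegral Δ) (hN' : N'.IsIntegral Δ) : N.topology = N'.topology :=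
  le_antisymm
    (continuous_id_iff_le.1 (hN'.contMDiff_inclusion hΔ hN Subset.rfl).continuous)
    (continuous_id_iff_le.1 (hN.contMDiff_inclusion hΔ hN' Subset.rfl).continuous)

lemma range_mfderiv_incl_le {h : R ⊆ S}
    (hincl : ContMDiff (𝓡 N'.dim) (𝓡 N.dim) ∞ (N'.inclusion N h)) (x : N'.Carrier) :
    (mfderiv (𝓡 N'.dim) (𝓡 d) N'.incl x).range ≤
      (mfderiv (𝓡 N.dim) (𝓡 d) N.incl (N'.inclusion N h x)).range := by
  have hcomp : mfderiv (𝓡 N'.dim) (𝓡 d) N'.incl x =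
      (mfderiv (𝓡 N.dim) (𝓡 d) N.incl (N'.inclusion N h x)).comp
        (mfderiv (𝓡 N'.dim) (𝓡 N.dim) (N'.inclusion N h) x) :=
    mfderiv_comp (M' := N.Carrier) (f := N'.inclusion N h) x
      (N.smooth_incl.mdifferentiableAt (by simp)) (hincl.mdifferentiableAt (by simp))
  rw [hcomp]
  exact LinearMap.range_comp_le_range _ _

lemma IsIntegral.of_same {N N' : ImmersiveStructure d S} (hN : N.IsIntegral Δ)
    (h : N'.Same N) : N'.IsIntegral Δ := fun x ↦
  (le_antisymm (range_mfderiv_incl_le h.1 x)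
    (range_mfderiv_incl_le h.2 (N'.inclusion N Subset.rfl x))).trans
      (hN (N'.inclusion N Subset.rfl x))

end ImmersiveStructure

/-! ### Orbits as maximal integral manifolds -/

section Orbits

variable {d : ℕ} {M : Type u} [TopologicalSpace M] [ChartedSpace (EuclideanSpace ℝ (Fin d)) M]
  [IsManifold (𝓡 d) ∞ M] [T2Space M] {D : Set (LocalVectorField d M)} {m : M} {R S : Set M}

lemma flow_eq_self_of_eq_zero {X : LocalVectorField d M} (hm : m ∈ X.domain)
    (hX : X.toFun m = 0) (t : ℝ) : flow X t m = m := by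
  have hconst : IsFlowCurve X t m (fun _ ↦ m) :=
    ⟨rfl, -(|t| + 1), |t| + 1, ⟨by linarith [abs_nonneg t], by linarith [abs_nonneg t]⟩,
      ⟨by linarith [neg_abs_le t], by linarith [le_abs_self t]⟩,
      (isMIntegralCurve_const hX).isMIntegralCurveOn _, fun _ _ ↦ hm⟩
  exact hconst.flow_eq

lemma eq_of_flow_eq_of_eq_zero {X : LocalVectorField d M} (hX : m ∈ X.domain → X.toFun m = 0)
    {t : ℝ} {y : M} (ht : (t, y) ∈ flowDomain X) (hy : flow X t y = m) : y = m := by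
  obtain ⟨hback, hback_eq⟩ := flow_neg ht
  rw [hy] at hback hback_eq
  have hm := mem_domain_of_mem_flowDomain hback
  exact hback_eq.symm.trans (flow_eq_self_of_eq_zero hm (hX hm) (-t))

lemma orbit_eq_singleton_of_forall_eq_zero (hD : EverywhereDefined D)
    (hm : ∀ X ∈ D, m ∈ X.domain → X.toFun m = 0) : orbit D m = {m} := by
  refine Subset.antisymm ?_ (singleton_subset_iff.2 (mem_orbit_self hD m))
  refine orbit_induction (Q := fun x ↦ x = m) rfl ?_
  rintro X hX t y rfl ht
  have hy := mem_domain_of_mem_flowDomain ht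
  exact flow_eq_self_of_eq_zero hy (hm X hX hy) t

-- The distribution that vanishes at `m` and is everything elsewhere is then `D`-invariant.
lemma orbitDistribution_eq_bot_of_forall_eq_zero
    (hm : ∀ X ∈ D, m ∈ X.domain → X.toFun m = 0) : orbitDistribution D m = ⊥ := by
  classical
  have hle : orbitDistribution D ≤ fun x ↦ if x = m then ⊥ else ⊤ := by
    refine orbitDistribution_le (fun X hX x hx ↦ ?_) (fun X hX t y ht v hv ↦ ?_)
    · by_cases hxm : x = m
      · subst hxm
        simp [hm X hX hx]
      · simp [hxm]
    · by_cases hflow : flow X t y = m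
      · rw [if_pos (eq_of_flow_eq_of_eq_zero (hm X hX) ht hflow), Submodule.mem_bot] at hv
        rw [hv, map_zero]
        exact Submodule.zero_mem _
      · rw [if_neg hflow]
        trivial
  simpa using hle m

lemma eq_zero_of_orbit_eq_singleton (hD : EverywhereDefined D) (h : orbit D m = {m})
    {X : LocalVectorField d M} (hX : X ∈ D) (hm : m ∈ X.domain) : X.toFun m = 0 := by
  obtain ⟨hdomain, hflow⟩ := flow_zero hm
  obtain ⟨a, b, h₀, -, hab, -, -⟩ := exists_isTrajectoryOn_flow hdomain
  have hconst : (fun s ↦ flow X s m) =ᶠ[𝓝 0] fun _ ↦ m := by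
    filter_upwards [isOpen_Ioo.mem_nhds h₀] with s hs
    exact (h ▸ flow_mem_orbit hX (mem_orbit_self hD m) (hab s hs) : flow X s m ∈ ({m} : Set M))
  have hderiv := hasMFDerivAt_unique (hasMFDerivAt_flow_time hdomain)
    ((hasMFDerivAt_const m (0 : ℝ)).congr_of_eventuallyEq hconst)
  have happly := DFunLike.congr_fun hderiv (1 : ℝ)
  rw [hflow] at happly
  exact (one_smul ℝ (X.toFun m)).symm.trans happly

theorem orbitDistribution_eq_bot_iff (hD : EverywhereDefined D) :
    orbitDistribution D m = ⊥ ↔ orbit D m = {m} := by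
  refine ⟨fun hbot ↦ orbit_eq_singleton_of_forall_eq_zero hD fun X hX hm ↦ ?_, fun h ↦
    orbitDistribution_eq_bot_of_forall_eq_zero fun X hX hm ↦
      eq_zero_of_orbit_eq_singleton hD h hX hm⟩
  have hmem := mem_orbitDistribution hX hm
  rwa [hbot, Submodule.mem_bot] at hmem

lemma connectedSpace_carrier_of_topology_eq (hD : EverywhereDefined D) (h : S = orbit D m)
    {N : ImmersiveStructure d S} (hN : N.topology = orbitTopology D m S h) :
    ConnectedSpace N.Carrier := by
  change @ConnectedSpace (Pts S) N.topology
  rw [hN]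
  exact connectedSpace_orbitTopology hD h

variable [ParacompactSpace M]

lemma exists_immersiveStructure_orbit (hD : EverywhereDefined D) (h : S = orbit D m)
    (hm : orbitDistribution D m ≠ ⊥) :
    ∃ N : ImmersiveStructure d S, N.topology = orbitTopology D m S h ∧
      N.IsIntegral (orbitDistribution D) ∧
      N.dim = Module.finrank ℝ (orbitDistribution D m) :=
  exists_immersiveStructure_orbitTopology hD h (Submodule.one_le_finrank_iff.2 hm)

lemma eventually_incl_mem_orbit (hD : EverywhereDefined D) {N : ImmersiveStructure d R}
    (hN : N.IsIntegral (orbitDistribution D)) (x : N.Carrier) :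
    ∀ᶠ y in 𝓝 x, N.incl y ∈ orbit D (N.incl x) := by
  obtain ⟨N₀, -, hN₀, -⟩ := exists_immersiveStructure_orbit hD rfl (hN.ne_bot x)
  let base : N₀.Carrier := (⟨N.incl x, mem_orbit_self hD (N.incl x)⟩ : Pts _)
  obtain ⟨h, W, hW, hxW, -, hh⟩ :=
    hN₀.exists_local_map (orbitDistribution_isSmooth hD) hN (x := base) (x' := x) rfl
  filter_upwards [hW.mem_nhds hxW] with y hy
  rw [← hh y hy]
  exact N₀.incl_mem _

theorem subset_orbit_of_isIntegral (hD : EverywhereDefined D) {N : ImmersiveStructure d R}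
    [ConnectedSpace N.Carrier] (hN : N.IsIntegral (orbitDistribution D))
    (hR : (R ∩ orbit D m).Nonempty) : R ⊆ orbit D m := by
  have hlocal := eventually_incl_mem_orbit hD hN
  have hclopen : IsClopen {x : N.Carrier | N.incl x ∈ orbit D m} := by
    constructor
    · rw [← isOpen_compl_iff, isOpen_iff_mem_nhds]
      intro x hx
      filter_upwards [hlocal x] with y hy hym
      exact hx (orbit_trans hym (orbit_symm hD hy))
    · rw [isOpen_iff_mem_nhds]
      intro x hx
      filter_upwards [hlocal x] with y hy
      exact orbit_trans hx hy
  obtain ⟨x, hxR, hx⟩ := hR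
  have huniv := hclopen.eq_univ ⟨((⟨x, hxR⟩ : Pts R) : N.Carrier), hx⟩
  exact fun y hy ↦ eq_univ_iff_forall.1 huniv (⟨y, hy⟩ : Pts R)

theorem isMaximalIntegral_of_topology_eq (hD : EverywhereDefined D) (h : S = orbit D m)
    (hm : orbitDistribution D m ≠ ⊥) {N : ImmersiveStructure d S}
    (hN : N.topology = orbitTopology D m S h) : N.IsMaximalIntegral (orbitDistribution D) := by
  obtain ⟨N₀, hN₀, hN₀_integral, -⟩ := exists_immersiveStructure_orbit hD h hm
  have hN_integral : N.IsIntegral (orbitDistribution D) :=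
    hN₀_integral.of_same (ImmersiveStructure.same_of_topology_eq (hN.trans hN₀.symm))
  refine ⟨connectedSpace_carrier_of_topology_eq hD h hN, hN_integral, fun R N' _ hN' hRS ↦ ?_⟩
  refine hN_integral.isOpenSubmanifold (orbitDistribution_isSmooth hD) hN' ?_
  rw [h] at hRS ⊢
  exact subset_orbit_of_isIntegral hD hN' hRS

lemma ImmersiveStructure.IsMaximalIntegral.eq_orbit (hD : EverywhereDefined D)
    {N : ImmersiveStructure d S} (hN : N.IsMaximalIntegral (orbitDistribution D))
    (x : N.Carrier) : S = orbit D (N.incl x) := by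
  obtain ⟨hconnected, hN, hmax⟩ := hN
  have hself := mem_orbit_self hD (N.incl x)
  obtain ⟨N₀, hN₀, hN₀_integral, -⟩ := exists_immersiveStructure_orbit hD rfl (hN.ne_bot x)
  obtain ⟨hsubset, -⟩ := hmax _ N₀ (connectedSpace_carrier_of_topology_eq hD rfl hN₀)
    hN₀_integral ⟨_, hself, N.incl_mem x⟩
  exact Subset.antisymm (subset_orbit_of_isIntegral hD hN ⟨_, N.incl_mem x, hself⟩) hsubset

theorem isMaximalIntegral_iff (hD : EverywhereDefined D) (N : ImmersiveStructure d S) :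
    N.IsMaximalIntegral (orbitDistribution D) ↔
      ∃ (m : M) (h : S = orbit D m), S ≠ {m} ∧ N.topology = orbitTopology D m S h := by
  constructor
  · intro hN
    obtain ⟨x⟩ := hN.1.toNonempty
    have hx := hN.2.1.ne_bot x
    have hS := hN.eq_orbit hD x
    obtain ⟨N₀, hN₀, hN₀_integral, -⟩ := exists_immersiveStructure_orbit hD hS hx
    exact ⟨N.incl x, hS, fun h ↦ hx ((orbitDistribution_eq_bot_iff hD).2 (hS ▸ h)),
      (hN.2.1.topology_eq (orbitDistribution_isSmooth hD) hN₀_integral).trans hN₀⟩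
  · rintro ⟨m, rfl, hne, hN⟩
    exact isMaximalIntegral_of_topology_eq hD rfl
      (fun hbot ↦ hne ((orbitDistribution_eq_bot_iff hD).1 hbot)) hN

theorem orbitDistribution_hasMaximalIntegralManifolds (hD : EverywhereDefined D) :
    (orbitDistribution D).HasMaximalIntegralManifolds := by
  intro m hm
  have hbot : orbitDistribution D m ≠ ⊥ := fun hbot ↦
    hm (orbitDistribution_eq_bot_of_forall_eq_zero fun X hX hmX ↦
      (Submodule.mem_bot ℝ).1 (hbot ▸ hX m hmX))
  obtain ⟨N, hN, -, -⟩ := exists_immersiveStructure_orbit hD rfl hbot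
  exact ⟨orbit D m, N, mem_orbit_self hD m, isMaximalIntegral_of_topology_eq hD rfl hbot hN⟩

end Orbits

end Sussmann

end

theorem mainTheorem1 {d : ℕ} {M : Type*} [TopologicalSpace M]
    [ChartedSpace (EuclideanSpace ℝ (Fin d)) M] [IsManifold (𝓡 d) ∞ M]
    [T2Space M] [ParacompactSpace M]
    (D : Set (Sussmann.LocalVectorField d M)) (hD : Sussmann.EverywhereDefined D) :
    -- (i) natural topology, existence and uniqueness of the smooth structure, dimension
    (∀ (m : M) (S : Set M) (h : S = Sussmann.orbit D m), S ≠ {m} →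
      ∃ N : Sussmann.ImmersiveStructure d S, N.topology = Sussmann.orbitTopology D m S h ∧
        (∀ x ∈ S, N.dim = Module.finrank ℝ (Sussmann.orbitDistribution D x)) ∧
        ∀ N' : Sussmann.ImmersiveStructure d S, N'.topology = Sussmann.orbitTopology D m S h → N'.Same N) ∧
    -- (ii) the non-trivial orbits are exactly the maximal integral manifolds
    (∀ (S : Set M) (N : Sussmann.ImmersiveStructure d S),
      N.IsMaximalIntegral (Sussmann.orbitDistribution D) ↔
        ∃ (m : M) (h : S = Sussmann.orbit D m), S ≠ {m} ∧ N.topology = Sussmann.orbitTopology D m S h) ∧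
    -- (iii) the maximal integral manifold property
    ((Sussmann.orbitDistribution D).IsSmooth ∧ (Sussmann.orbitDistribution D).HasMaximalIntegralManifolds) ∧
    -- (iv) involutivity
    (Sussmann.orbitDistribution D).IsInvolutive := by
  refine ⟨fun m S h hne ↦ ?_, fun S N ↦ Sussmann.isMaximalIntegral_iff hD N,
    ⟨Sussmann.orbitDistribution_isSmooth hD,
      Sussmann.orbitDistribution_hasMaximalIntegralManifolds hD⟩,
    Sussmann.orbitDistribution_isInvolutive hD⟩
  have hm : Sussmann.orbitDistribution D m ≠ ⊥ := fun hbot ↦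
    hne (h.trans ((Sussmann.orbitDistribution_eq_bot_iff hD).1 hbot))
  obtain ⟨N, hN, -, hdim⟩ := Sussmann.exists_immersiveStructure_orbit hD h hm
  refine ⟨N, hN, fun x hx ↦ ?_, fun N' hN' ↦
    Sussmann.ImmersiveStructure.same_of_topology_eq (hN'.trans hN.symm)⟩
  exact hdim.trans (Sussmann.finrank_orbitDistribution_of_mem_orbit (h ▸ hx)).symm
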